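/- **Setting.** Let $\mathcal D$ be a probability distribution on $\mathcal X\times\{\pm1\}$ with marginal $\mathcal D_{\mathcal X}$ and let $\mathcal H$ be a finite set of measurable classifiers $\mathcal X\to\{\pm1\}$. Put $\mathrm{err}(h)=\Pr(h(X)\ne Y)$ and let $h^*\in\mathcal H$ minimize $\mathrm{err}$ over $\mathcal H$. For $A\subseteq\mathcal H$ let $\mathrm{DIS}(A)=\{x:\exists h,h'\in A,\ h(x)\neq h'(x)\}$. The disagreement coefficient is $$\theta(h^*)=\sup_{r>0}\frac1r\,\mathcal D_{\mathcal X}\{x:\exists h\in\mathcal H,\ h(x)\ne h^*(x),\ \Pr(h(X)\ne h^*(X))\le r\}.$$ **Algorithm (Active Cover).** Inputs: $\alpha,\beta,\gamma,\eta,\xi,c_1,c_2,c_3\in\mathbb R$, a confidence $\delta$ with $0<\delta<1/e$ and $|\mathcal H|/\delta>\sqrt{192}$, and epoch ends $0=\tau_0<3=\tau_1<\dots<\tau_M=n$, $M\ge 1$, with $\tau_{m+1}\le2\tau_m$ for $1\le m<M$. With $\epsilon_m=32(\log(|\mathcal H|/\delta)+\log\tau_m)/\tau_m$ they satisfy $\alpha\ge1$,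 $\eta\ge864$, $\xi\le\frac1{8n\epsilon_M\log n}$, $\beta^2\le\frac{\eta}{864\gamma n\epsilon_M\log n}$, $\gamma\ge\eta/4$, $c_1\ge2\alpha\sqrt6$, $c_2\ge\eta c_1^2/4$, $c_3\ge1$. The examples $(X_i,Y_i)$, $1\le i\le n$, are i.i.d. from $\mathcal D$. Examples $1,2,3$ (epoch $1$) have their labels queried and enter the sample with weight $1$. Let $\tilde Z_m$ be the weighted sample of the first $m$ epochs and $\mathrm{err}(h,\tilde Z_m)=\tau_m^{-1}\sum_{(x,y,w)\in\tilde Z_m}w\,\mathbf 1(h(x)\ne y)$. For $2\le m\le M$, at the start of epoch $m$ (examples $\tau_{m-1}<i\le\tau_m$), let $h_m\in\arg\min_{h\in\mathcal H}\mathrm{err}(h,\tilde Z_{m-1})$, $\Delta_{m-1}=c_1\sqrt{\epsilon_{m-1}\mathrm{err}(h_m,\tilde Z_{m-1})}+c_2\epsilon_{m-1}\log\tau_{m-1}$, $A_m=\{h\in\mathcal H:\mathrm{err}(h,\tilde Z_{m-1})-\mathrm{err}(h_m,\tilde Z_{m-1})\le\gamma\Delta_{m-1}\}$, $D_m=\mathrm{DIS}(A_m)$,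 and let $P_m$ be a measurable minimizer of $\mathbb E_X[1/(1-P(X))]$ subject to $0\le P\le1$, $P\ge P_{\min,m}$ on $D_m$, and, for all $h\in\mathcal H$, $$\mathbb E_X\Big[\tfrac{\mathbf 1(h(X)\ne h_m(X),X\in D_m)}{P(X)}\Big]\le2\alpha^2\Pr(h(X)\ne h_m(X),X\in D_m)+2\beta^2\gamma\big(\mathrm{err}(h,\tilde Z_{m-1})-\mathrm{err}(h_m,\tilde Z_{m-1})\big)\tau_{m-1}\Delta_{m-1}+\xi\tau_{m-1}\Delta_{m-1}^2,$$ where $P_{\min,m}=\min\Big(c_3\Big/\Big(\sqrt{\tfrac{\tau_{m-1}\mathrm{err}(h_m,\tilde Z_{m-1})}{n\epsilon_M}}+\log\tau_{m-1}\Big),\tfrac12\Big)$. In epoch $m$, if $X_i\in D_m$ the label is queried with probability $P_m(X_i)$, given the past and the current example; if queried, $(X_i,Y_i,1/P_m(X_i))$ is added to the sample, otherwise an example of weight $0$ is. If $X_i\notin D_m$, the label is not queried and $(X_i,h_m(X_i),1)$ is added. Let $Q_i\in\{0,1\}$ indicate that label $i$ is queried (so $Q_1=Q_2=Q_3=1$),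 and let $\mathcal F_i$ be the information available after example $i$. **Statement.** There is an absolute integer $k$ such that for all $\zeta>0$, $0<\omega\le1$ and $\theta,\gamma,c_1,c_2\in\mathbb R$ there is a constant $C>0$, depending only on these numbers, with the following property. Suppose the algorithm is run as above with these $\gamma,c_1,c_2$, that $\theta(h^*)\le\theta$, and that Tsybakov's low-noise condition holds with $\varepsilon_0=1$: $$\Pr(h(X)\ne h^*(X))\le\zeta\,(\mathrm{err}(h)-\mathrm{err}(h^*))^\omega\quad\text{for all }h\in\mathcal H\text{ with }\mathrm{err}(h)-\mathrm{err}(h^*)\le1.$$ Put $B_m=C\,(\log\tau_m)^k\,\tau_m^{\frac{2(1-\omega)}{2-\omega}}\,\log(|\mathcal H|/\delta)$. Then there is an event $E$ of probability at least $1-\delta$ such that for all epochs $m=1,\dots,M$: 1. almost surely on $E$, $\ \sum_{i\le\tau_m}\mathbb E[Q_i\mid\mathcal F_{i-1}]\le B_m$; 2. $\mathbb E\big[\mathbf 1_E\sum_{i\le\tau_m}Q_i\big]\le B_m$; 3. $\mathbb E\big[\sum_{i\le\tau_m}Q_i\big]\le B_m+\delta\,\tau_m$. That is, up to the failure probability $\delta$,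 the expected number of label queries after $m$ epochs is $\tilde O\big(\tau_m^{2(1-\omega)/(2-\omega)}\log(|\mathcal H|/\delta)\big)$. -/

import Mathlib

open MeasureTheory ProbabilityTheory
open scoped ENNReal

namespace ActiveCover

/-- A binary classifier; the two labels `±1` are modelled by `Bool`. -/
abbrev Classifier (𝒳 : Type*) := 𝒳 → Bool

section Population

variable {𝒳 : Type*} [MeasurableSpace 𝒳]

/-- Expected error `err(h) = Pr(h(X) ≠ Y)`. -/
noncomputable def err (D : Measure (𝒳 × Bool)) (h : Classifier 𝒳) : ℝ :=
  D.real {z | h z.1 ≠ z.2}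

/-- `Pr_X(h(X) ≠ h'(X))`, where `X` follows the marginal of `D` on `𝒳`. -/
noncomputable def disagree (D : Measure (𝒳 × Bool)) (h h' : Classifier 𝒳) : ℝ :=
  D.fst.real {x | h x ≠ h' x}

/-- `hs` is an error minimizer in `H`. -/
def IsBest (D : Measure (𝒳 × Bool)) (H : Finset (Classifier 𝒳)) (hs : Classifier 𝒳) : Prop :=
  hs ∈ H ∧ ∀ h ∈ H, err D hs ≤ err D h

/-- The disagreement coefficient `θ(hs)`, a supremum over all radii `r > 0`. -/
noncomputable def disCoeff (D : Measure (𝒳 × Bool)) (H : Finset (Classifier 𝒳))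
    (hs : Classifier 𝒳) : ℝ≥0∞ :=
  ⨆ (r : ℝ) (_ : 0 < r),
    D.fst {x | ∃ h ∈ H, hs x ≠ h x ∧ disagree D h hs ≤ r} / ENNReal.ofReal r

/-- Tsybakov's low-noise condition with parameters `ζ`, `ω` and `ε₀`. -/
def Tsybakov (D : Measure (𝒳 × Bool)) (H : Finset (Classifier 𝒳)) (hs : Classifier 𝒳)
    (ζ ω ε₀ : ℝ) : Prop :=
  ∀ h ∈ H, err D h - err D hs ≤ ε₀ → disagree D h hs ≤ ζ * (err D h - err D hs) ^ ω

end Population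

/-- Disagreement region of a set of classifiers. -/
def dis {𝒳 : Type*} (A : Set (Classifier 𝒳)) : Set 𝒳 :=
  {x | ∃ h ∈ A, ∃ h' ∈ A, h x ≠ h' x}

/-- The inputs of the algorithm. `τ m` is the last example of epoch `m`, `M` the number of epochs,
so that `n = τ M` examples are processed. -/
structure Params where
  α : ℝ
  β : ℝ
  γ : ℝ
  η : ℝ
  ξ : ℝ
  c₁ : ℝ
  c₂ : ℝ
  c₃ : ℝ
  δ : ℝ
  M : ℕ
  τ : ℕ → ℕ

namespace Params

/-- Total number of examples. -/
def n (p : Params) : ℕ := p.τ p.M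

/-- `ε_m = 32 (log (N / δ) + log τ_m) / τ_m`, where `N` is the number of classifiers. -/
noncomputable def eps (p : Params) (N m : ℕ) : ℝ :=
  32 * (Real.log (N / p.δ) + Real.log (p.τ m)) / p.τ m

/-- The requirements on the inputs, for a class of `N` classifiers. -/
structure Valid (p : Params) (N : ℕ) : Prop where
  one_le_M : 1 ≤ p.M
  τ_zero : p.τ 0 = 0
  τ_one : p.τ 1 = 3
  τ_lt : ∀ m < p.M, p.τ m < p.τ (m + 1)
  τ_le : ∀ m, 1 ≤ m → m < p.M → p.τ (m + 1) ≤ 2 * p.τ m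
  α_ge : 1 ≤ p.α
  η_ge : 864 ≤ p.η
  ξ_le : p.ξ ≤ 1 / (8 * p.n * p.eps N p.M * Real.log p.n)
  β_le : p.β ^ 2 ≤ p.η / (864 * p.γ * p.n * p.eps N p.M * Real.log p.n)
  γ_ge : p.η / 4 ≤ p.γ
  c₁_ge : 2 * p.α * √6 ≤ p.c₁
  c₂_ge : p.η * p.c₁ ^ 2 / 4 ≤ p.c₂
  c₃_ge : 1 ≤ p.c₃
  δ_pos : 0 < p.δ
  δ_lt : p.δ < 1 / Real.exp 1
  card_div_δ : √192 < N / p.δ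

end Params

/-- Everything that is recorded in one execution. Examples are numbered from `1`.
`x i`, `y i` are the `i`-th point and its (possibly hidden) label, `q i` says whether that label is
queried, `(x i, y' i, w i)` is the importance weighted example added to the sample,
`h m` and `P m` are the classifier and the query probability function used in epoch `m`. -/
structure Trace (𝒳 : Type*) where
  x : ℕ → 𝒳
  y : ℕ → Bool
  q : ℕ → Bool
  y' : ℕ → Bool
  w : ℕ → ℝ
  h : ℕ → Classifier 𝒳
  P : ℕ → 𝒳 → ℝ

namespace Trace

variable {𝒳 : Type*}

/-- Importance weighted empirical error of `g` on the sample of the first `m` epochs, which has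
`τ m` elements. -/
noncomputable def empErr (t : Trace 𝒳) (p : Params) (m : ℕ) (g : Classifier 𝒳) : ℝ :=
  (∑ i ∈ Finset.Icc 1 (p.τ m), t.w i * (if g (t.x i) ≠ t.y' i then 1 else 0)) / p.τ m

/-- The threshold `Δ_m` (for `m ≥ 1`). -/
noncomputable def Δ (t : Trace 𝒳) (p : Params) (N m : ℕ) : ℝ :=
  p.c₁ * √(p.eps N m * t.empErr p m (t.h (m + 1))) + p.c₂ * p.eps N m * Real.log (p.τ m)

/-- The set `A_m` of good classifiers (for `m ≥ 2`). -/
noncomputable def A (t : Trace 𝒳) (p : Params) (H : Finset (Classifier 𝒳)) (m : ℕ) :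
    Set (Classifier 𝒳) :=
  {g | g ∈ H ∧ t.empErr p (m - 1) g - t.empErr p (m - 1) (t.h m) ≤ p.γ * t.Δ p H.card (m - 1)}

/-- The region `D_m = DIS(A_m)` in which labels may be queried in epoch `m` (for `m ≥ 2`). -/
noncomputable def region (t : Trace 𝒳) (p : Params) (H : Finset (Classifier 𝒳)) (m : ℕ) : Set 𝒳 :=
  dis (t.A p H m)

/-- The minimum query probability `P_{min,m}` (for `m ≥ 2`). -/
noncomputable def pMin (t : Trace 𝒳) (p : Params) (N m : ℕ) : ℝ :=
  min (p.c₃ / (√(p.τ (m - 1) * t.empErr p (m - 1) (t.h m) / (p.n * p.eps N p.M))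
    + Real.log (p.τ (m - 1)))) (1 / 2)

variable [MeasurableSpace 𝒳]

/-- The bound `b_m(g)` in the variance constraint of the optimization problem. -/
noncomputable def b (t : Trace 𝒳) (D : Measure (𝒳 × Bool)) (p : Params)
    (H : Finset (Classifier 𝒳)) (m : ℕ) (g : Classifier 𝒳) : ℝ :=
  2 * p.α ^ 2 * D.fst.real {x | g x ≠ t.h m x ∧ x ∈ t.region p H m}
    + 2 * p.β ^ 2 * p.γ * (t.empErr p (m - 1) g - t.empErr p (m - 1) (t.h m))
      * p.τ (m - 1) * t.Δ p H.card (m - 1)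
    + p.ξ * p.τ (m - 1) * t.Δ p H.card (m - 1) ^ 2

/-- Feasibility of `R` for the optimization problem of epoch `m`. -/
structure Feasible (t : Trace 𝒳) (D : Measure (𝒳 × Bool)) (p : Params)
    (H : Finset (Classifier 𝒳)) (m : ℕ) (R : 𝒳 → ℝ) : Prop where
  measurable : Measurable R
  variance : ∀ g ∈ H,
    ∫ x, Set.indicator {x | g x ≠ t.h m x ∧ x ∈ t.region p H m} (fun x => 1 / R x) x ∂D.fst
      ≤ t.b D p H m g
  nonneg : ∀ x, 0 ≤ R x
  le_one : ∀ x, R x ≤ 1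
  pMin_le : ∀ x ∈ t.region p H m, t.pMin p H.card m ≤ R x

/-- The objective `E_X[1 / (1 - R(X))]`, with `1 / 0 = ∞`. -/
noncomputable def objective (D : Measure (𝒳 × Bool)) (R : 𝒳 → ℝ) : ℝ≥0∞ :=
  ∫⁻ x, (ENNReal.ofReal (1 - R x))⁻¹ ∂D.fst

/-- The trace obeys the rules of the algorithm. Epoch `1` consists of the first three examples,
whose labels are always queried; the chance of a query in later epochs is specified in `IsRun`. -/
structure Follows (t : Trace 𝒳) (D : Measure (𝒳 × Bool)) (p : Params)
    (H : Finset (Classifier 𝒳)) : Prop where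
  /-- The first three labels are queried and enter the sample with weight one. -/
  start : ∀ i ∈ Finset.Icc 1 3, t.q i = true ∧ t.y' i = t.y i ∧ t.w i = 1
  /-- `h m` is an empirical risk minimizer on the sample of the first `m - 1` epochs. -/
  erm : ∀ m ∈ Finset.Icc 2 (p.M + 1),
    t.h m ∈ H ∧ ∀ g ∈ H, t.empErr p (m - 1) (t.h m) ≤ t.empErr p (m - 1) g
  /-- `P m` solves the optimization problem of epoch `m`. -/
  feasible : ∀ m ∈ Finset.Icc 2 p.M, t.Feasible D p H m (t.P m)
  optimal : ∀ m ∈ Finset.Icc 2 p.M, ∀ R, t.Feasible D p H m R →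
    objective D (t.P m) ≤ objective D R
  /-- In the region, a queried example enters with its label and inverse probability weight, and
  an example that is not queried enters with weight zero. -/
  queried : ∀ m ∈ Finset.Icc 2 p.M, ∀ i ∈ Finset.Ioc (p.τ (m - 1)) (p.τ m),
    t.x i ∈ t.region p H m → t.q i = true → t.y' i = t.y i ∧ t.w i = 1 / t.P m (t.x i)
  skipped : ∀ m ∈ Finset.Icc 2 p.M, ∀ i ∈ Finset.Ioc (p.τ (m - 1)) (p.τ m),
    t.x i ∈ t.region p H m → t.q i = false → t.y' i = true ∧ t.w i = 0
  /-- Outside the region, nothing is queried and the label predicted by `h m` is used. -/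
  predicted : ∀ m ∈ Finset.Icc 2 p.M, ∀ i ∈ Finset.Ioc (p.τ (m - 1)) (p.τ m),
    t.x i ∉ t.region p H m → t.q i = false ∧ t.y' i = t.h m (t.x i) ∧ t.w i = 1

/-- Indicator that the `i`-th label is queried. -/
def query (t : Trace 𝒳) (i : ℕ) : ℝ := if t.q i = true then 1 else 0

/-- Number of label queries in the first `m` epochs. -/
def numQueries (t : Trace 𝒳) (p : Params) (m : ℕ) : ℝ :=
  ∑ i ∈ Finset.Icc 1 (p.τ m), t.query i

end Trace

/-- `T` is a random execution of the algorithm on an i.i.d. stream from `D`. The σ-algebra `ℱ i`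
contains the information produced by the first `i` examples; it may be larger than the one that
they generate, so that ties may be broken at random. -/
structure IsRun {𝒳 Ω : Type*} [MeasurableSpace 𝒳] [mΩ : MeasurableSpace Ω]
    (D : Measure (𝒳 × Bool)) (H : Finset (Classifier 𝒳)) (p : Params)
    (μ : Measure Ω) (ℱ : Filtration ℕ mΩ) (T : Ω → Trace 𝒳) : Prop where
  follows : ∀ ω, (T ω).Follows D p H
  /-- The examples and the query decisions are adapted. -/
  measurable_example : ∀ i ∈ Finset.Icc 1 p.n,
    Measurable[ℱ i] fun ω => ((T ω).x i, (T ω).y i)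
  measurable_query : ∀ i ∈ Finset.Icc 1 p.n, Measurable[ℱ i] fun ω => (T ω).q i
  /-- `h m` and `P m` are determined at the end of epoch `m - 1`. -/
  measurable_h : ∀ m ∈ Finset.Icc 2 (p.M + 1), ∀ g ∈ H,
    MeasurableSet[ℱ (p.τ (m - 1))] {ω | (T ω).h m = g}
  measurable_P : ∀ m ∈ Finset.Icc 2 p.M,
    Measurable[(ℱ (p.τ (m - 1))).prod (inferInstance : MeasurableSpace 𝒳)]
      fun z : Ω × 𝒳 => (T z.1).P m z.2
  /-- Each labeled example has law `D` and is independent of the past. -/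
  law : ∀ i ∈ Finset.Icc 1 p.n, μ.map (fun ω => ((T ω).x i, (T ω).y i)) = D
  indep : ∀ i ∈ Finset.Icc 1 p.n,
    Indep (MeasurableSpace.comap (fun ω => ((T ω).x i, (T ω).y i)) inferInstance) (ℱ (i - 1)) μ
  /-- Given the past and the `i`-th labeled example, the `i`-th query decision in epoch `m` is a
  Bernoulli variable with parameter `P_m(X_i)` if `X_i` lies in the region, and `0` otherwise. -/
  draw : ∀ m ∈ Finset.Icc 2 p.M, ∀ i ∈ Finset.Ioc (p.τ (m - 1)) (p.τ m),
    μ[fun ω => (T ω).query i | ℱ (i - 1) ⊔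
        MeasurableSpace.comap (fun ω => ((T ω).x i, (T ω).y i)) inferInstance]
      =ᵐ[μ] fun ω => ((T ω).region p H m).indicator ((T ω).P m) ((T ω).x i)

end ActiveCover

namespace ActiveCover

/-! Inverse probability weights make the sample unbiased inside the disagreement region. Outside it
the inferred label h_m(x) is the label of h^*, as long as h^* has survived in A_m. The resulting
bias favors h^*: the expected sample loss of g minus that of h^* is at least err(g) - err(h^*)
(`err_sub_le_mean_sub`). It remains to control the deviations of cumulative weighted losses from the
sums of their conditional expectations.

This is done with Freedman's inequality. Two obstacles arise: the weights are suitably bounded only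
along good histories, and the right scale λ depends on the random threshold. So losses are
multiplied by λ and dropped where the query probability is below λ, which makes them bounded on
every history, and the inequality is used for all λ in a finite grid (`measure_score_gt_le`,
`measure_not_concentrated_le`).

On the resulting event, write a = τ_m ε_m and T = τ_m Δ_m. Strong induction over the epochs
(`Concentrated.controlled`) shows that nothing is dropped at a grid point λ between a/(γT) and
2a/(γT). The constraints on P bound the variance of loss differences by losses, by regrets of
earlier epochs and by T (`momSum_le`). Hence every deviation is at most half the conditional regret
plus γT/2, h^* stays in A_{m+1}, and all members of A_{m+1} have excess error at most 3γT/τ_m.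

The low-noise condition then places A_{m+1} in a ball around h^*, and the disagreement coefficient
bounds the mass of D_{m+1} (`Controlled.mass_le`). Let U be the sum, over the examples, of the
masses of the query regions. Since h^* incurs loss only in these regions, U bounds its expected
cumulative loss, so T is at most a constant times √(aU) + a log τ. Summing over the epochs gives U ≤
3 + K(√(aU) + a log τ)^ω τ^{1-ω} log τ (`Concentrated.massSum_le`), and solving for U
(`le_of_self_bound`) yields the exponent 2(1-ω)/(2-ω). Finally U dominates the sum of the
conditional query probabilities, and stopping that sum gives the bound in expectation
(`setIntegral_sum_le_of_condExp`). -/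

theorem exp_le_one_add_add_sq {x : ℝ} (hx : |x| ≤ 1) : Real.exp x ≤ 1 + x + x ^ 2 := by
  have := Real.abs_exp_sub_one_sub_id_le hx
  linarith [(abs_le.1 this).2]

/-! ### Conditional expectations and Freedman's inequality -/

section General

variable {Ω : Type*} {m mΩ : MeasurableSpace Ω} {μ : Measure Ω}

theorem integrable_of_abs_le [IsFiniteMeasure μ] {f : Ω → ℝ} (hf : Measurable f) {c : ℝ}
    (h : ∀ a, |f a| ≤ c) : Integrable f μ :=
  Integrable.of_bound hf.aestronglyMeasurable c (ae_of_all _ h)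

/-- Integrating against a bounded weight that is measurable for the conditioning σ-algebra. -/
theorem integral_mul_condExp [IsFiniteMeasure μ] (hm : m ≤ mΩ)
    {W f : Ω → ℝ} (hW : Measurable[m] W) {c : ℝ} (hc : ∀ a, |W a| ≤ c) (hf : Integrable f μ) :
    ∫ a, W a * f a ∂μ = ∫ a, W a * (μ[f|m]) a ∂μ := by
  have hint : Integrable (W * f) μ :=
    hf.bdd_mul (hW.mono hm le_rfl).aestronglyMeasurable (ae_of_all _ hc)
  have h1 : μ[W * f|m] =ᵐ[μ] W * μ[f|m] :=
    condExp_mul_of_stronglyMeasurable_left hW.stronglyMeasurable hint hf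
  calc ∫ a, W a * f a ∂μ = ∫ a, (μ[W * f|m]) a ∂μ := (integral_condExp hm).symm
    _ = _ := integral_congr_ae h1

theorem integral_mul_le_of_condExp_le [IsFiniteMeasure μ] (hm : m ≤ mΩ)
    {W f d : Ω → ℝ} (hW : Measurable[m] W) {c : ℝ} (hc : ∀ a, |W a| ≤ c) (hf : Integrable f μ)
    (hW0 : ∀ a, 0 ≤ W a) (hd : Integrable d μ) (h : μ[f|m] ≤ᵐ[μ] d) :
    ∫ a, W a * f a ∂μ ≤ ∫ a, W a * d a ∂μ := by
  rw [integral_mul_condExp hm hW hc hf]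
  refine integral_mono_ae
    (integrable_condExp.bdd_mul (hW.mono hm le_rfl).aestronglyMeasurable (ae_of_all _ hc))
    (hd.bdd_mul (hW.mono hm le_rfl).aestronglyMeasurable (ae_of_all _ hc)) ?_
  filter_upwards [h] with a ha
  exact mul_le_mul_of_nonneg_left ha (hW0 a)

/-- Freedman's exponential supermartingale. -/
theorem integral_exp_sum_sub_le_one [IsProbabilityMeasure μ] {ℱ : Filtration ℕ mΩ}
    {ξ d : ℕ → Ω → ℝ} {n : ℕ}
    (hξ : ∀ i ∈ Finset.Icc 1 n, Measurable[ℱ i] (ξ i))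
    (hd : ∀ i ∈ Finset.Icc 1 n, Measurable[ℱ (i - 1)] (d i))
    (hb : ∀ i ∈ Finset.Icc 1 n, ∀ a, |ξ i a| ≤ 1)
    (hdb : ∀ i ∈ Finset.Icc 1 n, ∀ a, |d i a| ≤ 2)
    (h : ∀ i ∈ Finset.Icc 1 n, μ[fun a => ξ i a + ξ i a ^ 2|ℱ (i - 1)] ≤ᵐ[μ] d i) :
    ∫ a, Real.exp (∑ i ∈ Finset.Icc 1 n, (ξ i a - d i a)) ∂μ ≤ 1 := by
  induction n with
  | zero => simp
  | succ n ih =>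
    have hsub : ∀ i ∈ Finset.Icc 1 n, i ∈ Finset.Icc 1 (n + 1) := fun i hi => by
      simp only [Finset.mem_Icc] at hi ⊢; omega
    have hlast : n + 1 ∈ Finset.Icc 1 (n + 1) := by simp
    specialize ih (fun i hi => hξ i (hsub i hi)) (fun i hi => hd i (hsub i hi))
      (fun i hi => hb i (hsub i hi)) (fun i hi => hdb i (hsub i hi)) (fun i hi => h i (hsub i hi))
    have hξl := hξ _ hlast
    have hdl := hd _ hlast
    have hl := h _ hlast
    have hbl := hb _ hlast
    have hdbl := hdb _ hlast
    rw [Nat.add_sub_cancel] at hdl hl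
    set S : Ω → ℝ := fun a => ∑ i ∈ Finset.Icc 1 n, (ξ i a - d i a) with hS
    have hSm : Measurable[ℱ n] S := by
      refine Finset.measurable_sum _ fun i hi => ?_
      have hi' := Finset.mem_Icc.1 hi
      exact ((hξ i (hsub i hi)).mono (ℱ.mono hi'.2) le_rfl).sub
        ((hd i (hsub i hi)).mono (ℱ.mono (by omega)) le_rfl)
    have hSb : ∀ a, |S a| ≤ n * 3 := fun a => by
      calc |S a| ≤ ∑ i ∈ Finset.Icc 1 n, |ξ i a - d i a| := Finset.abs_sum_le_sum_abs _ _
        _ ≤ ∑ i ∈ Finset.Icc 1 n, (3 : ℝ) := Finset.sum_le_sum fun i hi => by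
            linarith [abs_sub (ξ i a) (d i a), hb i (hsub i hi) a, hdb i (hsub i hi) a]
        _ = n * 3 := by simp
    -- W is the factor known before example n + 1. The chain is E[W e^ξ] ≤ E[W(1 + ξ + ξ²)] ≤ E[W(1
    -- + d)] ≤ E[W e^d] = E[e^S].
    set W : Ω → ℝ := fun a => Real.exp (S a - d (n + 1) a) with hWdef
    have hWm : Measurable[ℱ n] W := Real.measurable_exp.comp (hSm.sub hdl)
    have hWb : ∀ a, |W a| ≤ Real.exp (n * 3 + 2) := fun a => by
      rw [abs_of_pos (Real.exp_pos _)]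
      apply Real.exp_le_exp.2
      linarith [(abs_le.1 (hSb a)).2, (abs_le.1 (hdbl a)).1]
    have hξm : Measurable (ξ (n + 1)) := hξl.mono (ℱ.le _) le_rfl
    have hdm : Measurable (d (n + 1)) := hdl.mono (ℱ.le _) le_rfl
    have hWM : Measurable W := hWm.mono (ℱ.le _) le_rfl
    have hSM : Measurable S := hSm.mono (ℱ.le _) le_rfl
    have hsq : ∀ a, ξ (n + 1) a ^ 2 ≤ 1 := fun a => by
      rw [← sq_abs]; exact pow_le_one₀ (abs_nonneg _) (hbl a)
    have hint1 : Integrable (fun a => ξ (n + 1) a + ξ (n + 1) a ^ 2) μ :=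
      integrable_of_abs_le (c := 2) (by fun_prop) fun a => by
        rw [abs_le]; constructor <;>
        nlinarith [(abs_le.1 (hbl a)).1, (abs_le.1 (hbl a)).2, hsq a, sq_nonneg (ξ (n + 1) a)]
    have hint2 : Integrable (d (n + 1)) μ := integrable_of_abs_le hdm hdbl
    have hWi : Integrable W μ := integrable_of_abs_le hWM hWb
    have bddmul : ∀ f : Ω → ℝ, Integrable f μ → Integrable (fun a => W a * f a) μ := fun f hf =>
      hf.bdd_mul hWM.aestronglyMeasurable (ae_of_all _ hWb)
    have hle := integral_mul_le_of_condExp_le (ℱ.le n) hWm hWb hint1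
      (fun a => (Real.exp_pos _).le) hint2 hl
    calc ∫ a, Real.exp (∑ i ∈ Finset.Icc 1 (n + 1), (ξ i a - d i a)) ∂μ
        ≤ ∫ a, (W a + W a * (ξ (n + 1) a + ξ (n + 1) a ^ 2)) ∂μ := by
          refine integral_mono_of_nonneg (ae_of_all _ fun a => (Real.exp_pos _).le)
            (hWi.add (bddmul _ hint1)) (ae_of_all _ fun a => ?_)
          simp only
          rw [Finset.sum_Icc_succ_top (by omega)]
          have : Real.exp (∑ i ∈ Finset.Icc 1 n, (ξ i a - d i a) + (ξ (n + 1) a - d (n + 1) a))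
              = W a * Real.exp (ξ (n + 1) a) := by
            rw [hWdef, ← Real.exp_add]; congr 1; simp only [hS]; ring
          rw [this]
          nlinarith [exp_le_one_add_add_sq (hbl a), Real.exp_pos (S a - d (n + 1) a)]
      _ = ∫ a, W a ∂μ + ∫ a, W a * (ξ (n + 1) a + ξ (n + 1) a ^ 2) ∂μ :=
          integral_add hWi (bddmul _ hint1)
      _ ≤ ∫ a, W a ∂μ + ∫ a, W a * d (n + 1) a ∂μ := by linarith
      _ = ∫ a, (W a + W a * d (n + 1) a) ∂μ := (integral_add hWi (bddmul _ hint2)).symm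
      _ ≤ ∫ a, Real.exp (S a) ∂μ := by
          refine integral_mono (hWi.add (bddmul _ hint2))
            (integrable_of_abs_le (c := Real.exp (n * 3)) (Real.measurable_exp.comp hSM)
              fun a => ?_) fun a => ?_
          · rw [abs_of_pos (Real.exp_pos _)]
            exact Real.exp_le_exp.2 (abs_le.1 (hSb a)).2
          · have : Real.exp (S a) = W a * Real.exp (d (n + 1) a) := by
              rw [hWdef, ← Real.exp_add]; congr 1; ring
            simp only
            rw [this]
            nlinarith [Real.add_one_le_exp (d (n + 1) a), Real.exp_pos (S a - d (n + 1) a)]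
      _ ≤ 1 := ih

/-- Freedman's inequality in exponential form. -/
theorem measure_sum_sub_ge_le [IsProbabilityMeasure μ] {ℱ : Filtration ℕ mΩ}
    {ξ d : ℕ → Ω → ℝ} {n : ℕ}
    (hξ : ∀ i ∈ Finset.Icc 1 n, Measurable[ℱ i] (ξ i))
    (hd : ∀ i ∈ Finset.Icc 1 n, Measurable[ℱ (i - 1)] (d i))
    (hb : ∀ i ∈ Finset.Icc 1 n, ∀ a, |ξ i a| ≤ 1)
    (hdb : ∀ i ∈ Finset.Icc 1 n, ∀ a, |d i a| ≤ 2)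
    (h : ∀ i ∈ Finset.Icc 1 n, μ[fun a => ξ i a + ξ i a ^ 2|ℱ (i - 1)] ≤ᵐ[μ] d i) (s : ℝ) :
    μ.real {a | s < ∑ i ∈ Finset.Icc 1 n, (ξ i a - d i a)} ≤ Real.exp (-s) := by
  have h1 := integral_exp_sum_sub_le_one hξ hd hb hdb h
  have hM : Measurable fun a => ∑ i ∈ Finset.Icc 1 n, (ξ i a - d i a) :=
    Finset.measurable_sum _ fun i hi =>
      ((hξ i hi).mono (ℱ.le _) le_rfl).sub ((hd i hi).mono (ℱ.le _) le_rfl)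
  have hSb : ∀ a, |∑ i ∈ Finset.Icc 1 n, (ξ i a - d i a)| ≤ n * 3 := fun a => by
    calc _ ≤ ∑ i ∈ Finset.Icc 1 n, |ξ i a - d i a| := Finset.abs_sum_le_sum_abs _ _
      _ ≤ ∑ i ∈ Finset.Icc 1 n, (3 : ℝ) := Finset.sum_le_sum fun i hi => by
          linarith [abs_sub (ξ i a) (d i a), hb i hi a, hdb i hi a]
      _ = n * 3 := by simp
  have hint : Integrable (fun a => Real.exp (∑ i ∈ Finset.Icc 1 n, (ξ i a - d i a))) μ :=
    integrable_of_abs_le (c := Real.exp (n * 3)) (Real.measurable_exp.comp hM) fun a => by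
      rw [abs_of_pos (Real.exp_pos _)]
      exact Real.exp_le_exp.2 (abs_le.1 (hSb a)).2
  have h2 := mul_meas_ge_le_integral_of_nonneg
    (ae_of_all μ fun a => (Real.exp_pos (∑ i ∈ Finset.Icc 1 n, (ξ i a - d i a))).le) hint
    (Real.exp s)
  have h3 : μ.real {a | s < ∑ i ∈ Finset.Icc 1 n, (ξ i a - d i a)}
      ≤ μ.real {a | Real.exp s ≤ Real.exp (∑ i ∈ Finset.Icc 1 n, (ξ i a - d i a))} :=
    measureReal_mono fun a ha => Real.exp_le_exp.2 (le_of_lt ha)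
  rw [Real.exp_neg, ← one_div, le_div_iff₀ (Real.exp_pos s)]
  nlinarith [Real.exp_pos s]

variable {𝒵 : Type*} [MeasurableSpace 𝒵]

/-- Fubini for the product law of the pair. The space `Ω'` is general so that W can be the identity
into Ω with a smaller σ-algebra. -/
theorem integral_comp_of_indepFun {Ω' : Type*} [MeasurableSpace Ω'] [IsProbabilityMeasure μ]
    {W : Ω → Ω'} {Z : Ω → 𝒵} (hW : Measurable W) (hZ : Measurable Z) (hind : W ⟂ᵢ[μ] Z)
    {φ : Ω' × 𝒵 → ℝ} (hφ : Measurable φ) {c : ℝ} (hc : ∀ z, |φ z| ≤ c) :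
    ∫ a, φ (W a, Z a) ∂μ = ∫ a, ∫ z, φ (W a, z) ∂(μ.map Z) ∂μ := by
  have hWp : IsProbabilityMeasure (μ.map W) := Measure.isProbabilityMeasure_map hW.aemeasurable
  have hZp : IsProbabilityMeasure (μ.map Z) := Measure.isProbabilityMeasure_map hZ.aemeasurable
  have hmap := (indepFun_iff_map_prod_eq_prod_map_map hW.aemeasurable hZ.aemeasurable).1 hind
  have t1 := integral_map (μ := μ) (hW.prodMk hZ).aemeasurable
    (f := φ) hφ.aestronglyMeasurable
  rw [← t1, hmap, integral_prod φ (integrable_of_abs_le hφ hc)]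
  exact integral_map hW.aemeasurable
    hφ.stronglyMeasurable.integral_prod_right'.aestronglyMeasurable

/-- Conditional expectation of a function of the past and of an independent variable. -/
theorem condExp_comp_of_indep [IsProbabilityMeasure μ] (hm : m ≤ mΩ)
    {Z : Ω → 𝒵} (hZ : Measurable Z) (hind : Indep (MeasurableSpace.comap Z inferInstance) m μ)
    {ψ : Ω × 𝒵 → ℝ} (hψ : Measurable[m.prod inferInstance] ψ) {c : ℝ} (hc : ∀ z, |ψ z| ≤ c) :
    μ[fun a => ψ (a, Z a)|m] =ᵐ[μ] fun a => ∫ z, ψ (a, z) ∂(μ.map Z) := by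
  -- The past is encoded as the random element `id` with values in Ω equipped with m, so that
  -- independence of σ-algebras becomes independence of two random elements.
  have hid : @Measurable Ω Ω mΩ m id := measurable_id'' hm
  have hif : @IndepFun Ω Ω 𝒵 mΩ m _ id Z μ := by
    refine (@IndepFun_iff_Indep Ω Ω 𝒵 mΩ m _ id Z μ).2 ?_
    rw [MeasurableSpace.comap_id]
    exact hind.symm
  have hcpos : 0 ≤ c := by
    obtain ⟨a⟩ := μ.nonempty_of_neZero
    exact (abs_nonneg _).trans (hc (a, Z a))
  have hpair : @Measurable Ω (Ω × 𝒵) mΩ (m.prod inferInstance) (fun a => (a, Z a)) := by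
    have h1 : @Measurable Ω Ω mΩ m (fun a => a) := measurable_id'' hm
    exact h1.prodMk hZ
  have hpm : IsProbabilityMeasure (μ.map Z) := Measure.isProbabilityMeasure_map hZ.aemeasurable
  have hψm : Measurable[m] fun a => ∫ z, ψ (a, z) ∂(μ.map Z) :=
    (@StronglyMeasurable.integral_prod_right' Ω 𝒵 ℝ m _ _ _ _ _ ψ
      hψ.stronglyMeasurable).measurable
  have hcomp : Measurable fun a => ψ (a, Z a) := hψ.comp hpair
  have hb : ∀ a, |∫ z, ψ (a, z) ∂(μ.map Z)| ≤ c := fun a => by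
    have := norm_integral_le_of_norm_le_const (μ := μ.map Z) (f := fun z => ψ (a, z)) (C := c)
      (ae_of_all _ fun z => hc (a, z))
    simpa using this
  symm
  refine ae_eq_condExp_of_forall_setIntegral_eq hm (integrable_of_abs_le hcomp fun a => hc _)
    (fun s _ _ => (integrable_of_abs_le (hψm.mono hm le_rfl) hb).integrableOn)
    (fun s hs _ => ?_) hψm.stronglyMeasurable.aestronglyMeasurable
  set φ : Ω × 𝒵 → ℝ := fun z => s.indicator (fun _ => (1 : ℝ)) z.1 * ψ z with hφ
  have hφm : Measurable[m.prod inferInstance] φ := by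
    refine Measurable.mul ?_ hψ
    exact (measurable_const.indicator hs).comp (@measurable_fst Ω 𝒵 m _)
  have hφb : ∀ z, |φ z| ≤ c := fun z => by
    by_cases hz : z.1 ∈ s
    · simpa [hφ, hz] using hc z
    · simpa [hφ, hz] using hcpos
  have e1 : ∀ f : Ω → ℝ, ∫ a in s, f a ∂μ = ∫ a, s.indicator (fun _ => (1 : ℝ)) a * f a ∂μ := by
    intro f
    rw [← integral_indicator (hm s hs)]
    congr 1; ext a
    by_cases ha : a ∈ s <;> simp [ha]
  rw [e1, e1]
  have e2 : ∫ a, φ (a, Z a) ∂μ = ∫ a, ∫ z, φ (a, z) ∂(μ.map Z) ∂μ :=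
    @integral_comp_of_indepFun Ω mΩ μ 𝒵 _ Ω m _ id Z hid hZ hif φ hφm c hφb
  calc _ = ∫ a, ∫ z, φ (a, z) ∂(μ.map Z) ∂μ := by
        congr 1; ext a; simp only [hφ]; rw [integral_const_mul]
    _ = _ := e2.symm

/-- As `condExp_comp_of_indep`, with an additional randomization whose conditional expectation,
given the past and the independent variable, is `ρ`. -/
theorem condExp_randomized [IsProbabilityMeasure μ] (hm : m ≤ mΩ)
    {Z : Ω → 𝒵} (hZ : Measurable Z) (hind : Indep (MeasurableSpace.comap Z inferInstance) m μ)
    {q : Ω → ℝ} (hq : Measurable q) (hqb : ∀ a, |q a| ≤ 1) {ρ φ χ : Ω × 𝒵 → ℝ}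
    (hρ : Measurable[m.prod inferInstance] ρ) (hφ : Measurable[m.prod inferInstance] φ)
    (hχ : Measurable[m.prod inferInstance] χ) {c : ℝ} (hρb : ∀ z, |ρ z| ≤ 1)
    (hφb : ∀ z, |φ z| ≤ c) (hχb : ∀ z, |χ z| ≤ c)
    (hdraw : μ[q|m ⊔ MeasurableSpace.comap Z inferInstance] =ᵐ[μ] fun a => ρ (a, Z a)) :
    μ[fun a => q a * φ (a, Z a) + χ (a, Z a)|m]
      =ᵐ[μ] fun a => ∫ z, (ρ (a, z) * φ (a, z) + χ (a, z)) ∂(μ.map Z) := by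
  have hm' : m ⊔ MeasurableSpace.comap Z inferInstance ≤ mΩ := sup_le hm hZ.comap_le
  have hpair' : @Measurable Ω (Ω × 𝒵) (m ⊔ MeasurableSpace.comap Z inferInstance)
      (m.prod inferInstance) (fun a => (a, Z a)) := by
    have h1 : @Measurable Ω Ω (m ⊔ MeasurableSpace.comap Z inferInstance) m (fun a => a) :=
      measurable_id'' le_sup_left
    exact h1.prodMk ((comap_measurable Z).mono le_sup_right le_rfl)
  have hpair : @Measurable Ω (Ω × 𝒵) mΩ (m.prod inferInstance) (fun a => (a, Z a)) :=
    hpair'.mono hm' le_rfl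
  have hφ' := hφ.comp hpair'
  have hχ' := hχ.comp hpair'
  have hqi : Integrable q μ := integrable_of_abs_le hq hqb
  have hqφ : Integrable (fun a => q a * φ (a, Z a)) μ :=
    integrable_of_abs_le (c := 1 * c) (hq.mul (hφ.comp hpair)) fun a => by
      rw [abs_mul]
      exact mul_le_mul (hqb a) (hφb _) (abs_nonneg _) zero_le_one
  have hχi : Integrable (fun a => χ (a, Z a)) μ :=
    integrable_of_abs_le (hχ.comp hpair) fun a => hχb _
  have h1 : μ[(fun a => q a * φ (a, Z a))|m ⊔ MeasurableSpace.comap Z inferInstance]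
      =ᵐ[μ] fun a => ρ (a, Z a) * φ (a, Z a) := by
    have := condExp_mul_of_stronglyMeasurable_right (μ := μ) (f := q)
      (g := fun a => φ (a, Z a)) hφ'.stronglyMeasurable hqφ hqi
    refine this.trans ?_
    filter_upwards [hdraw] with a ha
    simp [ha]
  have h2 : μ[fun a => q a * φ (a, Z a) + χ (a, Z a)|m ⊔ MeasurableSpace.comap Z inferInstance]
      =ᵐ[μ] fun a => ρ (a, Z a) * φ (a, Z a) + χ (a, Z a) := by
    refine (condExp_add hqφ hχi _).trans ?_
    rw [condExp_of_stronglyMeasurable hm' (f := fun a => χ (a, Z a)) hχ'.stronglyMeasurable hχi]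
    filter_upwards [h1] with a ha
    simp [ha]
  -- Tower property: first average the query draw given the past and the example, then the example
  -- given the past.
  have h3 := (condExp_condExp_of_le (μ := μ)
    (f := fun a => q a * φ (a, Z a) + χ (a, Z a))
    (le_sup_left : m ≤ m ⊔ MeasurableSpace.comap Z inferInstance) hm').symm
  refine h3.trans ((condExp_congr_ae h2).trans ?_)
  refine condExp_comp_of_indep hm hZ hind (ψ := fun z => ρ z * φ z + χ z) (c := 1 * c + c)
    ((hρ.mul hφ).add hχ) fun z => ?_
  refine (abs_add_le _ _).trans (add_le_add ?_ (hχb z))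
  rw [abs_mul]
  exact mul_le_mul (hρb z) (hφb z) (abs_nonneg _) zero_le_one

/-- If the conditional expectations of nonnegative bounded variables sum to at most `B` on an
event, then the expectation of their sum over this event is at most `B`. -/
theorem setIntegral_sum_le_of_condExp [IsProbabilityMeasure μ] {ℱ : Filtration ℕ mΩ}
    {f : ℕ → Ω → ℝ} {n : ℕ} (hf : ∀ i ∈ Finset.Icc 1 n, Measurable (f i))
    (hf0 : ∀ i ∈ Finset.Icc 1 n, ∀ a, 0 ≤ f i a) (hf1 : ∀ i ∈ Finset.Icc 1 n, ∀ a, f i a ≤ 1)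
    {E : Set Ω} (hE : MeasurableSet E) {B : ℝ} (hB : 0 ≤ B)
    (h : ∀ᵐ a ∂μ, a ∈ E → ∑ i ∈ Finset.Icc 1 n, (μ[f i|ℱ (i - 1)]) a ≤ B) :
    ∫ a in E, ∑ i ∈ Finset.Icc 1 n, f i a ∂μ ≤ B := by
  set v : ℕ → Ω → ℝ := fun i => μ[f i|ℱ (i - 1)] with hv
  have hvm : ∀ i, Measurable[ℱ (i - 1)] (v i) := fun i => stronglyMeasurable_condExp.measurable
  have hfi : ∀ i ∈ Finset.Icc 1 n, Integrable (f i) μ := fun i hi =>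
    integrable_of_abs_le (c := 1) (hf i hi) fun a => by
      rw [abs_of_nonneg (hf0 i hi a)]; exact hf1 i hi a
  have hv0 : ∀ᵐ a ∂μ, ∀ i ∈ Finset.Icc 1 n, 0 ≤ v i a := by
    rw [Filter.eventually_all_finset]
    exact fun i hi => condExp_nonneg (ae_of_all _ (hf0 i hi))
  -- E need not belong to the past of any example, so it cannot be carried through conditional
  -- expectations. It is replaced by predictable indicators that the conditional expectations up to
  -- i sum to at most B. Almost surely on E all of them are 1, and the sum they stop is almost
  -- everywhere at most B.
  set I : ℕ → Ω → ℝ := fun i =>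
    {a | ∑ k ∈ Finset.Icc 1 i, v k a ≤ B}.indicator fun _ => 1 with hI
  have hIm : ∀ i, Measurable[ℱ (i - 1)] (I i) := fun i => by
    refine measurable_const.indicator (measurableSet_le ?_ measurable_const)
    refine Finset.measurable_sum _ fun k hk => (hvm k).mono (ℱ.mono ?_) le_rfl
    have := Finset.mem_Icc.1 hk; omega
  have hIb : ∀ i a, |I i a| ≤ 1 := fun i a => by
    simp only [hI, Set.indicator]; split_ifs <;> simp
  have hI0 : ∀ i a, 0 ≤ I i a := fun i a => by
    simp only [hI, Set.indicator]; split_ifs <;> simp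
  have hint : ∀ i ∈ Finset.Icc 1 n, ∀ g : Ω → ℝ, Integrable g μ →
      Integrable (fun a => I i a * g a) μ := fun i _ g hg =>
    hg.bdd_mul ((hIm i).mono (ℱ.le _) le_rfl).aestronglyMeasurable (ae_of_all _ (hIb i))
  have key : ∀ j ≤ n, ∀ a, (∀ i ∈ Finset.Icc 1 n, 0 ≤ v i a) →
      ∑ i ∈ Finset.Icc 1 j, I i a * v i a ≤ B := by
    intro j hj a ha
    induction j with
    | zero => simpa using hB
    | succ j ih =>
      rw [Finset.sum_Icc_succ_top (by omega)]
      by_cases hle : ∑ k ∈ Finset.Icc 1 (j + 1), v k a ≤ B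
      · have h1 : ∑ i ∈ Finset.Icc 1 j, I i a * v i a ≤ ∑ i ∈ Finset.Icc 1 j, v i a :=
          Finset.sum_le_sum fun i hi => by
            have hi' := Finset.mem_Icc.1 hi
            nlinarith [ha i (Finset.mem_Icc.2 ⟨hi'.1, by omega⟩), (abs_le.1 (hIb i a)).2]
        rw [Finset.sum_Icc_succ_top (by omega)] at hle
        nlinarith [ha (j + 1) (Finset.mem_Icc.2 ⟨by omega, hj⟩), (abs_le.1 (hIb (j + 1) a)).2]
      · have : I (j + 1) a = 0 := by
          simp only [hI, Set.indicator, Set.mem_ofPred_eq, if_neg hle]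
        rw [this]
        simpa using ih (by omega)
  rw [← integral_indicator hE]
  calc ∫ a, E.indicator (fun a => ∑ i ∈ Finset.Icc 1 n, f i a) a ∂μ
      ≤ ∫ a, ∑ i ∈ Finset.Icc 1 n, I i a * f i a ∂μ := by
        refine integral_mono_ae ((integrable_finsetSum _ hfi).indicator hE)
          (integrable_finsetSum _ fun i hi => hint i hi _ (hfi i hi)) ?_
        filter_upwards [h, hv0] with a ha hva
        by_cases hEa : a ∈ E
        · rw [Set.indicator_of_mem hEa]
          refine Finset.sum_le_sum fun i hi => ?_
          have hle : ∑ k ∈ Finset.Icc 1 i, v k a ≤ B :=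
            (Finset.sum_le_sum_of_subset_of_nonneg
              (Finset.Icc_subset_Icc_right (Finset.mem_Icc.1 hi).2)
              fun k hk _ => hva k hk).trans (ha hEa)
          have : I i a = 1 := by
            simp only [hI, Set.indicator, Set.mem_ofPred_eq, if_pos hle]
          rw [this, one_mul]
        · rw [Set.indicator_of_notMem hEa]
          exact Finset.sum_nonneg fun i hi => mul_nonneg (hI0 i a) (hf0 i hi a)
    _ = ∑ i ∈ Finset.Icc 1 n, ∫ a, I i a * f i a ∂μ :=
        integral_finsetSum _ fun i hi => hint i hi _ (hfi i hi)
    _ = ∑ i ∈ Finset.Icc 1 n, ∫ a, I i a * v i a ∂μ :=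
        Finset.sum_congr rfl fun i hi => integral_mul_condExp (ℱ.le _) (hIm i) (hIb i) (hfi i hi)
    _ = ∫ a, ∑ i ∈ Finset.Icc 1 n, I i a * v i a ∂μ :=
        (integral_finsetSum _ fun i hi => hint i hi _ integrable_condExp).symm
    _ ≤ ∫ _, B ∂μ := by
        refine integral_mono_ae
          (integrable_finsetSum _ fun i hi => hint i hi _ integrable_condExp)
          (integrable_const B) ?_
        filter_upwards [hv0] with a ha
        exact key n le_rfl a ha
    _ = B := by simp

end General

/-! ### Epochs and sums over them -/

namespace Params

/-- The epoch to which the `i`-th example belongs. -/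
noncomputable def epoch (p : Params) (i : ℕ) : ℕ := sInf {j | i ≤ p.τ j}

variable {p : Params} {N : ℕ}

theorem Valid.τ_le_τ (hv : p.Valid N) {j k : ℕ} (hjk : j ≤ k) (hk : k ≤ p.M) :
    p.τ j ≤ p.τ k := by
  induction k with
  | zero => simp_all
  | succ k ih =>
    rcases Nat.lt_or_ge j (k + 1) with h | h
    · exact (ih (by omega) (by omega)).trans (hv.τ_lt k (by omega)).le
    · rw [le_antisymm hjk h]

theorem Valid.three_le_τ (hv : p.Valid N) {j : ℕ} (hj : 1 ≤ j) (hjM : j ≤ p.M) : 3 ≤ p.τ j :=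
  hv.τ_one ▸ hv.τ_le_τ hj hjM

/-- Makes the failure probabilities of the epochs, bounded by δ / τ_m², summable. -/
theorem Valid.add_two_le_τ (hv : p.Valid N) {j : ℕ} (hj : 1 ≤ j) (hjM : j ≤ p.M) :
    j + 2 ≤ p.τ j := by
  induction j with
  | zero => omega
  | succ j ih =>
    rcases Nat.eq_zero_or_pos j with rfl | h
    · exact hv.τ_one.ge
    · have := ih h (by omega)
      have := hv.τ_lt j (by omega)
      omega

theorem Valid.epoch_eq (hv : p.Valid N) {i j : ℕ} (hjM : j ≤ p.M)
    (hi : i ∈ Finset.Ioc (p.τ (j - 1)) (p.τ j)) : p.epoch i = j := by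
  obtain ⟨h1, h2⟩ := Finset.mem_Ioc.1 hi
  refine le_antisymm (Nat.sInf_le h2) ?_
  by_contra! hlt
  have hmem : i ≤ p.τ (p.epoch i) := Nat.sInf_mem (s := {j | i ≤ p.τ j}) ⟨j, h2⟩
  have := hv.τ_le_τ (show p.epoch i ≤ j - 1 by omega) (by omega)
  omega

theorem Valid.mem_epoch (hv : p.Valid N) {i : ℕ} (hi : i ∈ Finset.Icc 1 p.n) :
    p.epoch i ∈ Finset.Icc 1 p.M ∧
      i ∈ Finset.Ioc (p.τ (p.epoch i - 1)) (p.τ (p.epoch i)) := by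
  obtain ⟨h1, h2⟩ := Finset.mem_Icc.1 hi
  have hmem : i ≤ p.τ (p.epoch i) := Nat.sInf_mem (s := {j | i ≤ p.τ j}) ⟨p.M, h2⟩
  have hle : p.epoch i ≤ p.M := Nat.sInf_le h2
  have hpos : 1 ≤ p.epoch i := by
    by_contra! h
    have h0 : p.epoch i = 0 := by omega
    rw [h0, hv.τ_zero] at hmem
    omega
  refine ⟨Finset.mem_Icc.2 ⟨hpos, hle⟩, Finset.mem_Ioc.2 ⟨?_, hmem⟩⟩
  by_contra! h
  have : p.epoch i ≤ p.epoch i - 1 := Nat.sInf_le h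
  omega

/-- The number of examples of epoch `j`. -/
def len (p : Params) (j : ℕ) : ℝ := (p.τ j : ℝ) - p.τ (j - 1)

theorem Valid.len_nonneg (hv : p.Valid N) {j : ℕ} (hj : j ≤ p.M) : 0 ≤ p.len j :=
  sub_nonneg.2 (Nat.cast_le.2 (hv.τ_le_τ (Nat.sub_le _ _) hj))

theorem Valid.sum_epochs (hv : p.Valid N) (f : ℕ → ℝ) {m : ℕ} (hm : m ≤ p.M) :
    ∑ i ∈ Finset.Icc 1 (p.τ m), f i
      = ∑ j ∈ Finset.Icc 1 m, ∑ i ∈ Finset.Ioc (p.τ (j - 1)) (p.τ j), f i := by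
  induction m with
  | zero => simp [hv.τ_zero]
  | succ m ih =>
    rw [Finset.sum_Icc_succ_top (by omega), ← ih (by omega), Nat.add_sub_cancel]
    have e : ∀ k, Finset.Icc 1 k = Finset.Ioc 0 k := fun k => by ext; simp; omega
    rw [e, e, Finset.sum_Ioc_consecutive _ (Nat.zero_le _) (hv.τ_lt m (by omega)).le]

theorem Valid.sum_epoch (hv : p.Valid N) (f : ℕ → ℝ) {m : ℕ} (hm : m ≤ p.M) :
    ∑ i ∈ Finset.Icc 1 (p.τ m), f (p.epoch i) = ∑ j ∈ Finset.Icc 1 m, p.len j * f j := by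
  rw [hv.sum_epochs _ hm]
  refine Finset.sum_congr rfl fun j hj => ?_
  have hj' := Finset.mem_Icc.1 hj
  rw [Finset.sum_congr rfl fun i hi => by rw [hv.epoch_eq (by omega) hi], Finset.sum_const,
    Nat.card_Ioc, nsmul_eq_mul, Nat.cast_sub (hv.τ_le_τ (Nat.sub_le _ _) (by omega)), len]

end Params

/-! ### Truncated scores and their drift -/

namespace Trace

variable {𝒳 : Type*}

/-- The query region, where everything is queried in the first epoch. -/
noncomputable def qreg (t : Trace 𝒳) (p : Params) (H : Finset (Classifier 𝒳)) (j : ℕ) : Set 𝒳 :=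
  if j ≤ 1 then Set.univ else t.region p H j

/-- The query probability function, which is `1` in the first epoch. -/
noncomputable def qprob (t : Trace 𝒳) (j : ℕ) (x : 𝒳) : ℝ := if j ≤ 1 then 1 else t.P j x

open Classical in
/-- The label with which `z` enters the sample in epoch `j`, unless it is skipped. -/
noncomputable def lab (t : Trace 𝒳) (p : Params) (H : Finset (Classifier 𝒳)) (j : ℕ)
    (z : 𝒳 × Bool) : Bool :=
  if z.1 ∈ t.qreg p H j then z.2 else t.h j z.1

/-- The `i`-th labeled example. -/
def ex (t : Trace 𝒳) (i : ℕ) : 𝒳 × Bool := (t.x i, t.y i)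

open Classical in
/-- The part of the truncated and scaled score that needs a query. -/
noncomputable def qpart (t : Trace 𝒳) (p : Params) (H : Finset (Classifier 𝒳)) (lam : ℝ)
    (F : 𝒳 → Bool → ℝ) (j : ℕ) (z : 𝒳 × Bool) : ℝ :=
  if z.1 ∈ t.qreg p H j ∧ lam ≤ t.qprob j z.1 then
    lam / t.qprob j z.1 * F z.1 (t.lab p H j z) else 0

open Classical in
/-- The part of the scaled score that needs no query. -/
noncomputable def fpart (t : Trace 𝒳) (p : Params) (H : Finset (Classifier 𝒳)) (lam : ℝ)
    (F : 𝒳 → Bool → ℝ) (j : ℕ) (z : 𝒳 × Bool) : ℝ :=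
  if z.1 ∈ t.qreg p H j then 0 else lam * F z.1 (t.lab p H j z)

/-- Chance of a query in epoch `j`. -/
noncomputable def chance (t : Trace 𝒳) (p : Params) (H : Finset (Classifier 𝒳)) (j : ℕ)
    (z : 𝒳 × Bool) : ℝ :=
  (t.qreg p H j).indicator (t.qprob j) z.1

/-- The truncated and scaled score of the `i`-th example. -/
noncomputable def score (t : Trace 𝒳) (p : Params) (H : Finset (Classifier 𝒳)) (lam : ℝ)
    (F : 𝒳 → Bool → ℝ) (i : ℕ) : ℝ :=
  t.query i * t.qpart p H lam F (p.epoch i) (t.ex i) + t.fpart p H lam F (p.epoch i) (t.ex i)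

/-- Conditional expectation of the sum of `score` and its square. -/
noncomputable def drift [MeasurableSpace 𝒳] (t : Trace 𝒳) (D : Measure (𝒳 × Bool)) (p : Params)
    (H : Finset (Classifier 𝒳)) (lam : ℝ) (F : 𝒳 → Bool → ℝ) (j : ℕ) : ℝ :=
  ∫ z, (t.chance p H j z * (t.qpart p H lam F j z + t.qpart p H lam F j z ^ 2)
    + (t.fpart p H lam F j z + t.fpart p H lam F j z ^ 2)) ∂D

/-- Importance weighted loss of `g` on the `i`-th example. -/
noncomputable def loss (t : Trace 𝒳) (g : Classifier 𝒳) (i : ℕ) : ℝ :=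
  t.w i * (if g (t.x i) ≠ t.y' i then 1 else 0)

theorem query_nonneg (t : Trace 𝒳) (i : ℕ) : 0 ≤ t.query i := by
  unfold query; split_ifs <;> simp

theorem query_le_one (t : Trace 𝒳) (i : ℕ) : t.query i ≤ 1 := by
  unfold query; split_ifs <;> simp

theorem query_sq (t : Trace 𝒳) (i : ℕ) : t.query i ^ 2 = t.query i := by
  unfold query; split_ifs <;> simp

section Bounds

variable {t : Trace 𝒳} {p : Params} {H : Finset (Classifier 𝒳)} {lam : ℝ} {F : 𝒳 → Bool → ℝ}
  {j : ℕ}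

theorem abs_qpart_le (hl : 0 < lam) (hF : ∀ x b, |F x b| ≤ 1) (z : 𝒳 × Bool) :
    |t.qpart p H lam F j z| ≤ 1 := by
  unfold qpart
  split_ifs with h
  · have hP : 0 < t.qprob j z.1 := hl.trans_le h.2
    rw [abs_mul, abs_of_pos (div_pos hl hP)]
    exact mul_le_one₀ ((div_le_one hP).2 h.2) (abs_nonneg _) (hF _ _)
  · simp

theorem abs_fpart_le (hl : 0 < lam) (hl1 : lam ≤ 1) (hF : ∀ x b, |F x b| ≤ 1) (z : 𝒳 × Bool) :
    |t.fpart p H lam F j z| ≤ 1 := by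
  unfold fpart
  split_ifs with h
  · simp
  · rw [abs_mul, abs_of_pos hl]
    exact mul_le_one₀ hl1 (abs_nonneg _) (hF _ _)

/-- One part lives inside the query region and the other outside, so no cross term appears when the
score is squared. -/
theorem qpart_mul_fpart (z : 𝒳 × Bool) :
    t.qpart p H lam F j z * t.fpart p H lam F j z = 0 := by
  unfold qpart fpart
  split_ifs <;> simp_all

theorem qpart_eq_zero_or_fpart_eq_zero (z : 𝒳 × Bool) :
    t.qpart p H lam F j z = 0 ∨ t.fpart p H lam F j z = 0 :=
  mul_eq_zero.1 (qpart_mul_fpart z)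

theorem abs_score_le (hl : 0 < lam) (hl1 : lam ≤ 1) (hF : ∀ x b, |F x b| ≤ 1) (i : ℕ) :
    |t.score p H lam F i| ≤ 1 := by
  unfold score
  rcases qpart_eq_zero_or_fpart_eq_zero (t := t) (p := p) (H := H) (lam := lam) (F := F)
    (j := p.epoch i) (t.ex i) with h | h
  · simpa [h] using abs_fpart_le hl hl1 hF _
  · rw [h, add_zero, abs_mul, abs_of_nonneg (t.query_nonneg i)]
    exact mul_le_one₀ (t.query_le_one i) (abs_nonneg _) (abs_qpart_le hl hF _)

/-- A query indicator is its own square and the cross term vanishes. The result is affine in the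
indicator, so its conditional expectation needs only the chance of a query. -/
theorem score_add_sq (i : ℕ) :
    t.score p H lam F i + t.score p H lam F i ^ 2
      = t.query i * (t.qpart p H lam F (p.epoch i) (t.ex i)
          + t.qpart p H lam F (p.epoch i) (t.ex i) ^ 2)
        + (t.fpart p H lam F (p.epoch i) (t.ex i)
          + t.fpart p H lam F (p.epoch i) (t.ex i) ^ 2) := by
  have h1 := t.query_sq i
  have h2 := qpart_mul_fpart (t := t) (p := p) (H := H) (lam := lam) (F := F)
    (j := p.epoch i) (t.ex i)
  unfold score
  linear_combination (t.qpart p H lam F (p.epoch i) (t.ex i)) ^ 2 * h1 + 2 * t.query i * h2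

theorem abs_add_sq_le {x : ℝ} (h : |x| ≤ 1) : |x + x ^ 2| ≤ 2 := by
  rw [abs_le] at *
  constructor <;> nlinarith

theorem abs_drift_le [MeasurableSpace 𝒳] {D : Measure (𝒳 × Bool)} [IsProbabilityMeasure D]
    (hl : 0 < lam) (hl1 : lam ≤ 1) (hF : ∀ x b, |F x b| ≤ 1)
    (hc : ∀ z, |t.chance p H j z| ≤ 1) : |t.drift D p H lam F j| ≤ 2 := by
  have := norm_integral_le_of_norm_le_const (μ := D) (C := 2) (f := fun z =>
    t.chance p H j z * (t.qpart p H lam F j z + t.qpart p H lam F j z ^ 2)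
    + (t.fpart p H lam F j z + t.fpart p H lam F j z ^ 2)) (ae_of_all _ fun z => by
      rw [Real.norm_eq_abs]
      rcases qpart_eq_zero_or_fpart_eq_zero (t := t) (p := p) (H := H) (lam := lam) (F := F)
        (j := j) z with h | h
      · simpa [h] using abs_add_sq_le (abs_fpart_le (t := t) (p := p) (H := H) (j := j) hl hl1 hF z)
      · have h2 := abs_add_sq_le (abs_qpart_le (t := t) (p := p) (H := H) (j := j) hl hF z)
        rw [h]
        simp only [ne_eq, OfNat.ofNat_ne_zero, not_false_eq_true, zero_pow, add_zero]
        rw [abs_mul]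
        nlinarith [hc z, abs_nonneg (t.chance p H j z)])
  simpa [drift] using this

end Bounds

end Trace

/-! ### Measurability of the rules of an epoch -/

section PastMeasurability

variable {Ω 𝒳 : Type*} [MeasurableSpace Ω] {T : Ω → Trace 𝒳} {p : Params}
  {H : Finset (Classifier 𝒳)} {j : ℕ}

/-- The threshold involves the random classifier of the epoch. Splitting over its finitely many
values leaves comparisons of empirical errors of fixed classifiers. -/
theorem measurableSet_mem_A (hj : 2 ≤ j)
    (hL : ∀ g ∈ H, Measurable fun a => (T a).empErr p (j - 1) g)
    (hhm : ∀ a, (T a).h j ∈ H) (hh : ∀ g ∈ H, MeasurableSet {a | (T a).h j = g})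
    {g : Classifier 𝒳} (hg : g ∈ H) : MeasurableSet {a | g ∈ (T a).A p H j} := by
  have e : {a | g ∈ (T a).A p H j} = ⋃ g' ∈ H, {a | (T a).h j = g'} ∩
      {a | (T a).empErr p (j - 1) g - (T a).empErr p (j - 1) g' ≤
        p.γ * (p.c₁ * √(p.eps H.card (j - 1) * (T a).empErr p (j - 1) g')
          + p.c₂ * p.eps H.card (j - 1) * Real.log (p.τ (j - 1)))} := by
    ext a
    have hj1 : j - 1 + 1 = j := by omega
    simp only [Trace.A, Trace.Δ, hj1, Set.mem_ofPred_eq, Set.mem_iUnion, Set.mem_inter_iff,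
      exists_prop]
    constructor
    · rintro ⟨-, h⟩
      exact ⟨_, hhm a, rfl, h⟩
    · rintro ⟨g', -, rfl, h⟩
      exact ⟨hg, h⟩
  rw [e]
  refine Finset.measurableSet_biUnion _ fun g' hg' => (hh g' hg').inter ?_
  have h1 := hL g hg
  have h2 := hL g' hg'
  exact measurableSet_le (h1.sub h2) (by fun_prop)

variable [MeasurableSpace 𝒳]

theorem measurableSet_region (hH : ∀ h ∈ H, Measurable h)
    (hA : ∀ g ∈ H, MeasurableSet {a | g ∈ (T a).A p H j}) :
    MeasurableSet {z : Ω × 𝒳 | z.2 ∈ (T z.1).region p H j} := by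
  have e : {z : Ω × 𝒳 | z.2 ∈ (T z.1).region p H j} = ⋃ g ∈ H, ⋃ g' ∈ H,
      (Prod.fst ⁻¹' {a | g ∈ (T a).A p H j} ∩ Prod.fst ⁻¹' {a | g' ∈ (T a).A p H j}) ∩
        Prod.snd ⁻¹' {x | g x ≠ g' x} := by
    ext z
    simp only [Trace.region, dis, Set.mem_ofPred_eq, Set.mem_iUnion, Set.mem_inter_iff,
      exists_prop, Set.mem_preimage]
    constructor
    · rintro ⟨g, hg, g', hg', h⟩
      exact ⟨g, hg.1, g', hg'.1, ⟨hg, hg'⟩, h⟩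
    · rintro ⟨g, -, g', -, ⟨hg, hg'⟩, h⟩
      exact ⟨g, hg, g', hg', h⟩
  rw [e]
  refine Finset.measurableSet_biUnion _ fun g hg => Finset.measurableSet_biUnion _ fun g' hg' => ?_
  refine ((measurable_fst (hA g hg)).inter (measurable_fst (hA g' hg'))).inter
    (measurable_snd ?_)
  exact (measurableSet_eq_fun (hH g hg) (hH g' hg')).compl

theorem measurable_h_apply (hH : ∀ h ∈ H, Measurable h) (hhm : ∀ a, (T a).h j ∈ H)
    (hh : ∀ g ∈ H, MeasurableSet {a | (T a).h j = g}) :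
    Measurable fun z : Ω × 𝒳 => (T z.1).h j z.2 := by
  refine measurable_to_bool ?_
  have e : (fun z : Ω × 𝒳 => (T z.1).h j z.2) ⁻¹' {true} = ⋃ g ∈ H,
      Prod.fst ⁻¹' {a | (T a).h j = g} ∩ Prod.snd ⁻¹' (g ⁻¹' {true}) := by
    ext z
    simp only [Set.mem_preimage, Set.mem_iUnion, Set.mem_inter_iff, Set.mem_ofPred_eq, exists_prop]
    constructor
    · intro h
      exact ⟨_, hhm z.1, rfl, h⟩
    · rintro ⟨g, -, rfl, h⟩
      exact h
  rw [e]
  exact Finset.measurableSet_biUnion _ fun g hg =>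
    (measurable_fst (hh g hg)).inter (measurable_snd (hH g hg (measurableSet_singleton _)))

/-- Joint measurability of the rules followed in epoch `j`. -/
structure RulesMeasurable (T : Ω → Trace 𝒳) (p : Params) (H : Finset (Classifier 𝒳)) (j : ℕ) :
    Prop where
  qreg : MeasurableSet {z : Ω × 𝒳 | z.2 ∈ (T z.1).qreg p H j}
  qprob : Measurable fun z : Ω × 𝒳 => (T z.1).qprob j z.2
  lab : Measurable fun z : Ω × (𝒳 × Bool) => (T z.1).lab p H j z.2

theorem rulesMeasurable_one (hj : j ≤ 1) : RulesMeasurable T p H j where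
  qreg := by simp [Trace.qreg, hj]
  qprob := by simp [Trace.qprob, hj]
  lab := by
    simp only [Trace.lab, Trace.qreg, hj, if_true, Set.mem_univ]
    fun_prop

theorem measurable_swap_snd :
    Measurable fun z : Ω × (𝒳 × Bool) => (z.1, z.2.1) := by fun_prop

theorem rulesMeasurable_of_two_le (hj : 2 ≤ j) (hH : ∀ h ∈ H, Measurable h)
    (hL : ∀ g ∈ H, Measurable fun a => (T a).empErr p (j - 1) g)
    (hhm : ∀ a, (T a).h j ∈ H) (hh : ∀ g ∈ H, MeasurableSet {a | (T a).h j = g})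
    (hP : Measurable fun z : Ω × 𝒳 => (T z.1).P j z.2) : RulesMeasurable T p H j := by
  have hj' : ¬ j ≤ 1 := by omega
  have hreg := measurableSet_region hH fun g hg => measurableSet_mem_A hj hL hhm hh hg
  have hqreg : MeasurableSet {z : Ω × 𝒳 | z.2 ∈ (T z.1).qreg p H j} := by
    simpa [Trace.qreg, hj'] using hreg
  refine ⟨hqreg, by simpa [Trace.qprob, hj'] using hP, ?_⟩
  exact Measurable.ite (measurable_swap_snd hqreg) (by fun_prop)
    ((measurable_h_apply hH hhm hh).comp measurable_swap_snd)

variable {lam : ℝ} {F : 𝒳 → Bool → ℝ}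

theorem RulesMeasurable.score_lab (hR : RulesMeasurable T p H j)
    (hF : Measurable fun z : 𝒳 × Bool => F z.1 z.2) :
    Measurable fun z : Ω × (𝒳 × Bool) => F z.2.1 ((T z.1).lab p H j z.2) :=
  hF.comp (Measurable.prodMk (by fun_prop) hR.lab)

theorem RulesMeasurable.qpart (hR : RulesMeasurable T p H j)
    (hF : Measurable fun z : 𝒳 × Bool => F z.1 z.2) :
    Measurable fun z : Ω × (𝒳 × Bool) => (T z.1).qpart p H lam F j z.2 := by
  have hP := hR.qprob.comp (measurable_swap_snd (Ω := Ω) (𝒳 := 𝒳))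
  exact Measurable.ite ((measurable_swap_snd hR.qreg).inter (measurableSet_le measurable_const hP))
    ((measurable_const.div hP).mul (hR.score_lab hF)) measurable_const

theorem RulesMeasurable.fpart (hR : RulesMeasurable T p H j)
    (hF : Measurable fun z : 𝒳 × Bool => F z.1 z.2) :
    Measurable fun z : Ω × (𝒳 × Bool) => (T z.1).fpart p H lam F j z.2 :=
  Measurable.ite (measurable_swap_snd hR.qreg) measurable_const
    (measurable_const.mul (hR.score_lab hF))

theorem RulesMeasurable.chance (hR : RulesMeasurable T p H j) :
    Measurable fun z : Ω × (𝒳 × Bool) => (T z.1).chance p H j z.2 := by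
  have hP := hR.qprob.comp (measurable_swap_snd (Ω := Ω) (𝒳 := 𝒳))
  classical
  exact Measurable.ite (measurable_swap_snd hR.qreg) hP measurable_const

theorem RulesMeasurable.drift (hR : RulesMeasurable T p H j)
    (hF : Measurable fun z : 𝒳 × Bool => F z.1 z.2) {D : Measure (𝒳 × Bool)}
    [IsProbabilityMeasure D] :
    Measurable fun a => (T a).drift D p H lam F j := by
  have h1 := hR.qpart (lam := lam) hF
  have h2 := hR.fpart (lam := lam) hF
  have h3 := hR.chance
  have h : Measurable fun z : Ω × (𝒳 × Bool) =>
    (T z.1).chance p H j z.2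
      * ((T z.1).qpart p H lam F j z.2 + (T z.1).qpart p H lam F j z.2 ^ 2)
    + ((T z.1).fpart p H lam F j z.2 + (T z.1).fpart p H lam F j z.2 ^ 2) := by fun_prop
  exact (h.stronglyMeasurable.integral_prod_right').measurable

end PastMeasurability

/-- The `0`-`1` loss of `g`. -/
def errInd {𝒳 : Type*} (g : Classifier 𝒳) (x : 𝒳) (b : Bool) : ℝ := if g x ≠ b then 1 else 0

/-! ### Losses as importance weighted scores -/

namespace Trace

variable {𝒳 : Type*} {t : Trace 𝒳} {p : Params} {H : Finset (Classifier 𝒳)} {lam : ℝ}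
  {F : 𝒳 → Bool → ℝ}

open Classical in
/-- Importance weighted score of the `i`-th example. -/
noncomputable def wscore (t : Trace 𝒳) (p : Params) (H : Finset (Classifier 𝒳))
    (F : 𝒳 → Bool → ℝ) (i : ℕ) : ℝ :=
  t.query i * (if t.x i ∈ t.qreg p H (p.epoch i) then
      1 / t.qprob (p.epoch i) (t.x i) * F (t.x i) (t.lab p H (p.epoch i) (t.ex i)) else 0)
    + (if t.x i ∈ t.qreg p H (p.epoch i) then 0
        else F (t.x i) (t.lab p H (p.epoch i) (t.ex i)))

/-- Where the query probability is at least the scale, truncation has no effect. This links the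
bounded scores of the concentration bound to the actual losses. -/
theorem score_eq_mul_wscore {i : ℕ}
    (h : t.x i ∈ t.qreg p H (p.epoch i) → lam ≤ t.qprob (p.epoch i) (t.x i)) :
    t.score p H lam F i = lam * t.wscore p H F i := by
  unfold score wscore qpart fpart
  by_cases hx : t.x i ∈ t.qreg p H (p.epoch i)
  · have := h hx
    simp only [ex, hx, this, and_self, if_true]
    ring
  · simp [ex, hx]

/-- The weights do not depend on the scored function, so scores of loss differences are differences
of weighted losses. -/
theorem wscore_lin (u v : ℝ) (F G : 𝒳 → Bool → ℝ) (i : ℕ) :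
    t.wscore p H (fun x b => u * F x b + v * G x b) i
      = u * t.wscore p H F i + v * t.wscore p H G i := by
  unfold wscore
  split_ifs <;> ring

/-- The placeholder label of a skipped example is harmless because its weight is zero. The right
side involves only examples, queries and the rules of the epoch, whose measurability is available;
none is assumed for `y'` and `w`. -/
theorem loss_eq_wscore [MeasurableSpace 𝒳] {D : Measure (𝒳 × Bool)} (hf : t.Follows D p H) {N : ℕ}
    (hv : p.Valid N) (g : Classifier 𝒳) {i : ℕ} (hi : i ∈ Finset.Icc 1 p.n) :
    t.loss g i = t.wscore p H (errInd g) i := by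
  obtain ⟨hj, hij⟩ := hv.mem_epoch hi
  set j := p.epoch i with hjdef
  obtain ⟨hj1, hjM⟩ := Finset.mem_Icc.1 hj
  unfold wscore
  rw [← hjdef]
  rcases hj1.eq_or_lt with h1 | h1
  · have hi3 : i ∈ Finset.Icc 1 3 := by
      rw [← h1, hv.τ_one, Nat.sub_self, hv.τ_zero] at hij
      simp only [Finset.mem_Ioc] at hij
      simp only [Finset.mem_Icc]; omega
    obtain ⟨hq, hy, hw⟩ := hf.start i hi3
    simp [qreg, qprob, lab, ← h1, loss, hq, hy, hw, query, errInd, ex]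
  · have hj2 : j ∈ Finset.Icc 2 p.M := Finset.mem_Icc.2 ⟨h1, hjM⟩
    have hn : ¬ j ≤ 1 := by omega
    by_cases hx : t.x i ∈ t.region p H j
    · by_cases hq : t.q i = true
      · obtain ⟨hy, hw⟩ := hf.queried j hj2 i hij hx hq
        simp [qreg, qprob, lab, hn, hx, loss, hq, hy, hw, query, errInd, ex]
      · obtain ⟨hy, hw⟩ := hf.skipped j hj2 i hij hx (by simpa using hq)
        simp [qreg, hn, hx, loss, hq, hw, query]
    · obtain ⟨hq, hy, hw⟩ := hf.predicted j hj2 i hij hx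
      simp [qreg, lab, hn, hx, loss, hq, hy, hw, query, errInd, ex]

/-- Cumulative importance weighted loss. -/
noncomputable def cumLoss (t : Trace 𝒳) (p : Params) (m : ℕ) (g : Classifier 𝒳) : ℝ :=
  ∑ i ∈ Finset.Icc 1 (p.τ m), t.loss g i

theorem empErr_eq (m : ℕ) (g : Classifier 𝒳) : t.empErr p m g = t.cumLoss p m g / p.τ m := rfl

theorem cumLoss_eq_sum_wscore [MeasurableSpace 𝒳] {D : Measure (𝒳 × Bool)} (hf : t.Follows D p H)
    {N : ℕ} (hv : p.Valid N) (g : Classifier 𝒳) {m : ℕ} (hm : m ≤ p.M) :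
    t.cumLoss p m g = ∑ i ∈ Finset.Icc 1 (p.τ m), t.wscore p H (errInd g) i :=
  Finset.sum_congr rfl fun _ hi => loss_eq_wscore hf hv g
    (Finset.Icc_subset_Icc_right (hv.τ_le_τ hm le_rfl) hi)

theorem abs_chance_le [MeasurableSpace 𝒳] {D : Measure (𝒳 × Bool)} (hf : t.Follows D p H) {j : ℕ}
    (hj : j ≤ p.M) (z : 𝒳 × Bool) : |t.chance p H j z| ≤ 1 := by
  unfold chance
  rw [Set.indicator]
  split_ifs with h
  · unfold qprob
    split_ifs with h1
    · simp
    · have hF := hf.feasible j (Finset.mem_Icc.2 ⟨by omega, hj⟩)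
      rw [abs_of_nonneg (hF.nonneg _)]
      exact hF.le_one _
  · simp

end Trace

theorem measurable_errInd {𝒳 : Type*} [MeasurableSpace 𝒳] {g : Classifier 𝒳} (hg : Measurable g) :
    Measurable fun z : 𝒳 × Bool => errInd g z.1 z.2 := by
  unfold errInd
  refine Measurable.ite ?_ measurable_const measurable_const
  exact (measurableSet_eq_fun (hg.comp measurable_fst) measurable_snd).compl

theorem RulesMeasurable.wscore {Ω 𝒳 : Type*} [MeasurableSpace Ω] [MeasurableSpace 𝒳]
    {T : Ω → Trace 𝒳} {p : Params} {H : Finset (Classifier 𝒳)} {i : ℕ}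
    {F : 𝒳 → Bool → ℝ} (hR : RulesMeasurable T p H (p.epoch i))
    (hF : Measurable fun z : 𝒳 × Bool => F z.1 z.2)
    (hq : Measurable fun a => (T a).q i) (hz : Measurable fun a => (T a).ex i) :
    Measurable fun a => (T a).wscore p H F i := by
  have h1 : Measurable fun a => (a, (T a).ex i) := measurable_id.prodMk hz
  have h2 : Measurable fun a => (a, (T a).x i) := measurable_id.prodMk hz.fst
  have hs : Measurable fun a => F ((T a).ex i).1 ((T a).lab p H (p.epoch i) ((T a).ex i)) :=
    (hR.score_lab hF).comp h1
  have hq' : Measurable fun a => (T a).query i :=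
    Measurable.ite (hq (measurableSet_singleton true)) measurable_const measurable_const
  exact (hq'.mul (Measurable.ite (h2 hR.qreg)
    ((measurable_const.div (hR.qprob.comp h2)).mul hs) measurable_const)).add
    (Measurable.ite (h2 hR.qreg) measurable_const hs)

theorem rulesMeasurable_mono {Ω 𝒳 : Type*} {m₁ m₂ : MeasurableSpace Ω} [MeasurableSpace 𝒳]
    {T : Ω → Trace 𝒳} {p : Params} {H : Finset (Classifier 𝒳)} {j : ℕ} (h : m₁ ≤ m₂)
    (hR : @RulesMeasurable Ω 𝒳 m₁ _ T p H j) : @RulesMeasurable Ω 𝒳 m₂ _ T p H j := by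
  have h1 : m₁.prod (inferInstance : MeasurableSpace 𝒳) ≤ m₂.prod inferInstance :=
    sup_le_sup (MeasurableSpace.comap_mono h) le_rfl
  have h2 : m₁.prod (inferInstance : MeasurableSpace (𝒳 × Bool)) ≤ m₂.prod inferInstance :=
    sup_le_sup (MeasurableSpace.comap_mono h) le_rfl
  exact @RulesMeasurable.mk Ω 𝒳 m₂ _ T p H j
    (h1 _ (@RulesMeasurable.qreg Ω 𝒳 m₁ _ T p H j hR))
    ((@RulesMeasurable.qprob Ω 𝒳 m₁ _ T p H j hR).mono h1 le_rfl)
    ((@RulesMeasurable.lab Ω 𝒳 m₁ _ T p H j hR).mono h2 le_rfl)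

/-! ### Conditional laws along a run, and concentration of the scores -/

namespace IsRun

variable {𝒳 Ω : Type*} [MeasurableSpace 𝒳] {mΩ : MeasurableSpace Ω}
  {D : Measure (𝒳 × Bool)} {H : Finset (Classifier 𝒳)} {p : Params}
  {μ : Measure Ω} {ℱ : Filtration ℕ mΩ} {T : Ω → Trace 𝒳}

theorem measurable_wscore (hr : IsRun D H p μ ℱ T) (hv : p.Valid H.card)
    {F : 𝒳 → Bool → ℝ} (hF : Measurable fun z : 𝒳 × Bool => F z.1 z.2)
    {i : ℕ} (hi : i ∈ Finset.Icc 1 p.n)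
    (hR : @RulesMeasurable Ω 𝒳 (ℱ (p.τ (p.epoch i - 1))) _ T p H (p.epoch i)) :
    Measurable[ℱ i] fun a => (T a).wscore p H F i := by
  have hle : ℱ (p.τ (p.epoch i - 1)) ≤ ℱ i :=
    ℱ.mono (Finset.mem_Ioc.1 (hv.mem_epoch hi).2).1.le
  have hR' : @RulesMeasurable Ω 𝒳 (ℱ i) _ T p H (p.epoch i) := rulesMeasurable_mono hle hR
  exact @RulesMeasurable.wscore Ω 𝒳 (ℱ i) _ T p H i F hR' hF (hr.measurable_query i hi)
    (hr.measurable_example i hi)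

/-- Strong induction: the rules of epoch j depend on the empirical errors after epoch j - 1, which
are sums of scores formed with the rules of earlier epochs. -/
theorem rulesMeasurable (hr : IsRun D H p μ ℱ T) (hv : p.Valid H.card)
    (hH : ∀ h ∈ H, Measurable h) {j : ℕ} (hj : j ∈ Finset.Icc 1 p.M) :
    @RulesMeasurable Ω 𝒳 (ℱ (p.τ (j - 1))) _ T p H j := by
  induction j using Nat.strong_induction_on with
  | _ j ih =>
    obtain ⟨hj1, hjM⟩ := Finset.mem_Icc.1 hj
    rcases hj1.eq_or_lt with h1 | h1
    · exact @rulesMeasurable_one Ω 𝒳 (ℱ (p.τ (j - 1))) T p H j _ h1.ge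
    · have hj2 : j ∈ Finset.Icc 2 p.M := Finset.mem_Icc.2 ⟨h1, hjM⟩
      have hj2' : j ∈ Finset.Icc 2 (p.M + 1) := Finset.mem_Icc.2 ⟨h1, by omega⟩
      refine @rulesMeasurable_of_two_le Ω 𝒳 (ℱ (p.τ (j - 1))) T p H j _ h1 hH (fun g hg => ?_)
        (fun a => ((hr.follows a).erm j hj2').1) (hr.measurable_h j hj2') (hr.measurable_P j hj2)
      simp only [Trace.empErr_eq]
      refine Measurable.div_const ?_ _
      simp only [fun a => Trace.cumLoss_eq_sum_wscore (hr.follows a) hv g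
        (show j - 1 ≤ p.M by omega)]
      refine Finset.measurable_sum _ fun i hi => ?_
      have hin : i ∈ Finset.Icc 1 p.n :=
        Finset.Icc_subset_Icc_right (hv.τ_le_τ (by omega) le_rfl) hi
      have hilt : p.epoch i < j := by
        have : p.epoch i ≤ j - 1 := Nat.sInf_le (Finset.mem_Icc.1 hi).2
        omega
      exact (hr.measurable_wscore hv (measurable_errInd (hH g hg)) hin
        (ih _ hilt (hv.mem_epoch hin).1)).mono (ℱ.mono (Finset.mem_Icc.1 hi).2) le_rfl

theorem measurable_ex (hr : IsRun D H p μ ℱ T) {i : ℕ} (hi : i ∈ Finset.Icc 1 p.n) :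
    Measurable[ℱ i] fun a => (T a).ex i := hr.measurable_example i hi

theorem measurable_query' (hr : IsRun D H p μ ℱ T) {i : ℕ} (hi : i ∈ Finset.Icc 1 p.n) :
    Measurable[ℱ i] fun a => (T a).query i :=
  Measurable.ite (hr.measurable_query i hi (measurableSet_singleton true)) measurable_const
    measurable_const

theorem rulesMeasurable_pred (hr : IsRun D H p μ ℱ T) (hv : p.Valid H.card)
    (hH : ∀ h ∈ H, Measurable h) {i : ℕ} (hi : i ∈ Finset.Icc 1 p.n) :
    @RulesMeasurable Ω 𝒳 (ℱ (i - 1)) _ T p H (p.epoch i) := by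
  obtain ⟨hj, hij⟩ := hv.mem_epoch hi
  have hR := hr.rulesMeasurable hv hH hj
  have hle : ℱ (p.τ (p.epoch i - 1)) ≤ ℱ (i - 1) := ℱ.mono (by
    have := Finset.mem_Ioc.1 hij; omega)
  exact rulesMeasurable_mono hle hR

theorem condExp_query_sup [IsProbabilityMeasure μ] (hr : IsRun D H p μ ℱ T)
    (hv : p.Valid H.card) {i : ℕ} (hi : i ∈ Finset.Icc 1 p.n) :
    μ[fun a => (T a).query i | ℱ (i - 1) ⊔
        MeasurableSpace.comap (fun a => (T a).ex i) inferInstance]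
      =ᵐ[μ] fun a => (T a).chance p H (p.epoch i) ((T a).ex i) := by
  obtain ⟨hj, hij⟩ := hv.mem_epoch hi
  obtain ⟨hj1, hjM⟩ := Finset.mem_Icc.1 hj
  rcases hj1.eq_or_lt with h1 | h1
  · have hi3 : i ∈ Finset.Icc 1 3 := by
      rw [← h1, hv.τ_one, Nat.sub_self, hv.τ_zero] at hij
      simp only [Finset.mem_Ioc] at hij
      simp only [Finset.mem_Icc]; omega
    have e1 : (fun a => (T a).query i) = fun _ => (1 : ℝ) := by
      ext a
      simp [Trace.query, ((hr.follows a).start i hi3).1]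
    have e2 : (fun a => (T a).chance p H (p.epoch i) ((T a).ex i)) = fun _ => (1 : ℝ) := by
      ext a
      simp [Trace.chance, Trace.qreg, Trace.qprob, ← h1]
    rw [e1, e2, condExp_const]
    exact sup_le (ℱ.le _) (((hr.measurable_ex hi).mono (ℱ.le _) le_rfl).comap_le)
  · have h := hr.draw _ (Finset.mem_Icc.2 ⟨h1, hjM⟩) i hij
    have hn : ¬ p.epoch i ≤ 1 := by omega
    have e : ∀ a, (T a).chance p H (p.epoch i) ((T a).ex i)
        = ((T a).region p H (p.epoch i)).indicator ((T a).P (p.epoch i)) ((T a).x i) := by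
      intro a
      have e1 : (T a).qreg p H (p.epoch i) = (T a).region p H (p.epoch i) := if_neg hn
      have e2 : (T a).qprob (p.epoch i) = (T a).P (p.epoch i) := by
        ext x; exact if_neg hn
      rw [Trace.chance, e1, e2, Trace.ex]
    simp only [e]
    exact h

/-- Given the past, the rules of the epoch are frozen: the query indicator is replaced by its
chance, and the fresh example is integrated out against D. -/
theorem condExp_rules [IsProbabilityMeasure μ] (hr : IsRun D H p μ ℱ T)
    (hv : p.Valid H.card) (hH : ∀ h ∈ H, Measurable h) {i : ℕ} (hi : i ∈ Finset.Icc 1 p.n)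
    {φ χ : Ω × (𝒳 × Bool) → ℝ} (hφ : Measurable[(ℱ (i - 1)).prod inferInstance] φ)
    (hχ : Measurable[(ℱ (i - 1)).prod inferInstance] χ) {c : ℝ}
    (hφb : ∀ z, |φ z| ≤ c) (hχb : ∀ z, |χ z| ≤ c) :
    μ[fun a => (T a).query i * φ (a, (T a).ex i) + χ (a, (T a).ex i)|ℱ (i - 1)]
      =ᵐ[μ] fun a => ∫ z, ((T a).chance p H (p.epoch i) z * φ (a, z) + χ (a, z)) ∂D := by
  have hjM := (Finset.mem_Icc.1 (hv.mem_epoch hi).1).2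
  have hR := hr.rulesMeasurable_pred hv hH hi
  have := condExp_randomized (μ := μ) (ℱ.le (i - 1)) (Z := fun a => (T a).ex i)
    ((hr.measurable_ex hi).mono (ℱ.le _) le_rfl) (hr.indep i hi)
    (q := fun a => (T a).query i) ((hr.measurable_query' hi).mono (ℱ.le _) le_rfl)
    (fun a => by rw [abs_of_nonneg (Trace.query_nonneg _ _)]; exact Trace.query_le_one _ _)
    (ρ := fun z => (T z.1).chance p H (p.epoch i) z.2)
    (@RulesMeasurable.chance Ω 𝒳 (ℱ (i - 1)) T p H _ _ hR) hφ hχ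
    (fun z => Trace.abs_chance_le (hr.follows z.1) hjM z.2) hφb hχb (hr.condExp_query_sup hv hi)
  rwa [show μ.map (fun a => (T a).ex i) = D from hr.law i hi] at this

/-- The conditional probability of a query is at most the mass of the query region. -/
theorem condExp_query_le [IsProbabilityMeasure μ] [IsProbabilityMeasure D]
    (hr : IsRun D H p μ ℱ T) (hv : p.Valid H.card) (hH : ∀ h ∈ H, Measurable h) {i : ℕ}
    (hi : i ∈ Finset.Icc 1 p.n) :
    μ[fun a => (T a).query i|ℱ (i - 1)]
      ≤ᵐ[μ] fun a => D.real {z | z.1 ∈ (T a).qreg p H (p.epoch i)} := by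
  have hjM := (Finset.mem_Icc.1 (hv.mem_epoch hi).1).2
  have hR := hr.rulesMeasurable_pred hv hH hi
  have h := hr.condExp_rules hv hH hi (φ := fun _ => 1) (χ := fun _ => 0) (c := 1)
    measurable_const measurable_const (by simp) (by simp)
  simp only [mul_one, add_zero] at h
  filter_upwards [h] with a ha
  rw [ha]
  have hmeas : MeasurableSet {z : 𝒳 × Bool | z.1 ∈ (T a).qreg p H (p.epoch i)} := by
    have := @RulesMeasurable.qreg Ω 𝒳 (ℱ (i - 1)) _ T p H _ hR
    have h2 : MeasurableSet {x : 𝒳 | x ∈ (T a).qreg p H (p.epoch i)} :=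
      (@measurable_prodMk_left Ω 𝒳 (ℱ (i - 1)) _ a) this
    exact measurable_fst h2
  rw [← integral_indicator_one hmeas]
  refine integral_mono_of_nonneg (ae_of_all _ fun z => ?_)
    ((integrable_const (1 : ℝ)).indicator hmeas) (ae_of_all _ fun z => ?_)
  · by_cases hz : z.1 ∈ (T a).qreg p H (p.epoch i)
    · simp only [Trace.chance, Set.indicator_of_mem hz, Trace.qprob, Pi.zero_apply]
      split_ifs with h1
      · simp
      · exact ((hr.follows a).feasible _ (Finset.mem_Icc.2 ⟨by omega, hjM⟩)).nonneg _
    · simp [Trace.chance, hz]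
  · have := Trace.abs_chance_le (hr.follows a) hjM z
    by_cases hz : z.1 ∈ (T a).qreg p H (p.epoch i)
    · simpa [Set.indicator, hz] using (abs_le.1 this).2
    · simp [Trace.chance, hz]

/-- Concentration of the truncated scores. -/
theorem measure_score_gt_le [IsProbabilityMeasure μ] [IsProbabilityMeasure D]
    (hr : IsRun D H p μ ℱ T) (hv : p.Valid H.card) (hH : ∀ h ∈ H, Measurable h)
    {F : 𝒳 → Bool → ℝ} (hF : Measurable fun z : 𝒳 × Bool => F z.1 z.2)
    (hF1 : ∀ x b, |F x b| ≤ 1) {lam : ℝ} (hl : 0 < lam) (hl1 : lam ≤ 1) {m : ℕ} (hm : m ≤ p.M)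
    (s : ℝ) :
    μ.real {a | s < ∑ i ∈ Finset.Icc 1 (p.τ m),
      ((T a).score p H lam F i - (T a).drift D p H lam F (p.epoch i))} ≤ Real.exp (-s) := by
  have hsub : ∀ i ∈ Finset.Icc 1 (p.τ m), i ∈ Finset.Icc 1 p.n := fun i hi =>
    Finset.Icc_subset_Icc_right (hv.τ_le_τ hm le_rfl) hi
  have hq : ∀ i ∈ Finset.Icc 1 p.n, Measurable[(ℱ (i - 1)).prod inferInstance]
      fun z : Ω × (𝒳 × Bool) => (T z.1).qpart p H lam F (p.epoch i) z.2 := fun i hi =>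
    @RulesMeasurable.qpart Ω 𝒳 (ℱ (i - 1)) T p H _ _ lam F
      (hr.rulesMeasurable_pred hv hH hi) hF
  have hf : ∀ i ∈ Finset.Icc 1 p.n, Measurable[(ℱ (i - 1)).prod inferInstance]
      fun z : Ω × (𝒳 × Bool) => (T z.1).fpart p H lam F (p.epoch i) z.2 := fun i hi =>
    @RulesMeasurable.fpart Ω 𝒳 (ℱ (i - 1)) T p H _ _ lam F
      (hr.rulesMeasurable_pred hv hH hi) hF
  refine measure_sum_sub_ge_le (ℱ := ℱ) (ξ := fun i a => (T a).score p H lam F i)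
    (d := fun i a => (T a).drift D p H lam F (p.epoch i)) (fun i hi => ?_) (fun i hi => ?_)
    (fun i hi a => Trace.abs_score_le hl hl1 hF1 i)
    (fun i hi a => Trace.abs_drift_le hl hl1 hF1
      (Trace.abs_chance_le (hr.follows a) (Finset.mem_Icc.1 (hv.mem_epoch (hsub i hi)).1).2))
    (fun i hi => ?_) s
  · have hi' := hsub i hi
    have hpair : @Measurable Ω (Ω × (𝒳 × Bool)) (ℱ i) ((ℱ (i - 1)).prod inferInstance)
        (fun a => (a, (T a).ex i)) := by
      have h1 : @Measurable Ω Ω (ℱ i) (ℱ (i - 1)) (fun a => a) :=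
        measurable_id'' (ℱ.mono (Nat.sub_le i 1))
      exact h1.prodMk (hr.measurable_ex hi')
    have h1 := (hq i hi').comp hpair
    have h2 := (hf i hi').comp hpair
    have h3 := hr.measurable_query' hi'
    exact (h3.mul h1).add h2
  · exact @RulesMeasurable.drift Ω 𝒳 (ℱ (i - 1)) T p H _ _ lam F
      (hr.rulesMeasurable_pred hv hH (hsub i hi)) hF D _
  · have hi' := hsub i hi
    have h := hr.condExp_rules hv hH hi' (c := 2)
      (φ := fun z => (T z.1).qpart p H lam F (p.epoch i) z.2
        + (T z.1).qpart p H lam F (p.epoch i) z.2 ^ 2)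
      (χ := fun z => (T z.1).fpart p H lam F (p.epoch i) z.2
        + (T z.1).fpart p H lam F (p.epoch i) z.2 ^ 2)
      ((hq i hi').add ((hq i hi').pow_const 2)) ((hf i hi').add ((hf i hi').pow_const 2))
      (fun z => Trace.abs_add_sq_le (Trace.abs_qpart_le hl hF1 z.2))
      (fun z => Trace.abs_add_sq_le (Trace.abs_fpart_le hl hl1 hF1 z.2))
    have e : (fun a => (T a).score p H lam F i + (T a).score p H lam F i ^ 2) = fun a =>
        (T a).query i * ((T a).qpart p H lam F (p.epoch i) ((T a).ex i)
          + (T a).qpart p H lam F (p.epoch i) ((T a).ex i) ^ 2)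
        + ((T a).fpart p H lam F (p.epoch i) ((T a).ex i)
          + (T a).fpart p H lam F (p.epoch i) ((T a).ex i) ^ 2) :=
      funext fun a => Trace.score_add_sq i
    rw [e]
    exact h.le

end IsRun

/-! ### Means, second moments and favorable bias within one epoch -/

theorem integrable_fun_sub {Ω : Type*} [MeasurableSpace Ω] {μ : Measure Ω} {f g : Ω → ℝ}
    (hf : Integrable f μ) (hg : Integrable g μ) : Integrable (fun a => f a - g a) μ :=
  hf.sub hg

theorem errInd_nonneg {𝒳 : Type*} (g : Classifier 𝒳) (x : 𝒳) (b : Bool) : 0 ≤ errInd g x b := by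
  unfold errInd; split_ifs <;> simp

theorem errInd_le_one {𝒳 : Type*} (g : Classifier 𝒳) (x : 𝒳) (b : Bool) : errInd g x b ≤ 1 := by
  unfold errInd; split_ifs <;> simp

theorem errInd_sq {𝒳 : Type*} (g : Classifier 𝒳) (x : 𝒳) (b : Bool) :
    errInd g x b ^ 2 = errInd g x b := by
  unfold errInd; split_ifs <;> simp

theorem abs_errInd_sub_le {𝒳 : Type*} (g h : Classifier 𝒳) (x : 𝒳) (b : Bool) :
    |errInd g x b - errInd h x b| ≤ 1 := by
  rw [abs_le]
  constructor <;> linarith [errInd_nonneg g x b, errInd_nonneg h x b, errInd_le_one g x b,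
    errInd_le_one h x b]

theorem abs_errInd_le {𝒳 : Type*} (g : Classifier 𝒳) (x : 𝒳) (b : Bool) : |errInd g x b| ≤ 1 := by
  rw [abs_of_nonneg (errInd_nonneg _ _ _)]; exact errInd_le_one _ _ _

theorem err_eq_integral {𝒳 : Type*} [MeasurableSpace 𝒳] (D : Measure (𝒳 × Bool))
    {g : Classifier 𝒳} (hg : Measurable g) : err D g = ∫ z, errInd g z.1 z.2 ∂D := by
  have hm : MeasurableSet {z : 𝒳 × Bool | g z.1 ≠ z.2} :=
    (measurableSet_eq_fun (hg.comp measurable_fst) measurable_snd).compl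
  rw [err, ← integral_indicator_one hm]
  congr 1
  ext z
  simp [errInd, Set.indicator]

namespace Trace

variable {𝒳 : Type*} {t : Trace 𝒳} {p : Params} {H : Finset (Classifier 𝒳)} {j : ℕ}

/-- Outside the query region, all classifiers of `A` agree. -/
theorem eq_of_notMem_qreg {g g' : Classifier 𝒳} (hg : 2 ≤ j → g ∈ t.A p H j)
    (hg' : 2 ≤ j → g' ∈ t.A p H j) {x : 𝒳} (hx : x ∉ t.qreg p H j) : g x = g' x := by
  unfold qreg at hx
  split_ifs at hx with h
  · exact absurd (Set.mem_univ x) hx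
  · by_contra hne
    exact hx ⟨g, hg (by omega), g', hg' (by omega), hne⟩

theorem pMin_pos (hc : 1 ≤ p.c₃) (hτ : 3 ≤ p.τ (j - 1)) (N : ℕ) : 0 < t.pMin p N j := by
  unfold pMin
  have : 0 < Real.log (p.τ (j - 1)) := Real.log_pos (by exact_mod_cast (by omega : 1 < p.τ (j - 1)))
  refine lt_min (div_pos (by linarith) ?_) (by norm_num)
  positivity

variable [MeasurableSpace 𝒳] {D : Measure (𝒳 × Bool)} {lam : ℝ} {F G : 𝒳 → Bool → ℝ}

/-- Expected score of an example of epoch `j`. -/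
noncomputable def mean (t : Trace 𝒳) (D : Measure (𝒳 × Bool)) (p : Params)
    (H : Finset (Classifier 𝒳)) (F : 𝒳 → Bool → ℝ) (j : ℕ) : ℝ :=
  ∫ z, F z.1 (t.lab p H j z) ∂D

open Classical in
/-- Second moment of the importance weighted score of an example of epoch `j`. -/
noncomputable def mom (t : Trace 𝒳) (D : Measure (𝒳 × Bool)) (p : Params)
    (H : Finset (Classifier 𝒳)) (F : 𝒳 → Bool → ℝ) (j : ℕ) : ℝ :=
  ∫ z, (if z.1 ∈ t.qreg p H j then F z.1 (t.lab p H j z) ^ 2 / t.qprob j z.1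
    else F z.1 (t.lab p H j z) ^ 2) ∂D

/-- The rules of epoch `j` are measurable. -/
structure EpochMeasurable (t : Trace 𝒳) (p : Params) (H : Finset (Classifier 𝒳)) (j : ℕ) :
    Prop where
  qreg : MeasurableSet (t.qreg p H j)
  qprob : Measurable (t.qprob j)
  lab : Measurable (t.lab p H j)

theorem Follows.epochMeasurable (hf : t.Follows D p H) (hH : ∀ h ∈ H, Measurable h)
    (hj : j ∈ Finset.Icc 1 p.M) : t.EpochMeasurable p H j := by
  obtain ⟨hj1, hjM⟩ := Finset.mem_Icc.1 hj
  -- A fixed trace is a random trace on a one-point space, so the joint measurability results apply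
  -- to it.
  have hR : RulesMeasurable (fun _ : Unit => t) p H j := by
    rcases hj1.eq_or_lt with h1 | h1
    · exact rulesMeasurable_one h1.ge
    · refine rulesMeasurable_of_two_le h1 hH (fun g _ => measurable_const)
        (fun _ => (hf.erm j (Finset.mem_Icc.2 ⟨h1, by omega⟩)).1) (fun g _ => MeasurableSet.const _)
        ((hf.feasible j (Finset.mem_Icc.2 ⟨h1, hjM⟩)).measurable.comp measurable_snd)
  exact ⟨measurable_prodMk_left (x := ()) hR.qreg, hR.qprob.comp (measurable_prodMk_left (x := ())),
    hR.lab.comp (measurable_prodMk_left (x := ()))⟩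

theorem EpochMeasurable.score (hR : t.EpochMeasurable p H j)
    (hF : Measurable fun z : 𝒳 × Bool => F z.1 z.2) :
    Measurable fun z : 𝒳 × Bool => F z.1 (t.lab p H j z) :=
  hF.comp (measurable_fst.prodMk hR.lab)

theorem integrable_score [IsProbabilityMeasure D] (hR : t.EpochMeasurable p H j)
    (hF : Measurable fun z : 𝒳 × Bool => F z.1 z.2) (hF1 : ∀ x b, |F x b| ≤ 1) :
    Integrable (fun z : 𝒳 × Bool => F z.1 (t.lab p H j z)) D :=
  integrable_of_abs_le (hR.score hF) fun _ => hF1 _ _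

open Classical in
theorem integrable_mom [IsProbabilityMeasure D] (hR : t.EpochMeasurable p H j)
    (hF : Measurable fun z : 𝒳 × Bool => F z.1 z.2) (hF1 : ∀ x b, |F x b| ≤ 1) (hl : 0 < lam)
    (hl1 : lam ≤ 1) (h : ∀ x ∈ t.qreg p H j, lam ≤ t.qprob j x) :
    Integrable (fun z : 𝒳 × Bool => if z.1 ∈ t.qreg p H j then
      F z.1 (t.lab p H j z) ^ 2 / t.qprob j z.1 else F z.1 (t.lab p H j z) ^ 2) D := by
  have hsq : ∀ z : 𝒳 × Bool, F z.1 (t.lab p H j z) ^ 2 ≤ 1 := fun z => by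
    rw [← sq_abs]; exact pow_le_one₀ (abs_nonneg _) (hF1 _ _)
  refine integrable_of_abs_le (c := 1 / lam) (Measurable.ite (measurable_fst hR.qreg)
    (((hR.score hF).pow_const 2).div (hR.qprob.comp measurable_fst))
    ((hR.score hF).pow_const 2)) fun z => ?_
  split_ifs with hz
  · have hP : 0 < t.qprob j z.1 := hl.trans_le (h _ hz)
    rw [abs_of_nonneg (div_nonneg (sq_nonneg _) hP.le)]
    exact div_le_div₀ zero_le_one (hsq z) hl (h _ hz)
  · rw [abs_of_nonneg (sq_nonneg _)]
    exact (hsq z).trans ((one_le_div hl).2 hl1)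

/-- When nothing is truncated, the chance of a query cancels one factor 1/P: the mean loses its
weight, and the second moment keeps a single factor 1/P, the quantity constrained by the
optimization problem. -/
theorem drift_eq [IsProbabilityMeasure D] (hR : t.EpochMeasurable p H j)
    (hF : Measurable fun z : 𝒳 × Bool => F z.1 z.2) (hF1 : ∀ x b, |F x b| ≤ 1) (hl : 0 < lam)
    (hl1 : lam ≤ 1) (h : ∀ x ∈ t.qreg p H j, lam ≤ t.qprob j x) :
    t.drift D p H lam F j = lam * t.mean D p H F j + lam ^ 2 * t.mom D p H F j := by
  classical
  rw [mean, mom, ← integral_const_mul, ← integral_const_mul,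
    ← integral_add ((integrable_score hR hF hF1).const_mul lam)
      ((integrable_mom hR hF hF1 hl hl1 h).const_mul _), drift]
  congr 1
  ext z
  by_cases hz : z.1 ∈ t.qreg p H j
  · have hP := h _ hz
    have hP0 : t.qprob j z.1 ≠ 0 := (hl.trans_le hP).ne'
    simp only [chance, qpart, fpart, Set.indicator_of_mem hz, hz, hP, and_self, if_true]
    field_simp
    ring
  · simp only [chance, qpart, fpart, Set.indicator_of_notMem hz, hz, false_and, if_false]
    ring

theorem mean_lin [IsProbabilityMeasure D] (hR : t.EpochMeasurable p H j)
    (hF : Measurable fun z : 𝒳 × Bool => F z.1 z.2) (hF1 : ∀ x b, |F x b| ≤ 1)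
    (hG : Measurable fun z : 𝒳 × Bool => G z.1 z.2) (hG1 : ∀ x b, |G x b| ≤ 1) (u v : ℝ) :
    t.mean D p H (fun x b => u * F x b + v * G x b) j
      = u * t.mean D p H F j + v * t.mean D p H G j := by
  simp only [mean]
  rw [integral_add ((integrable_score hR hF hF1).const_mul u)
    ((integrable_score hR hG hG1).const_mul v), integral_const_mul, integral_const_mul]

theorem mean_errInd_nonneg (g : Classifier 𝒳) : 0 ≤ t.mean D p H (errInd g) j :=
  integral_nonneg fun _ => errInd_nonneg _ _ _

/-- Favorable bias. -/
theorem err_sub_le_mean_sub [IsProbabilityMeasure D] (hR : t.EpochMeasurable p H j)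
    {g hs : Classifier 𝒳} (hg : Measurable g) (hhs : Measurable hs)
    (hsA : 2 ≤ j → hs ∈ t.A p H j) (hjA : 2 ≤ j → t.h j ∈ t.A p H j) :
    err D g - err D hs ≤ t.mean D p H (errInd g) j - t.mean D p H (errInd hs) j := by
  have i1 : ∀ {g : Classifier 𝒳}, Measurable g →
      Integrable (fun z : 𝒳 × Bool => errInd g z.1 z.2) D := fun hg =>
    integrable_of_abs_le (measurable_errInd hg) fun _ => abs_errInd_le _ _ _
  have i2 : ∀ {g : Classifier 𝒳}, Measurable g →
      Integrable (fun z : 𝒳 × Bool => errInd g z.1 (t.lab p H j z)) D := fun hg =>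
    integrable_score hR (measurable_errInd hg) (abs_errInd_le _)
  rw [err_eq_integral D hg, err_eq_integral D hhs, mean, mean, ← integral_sub (i1 hg) (i1 hhs),
    ← integral_sub (i2 hg) (i2 hhs)]
  refine integral_mono ((i1 hg).sub (i1 hhs)) ((i2 hg).sub (i2 hhs)) fun z => ?_
  by_cases hz : z.1 ∈ t.qreg p H j
  · simp [lab, hz]
  -- Outside the region the label used is that of `hs`. The right side is then the indicator of g ≠
  -- hs, which dominates the difference of the true losses.
  · have e : t.lab p H j z = hs z.1 := by
      simp only [lab, hz, if_false]
      exact eq_of_notMem_qreg hjA hsA hz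
    simp only [e, errInd]
    cases g z.1 <;> cases hs z.1 <;> cases z.2 <;> simp

/-- The second moment of the loss of `hs`, which is only incurred in the query region. -/
theorem mom_errInd_le [IsProbabilityMeasure D] (hR : t.EpochMeasurable p H j)
    {hs : Classifier 𝒳} (hhs : Measurable hs)
    (hsA : 2 ≤ j → hs ∈ t.A p H j) (hjA : 2 ≤ j → t.h j ∈ t.A p H j) (hl : 0 < lam)
    (hl1 : lam ≤ 1) (h : ∀ x ∈ t.qreg p H j, 2 * lam ≤ t.qprob j x) :
    lam * t.mom D p H (errInd hs) j ≤ t.mean D p H (errInd hs) j / 2 := by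
  classical
  have h' : ∀ x ∈ t.qreg p H j, lam ≤ t.qprob j x := fun x hx => by linarith [h x hx]
  have im := measurable_errInd hhs
  rw [mom, ← integral_const_mul, mean, ← integral_div]
  refine integral_mono ((integrable_mom hR im (abs_errInd_le _) hl hl1 h').const_mul _)
    ((integrable_score hR im (abs_errInd_le _)).div_const _) fun z => ?_
  by_cases hz : z.1 ∈ t.qreg p H j
  · have hP := h _ hz
    have hP0 : 0 < t.qprob j z.1 := by linarith
    simp only [hz, if_true, errInd_sq]
    rw [mul_div_assoc', div_le_div_iff₀ hP0 two_pos]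
    nlinarith [errInd_nonneg hs z.1 (t.lab p H j z)]
  · have e : t.lab p H j z = hs z.1 := by
      simp only [lab, hz, if_false]
      exact eq_of_notMem_qreg hjA hsA hz
    simp [hz, e, errInd]

/-- Mass of the query region in which `g` and `g'` disagree. -/
theorem sum_disagree_le [IsProbabilityMeasure D] (hR : t.EpochMeasurable p H j)
    {g hs : Classifier 𝒳} (hg : Measurable g) (hhs : Measurable hs) (hhj : Measurable (t.h j))
    (hsA : 2 ≤ j → hs ∈ t.A p H j) (hjA : 2 ≤ j → t.h j ∈ t.A p H j) :
    D.real {z | g z.1 ≠ t.h j z.1 ∧ z.1 ∈ t.qreg p H j}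
      + D.real {z | hs z.1 ≠ t.h j z.1 ∧ z.1 ∈ t.qreg p H j}
      + D.real {z | g z.1 ≠ hs z.1 ∧ z.1 ∉ t.qreg p H j}
      ≤ t.mean D p H (errInd g) j - t.mean D p H (errInd hs) j
        + 6 * t.mean D p H (errInd hs) j + 2 * (err D (t.h j) - err D hs) := by
  classical
  have i1 : ∀ {g : Classifier 𝒳}, Measurable g →
      Integrable (fun z : 𝒳 × Bool => errInd g z.1 z.2) D := fun hg =>
    integrable_of_abs_le (measurable_errInd hg) fun _ => abs_errInd_le _ _ _
  have i2 : ∀ {g : Classifier 𝒳}, Measurable g →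
      Integrable (fun z : 𝒳 × Bool => errInd g z.1 (t.lab p H j z)) D := fun hg =>
    integrable_score hR (measurable_errInd hg) (abs_errInd_le _)
  have hne : ∀ {g h : Classifier 𝒳}, Measurable g → Measurable h →
      MeasurableSet {z : 𝒳 × Bool | g z.1 ≠ h z.1} := fun hg hh =>
    (measurableSet_eq_fun (hg.comp measurable_fst) (hh.comp measurable_fst)).compl
  have hq : MeasurableSet {z : 𝒳 × Bool | z.1 ∈ t.qreg p H j} := measurable_fst hR.qreg
  have m1 := (hne hg hhj).inter hq
  have m2 := (hne hhs hhj).inter hq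
  have m3 := (hne hg hhs).inter hq.compl
  have ii : ∀ {s : Set (𝒳 × Bool)}, MeasurableSet s →
      Integrable (s.indicator (1 : 𝒳 × Bool → ℝ)) D := fun hs =>
    (integrable_const (1 : ℝ)).indicator hs
  change D.real ({z | g z.1 ≠ t.h j z.1} ∩ {z | z.1 ∈ t.qreg p H j})
    + D.real ({z | hs z.1 ≠ t.h j z.1} ∩ {z | z.1 ∈ t.qreg p H j})
    + D.real ({z | g z.1 ≠ hs z.1} ∩ {z | z.1 ∈ t.qreg p H j}ᶜ) ≤ _
  rw [← integral_indicator_one m1, ← integral_indicator_one m2, ← integral_indicator_one m3,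
    ← integral_add (ii m1) (ii m2), ← integral_add ((ii m1).fun_add (ii m2)) (ii m3),
    err_eq_integral D hhj, err_eq_integral D hhs, mean, mean, ← integral_sub (i2 hg) (i2 hhs),
    ← integral_const_mul, ← integral_add (integrable_fun_sub (i2 hg) (i2 hhs)) ((i2 hhs).const_mul 6),
    ← integral_sub (i1 hhj) (i1 hhs), ← integral_const_mul,
    ← integral_add ((integrable_fun_sub (i2 hg) (i2 hhs)).fun_add ((i2 hhs).const_mul 6))
      ((integrable_fun_sub (i1 hhj) (i1 hhs)).const_mul 2)]
  refine integral_mono (((ii m1).fun_add (ii m2)).fun_add (ii m3))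
    (((integrable_fun_sub (i2 hg) (i2 hhs)).fun_add ((i2 hhs).const_mul 6)).fun_add
      ((integrable_fun_sub (i1 hhj) (i1 hhs)).const_mul 2)) fun z => ?_
  -- In the region, a disagreement with h_j costs an error of one of the two classifiers, whence the
  -- bound by the losses of g and `hs` plus twice that of h_j. Outside, h_j equals `hs` and only the
  -- disagreement of g with `hs` remains.
  by_cases hz : z.1 ∈ t.qreg p H j
  · have e : t.lab p H j z = z.2 := by simp [lab, hz]
    simp only [Set.indicator, Set.mem_inter_iff, Set.mem_ofPred_eq, Set.mem_compl_iff, hz, e,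
      errInd]
    cases g z.1 <;> cases hs z.1 <;> cases t.h j z.1 <;> cases z.2 <;> norm_num
  · have e2 : t.h j z.1 = hs z.1 := eq_of_notMem_qreg hjA hsA hz
    have e : t.lab p H j z = hs z.1 := by simp [lab, hz, e2]
    simp only [Set.indicator, Set.mem_inter_iff, Set.mem_ofPred_eq, Set.mem_compl_iff, hz, e, e2,
      errInd]
    cases g z.1 <;> cases hs z.1 <;> cases z.2 <;> norm_num

/-- Second moment of the loss difference, in the first epoch. -/
theorem mom_sub_le_of_le_one [IsProbabilityMeasure D] (hR : t.EpochMeasurable p H j) (hj : j ≤ 1)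
    {g hs : Classifier 𝒳} (hg : Measurable g) (hhs : Measurable hs) :
    t.mom D p H (fun x b => errInd g x b - errInd hs x b) j
      ≤ t.mean D p H (errInd g) j - t.mean D p H (errInd hs) j
        + 6 * t.mean D p H (errInd hs) j := by
  classical
  have i2 : ∀ {g : Classifier 𝒳}, Measurable g →
      Integrable (fun z : 𝒳 × Bool => errInd g z.1 (t.lab p H j z)) D := fun hg =>
    integrable_score hR (measurable_errInd hg) (abs_errInd_le _)
  rw [mom, mean, mean, ← integral_sub (i2 hg) (i2 hhs), ← integral_const_mul,
    ← integral_add (integrable_fun_sub (i2 hg) (i2 hhs)) ((i2 hhs).const_mul 6)]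
  have h1 : ∀ x ∈ t.qreg p H j, (1 : ℝ) ≤ t.qprob j x := fun x _ => by simp [qprob, hj]
  refine integral_mono (integrable_mom hR
    ((measurable_errInd hg).sub (measurable_errInd hhs)) (abs_errInd_sub_le g hs) one_pos le_rfl h1)
    ((integrable_fun_sub (i2 hg) (i2 hhs)).fun_add ((i2 hhs).const_mul 6)) fun z => ?_
  have hz : z.1 ∈ t.qreg p H j := by simp [qreg, hj]
  simp only [hz, if_true, qprob, hj, errInd]
  cases g z.1 <;> cases hs z.1 <;> cases t.lab p H j z <;> norm_num

theorem fst_real_eq {S : Set 𝒳} (hS : MeasurableSet S) :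
    D.fst.real S = D.real {z | z.1 ∈ S} := by
  rw [measureReal_def, Measure.fst_apply hS, measureReal_def]
  rfl

/-- Second moment of the loss difference, in terms of the constraints on `P`. -/
theorem mom_sub_le [IsProbabilityMeasure D] (hf : t.Follows D p H) (hv : p.Valid H.card)
    (hH : ∀ h ∈ H, Measurable h) (hj : j ∈ Finset.Icc 2 p.M)
    {g hs : Classifier 𝒳} (hg : g ∈ H) (hhs : hs ∈ H) :
    t.mom D p H (fun x b => errInd g x b - errInd hs x b) j
      ≤ t.b D p H j g + t.b D p H j hs
        + D.real {z | g z.1 ≠ hs z.1 ∧ z.1 ∉ t.qreg p H j} := by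
  classical
  obtain ⟨hj2, hjM⟩ := Finset.mem_Icc.1 hj
  have hR := hf.epochMeasurable hH (Finset.mem_Icc.2 ⟨by omega, hjM⟩ : j ∈ Finset.Icc 1 p.M)
  have hF := hf.feasible j hj
  have hhj : Measurable (t.h j) := hH _ (hf.erm j (Finset.mem_Icc.2 ⟨hj2, by omega⟩)).1
  have hn : ¬ j ≤ 1 := by omega
  have eq : t.qreg p H j = t.region p H j := if_neg hn
  have ep : ∀ x, t.qprob j x = t.P j x := fun x => if_neg hn
  have hpm := pMin_pos (t := t) (p := p) (j := j) hv.c₃_ge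
    (hv.three_le_τ (by omega) (by omega)) H.card
  have hpm1 : t.pMin p H.card j ≤ 1 := (min_le_right _ _).trans (by norm_num)
  have hreg : MeasurableSet (t.region p H j) := eq ▸ hR.qreg
  have hset : ∀ {g : Classifier 𝒳}, Measurable g →
      MeasurableSet {x | g x ≠ t.h j x ∧ x ∈ t.region p H j} := fun hg =>
    (measurableSet_eq_fun hg hhj).compl.inter hreg
  have hind : ∀ {g : Classifier 𝒳}, Measurable g → Measurable
      ({x | g x ≠ t.h j x ∧ x ∈ t.region p H j}.indicator fun x => 1 / t.P j x) := fun hg =>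
    (measurable_const.div hF.measurable).indicator (hset hg)
  have ii : ∀ {g : Classifier 𝒳}, Measurable g → Integrable (fun z : 𝒳 × Bool =>
      {x | g x ≠ t.h j x ∧ x ∈ t.region p H j}.indicator (fun x => 1 / t.P j x) z.1) D := by
    intro g hg
    refine integrable_of_abs_le (c := 1 / t.pMin p H.card j) ((hind hg).comp measurable_fst)
      fun z => ?_
    rw [Set.indicator]
    split_ifs with hz
    · have := hF.pMin_le _ hz.2
      rw [abs_of_nonneg (one_div_nonneg.2 (hpm.le.trans this))]
      exact one_div_le_one_div_of_le hpm this
    · rw [abs_zero]; exact (one_div_pos.2 hpm).le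
  have hvar : ∀ g ∈ H, ∫ z, {x | g x ≠ t.h j x ∧ x ∈ t.region p H j}.indicator
      (fun x => 1 / t.P j x) z.1 ∂D ≤ t.b D p H j g := by
    intro g hg
    have h := hF.variance g hg
    rwa [Measure.fst, integral_map measurable_fst.aemeasurable
      (hind (hH g hg)).aestronglyMeasurable] at h
  have m3 : MeasurableSet {z : 𝒳 × Bool | g z.1 ≠ hs z.1 ∧ z.1 ∉ t.qreg p H j} :=
    (measurableSet_eq_fun ((hH g hg).comp measurable_fst)
      ((hH hs hhs).comp measurable_fst)).compl.inter (measurable_fst hR.qreg).compl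
  have i3 : Integrable
      ({z : 𝒳 × Bool | g z.1 ≠ hs z.1 ∧ z.1 ∉ t.qreg p H j}.indicator (1 : 𝒳 × Bool → ℝ)) D :=
    (integrable_const (1 : ℝ)).indicator m3
  refine le_trans ?_ (add_le_add (add_le_add (hvar g hg) (hvar hs hhs)) le_rfl)
  rw [mom, ← integral_indicator_one m3, ← integral_add (ii (hH g hg)) (ii (hH hs hhs)),
    ← integral_add ((ii (hH g hg)).fun_add (ii (hH hs hhs))) i3]
  refine integral_mono (integrable_mom hR ((measurable_errInd (hH g hg)).sub
    (measurable_errInd (hH hs hhs))) (abs_errInd_sub_le g hs) hpm hpm1 fun x hx => by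
      rw [ep]; exact hF.pMin_le x (eq ▸ hx))
    (((ii (hH g hg)).fun_add (ii (hH hs hhs))).fun_add i3) fun z => ?_
  -- In the region, if g and `hs` differ then one of them differs from h_j; the constraints for g
  -- and for `hs` pay for these two cases.
  by_cases hz : z.1 ∈ t.qreg p H j
  · have hz' : z.1 ∈ t.region p H j := eq ▸ hz
    have hP : 0 < t.P j z.1 := hpm.trans_le (hF.pMin_le _ hz')
    have hP' : 0 < 1 / t.P j z.1 := one_div_pos.2 hP
    simp only [Set.indicator, Set.mem_ofPred_eq, hz, hz', if_true, ep, errInd]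
    rw [div_eq_mul_one_div (_ ^ 2)]
    generalize 1 / t.P j z.1 = r at hP'
    cases g z.1 <;> cases hs z.1 <;> cases t.h j z.1 <;> cases t.lab p H j z <;> simp <;> linarith
  · have hz' : z.1 ∉ t.region p H j := eq ▸ hz
    simp only [Set.indicator, Set.mem_ofPred_eq, hz, hz', errInd]
    cases g z.1 <;> cases hs z.1 <;> cases t.lab p H j z <;> norm_num

end Trace

/-- Follows from log y ≤ y/e and e > 16/7. The factor 7/8 leaves y/8 for the square root in the
bound on the weights. -/
theorem two_mul_log_le {y : ℝ} (hy : 0 < y) : 2 * Real.log y ≤ 7 / 8 * y := by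
  have h1 := Real.log_le_sub_one_of_pos (div_pos hy (Real.exp_pos 1))
  rw [Real.log_div hy.ne' (Real.exp_pos 1).ne', Real.log_exp] at h1
  have h2 : y / Real.exp 1 ≤ 7 / 16 * y := by
    rw [div_le_iff₀ (Real.exp_pos 1)]
    nlinarith [Real.exp_one_gt_d9]
  linarith

theorem one_le_log_of_three_le {y : ℝ} (hy : 3 ≤ y) : 1 ≤ Real.log y := by
  rw [Real.le_log_iff_exp_le (by linarith)]
  linarith [Real.exp_one_lt_d9]

/-! ### Numerical consequences of the requirements on the inputs -/

namespace Params

variable {p : Params} {N m j : ℕ}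

/-- `τ_m ε_m`. -/
noncomputable def acc (p : Params) (N m : ℕ) : ℝ :=
  32 * (Real.log (N / p.δ) + Real.log (p.τ m))

theorem Valid.three_le_cast (hv : p.Valid N) (hm : m ∈ Finset.Icc 1 p.M) : (3 : ℝ) ≤ p.τ m := by
  obtain ⟨h1, h2⟩ := Finset.mem_Icc.1 hm
  exact_mod_cast hv.three_le_τ h1 h2

theorem Valid.one_le_log_τ (hv : p.Valid N) (hm : m ∈ Finset.Icc 1 p.M) :
    1 ≤ Real.log (p.τ m) := one_le_log_of_three_le (hv.three_le_cast hm)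

theorem Valid.last_mem (hv : p.Valid N) : p.M ∈ Finset.Icc 1 p.M :=
  Finset.mem_Icc.2 ⟨hv.one_le_M, le_rfl⟩

theorem Valid.one_le_log_card_div (hv : p.Valid N) (hN : 1 ≤ N) : 1 ≤ Real.log (N / p.δ) := by
  have h1 : (1 : ℝ) ≤ N := by exact_mod_cast hN
  have h2 : Real.exp 1 ≤ 1 / p.δ := by
    rw [le_div_iff₀ hv.δ_pos]
    have := (lt_div_iff₀ (Real.exp_pos 1)).1 hv.δ_lt
    linarith
  rw [Real.le_log_iff_exp_le (div_pos (by linarith) hv.δ_pos)]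
  exact h2.trans (div_le_div_of_nonneg_right h1 hv.δ_pos.le)

theorem Valid.log_τ_le (hv : p.Valid N) (hj : 1 ≤ j) (hjm : j ≤ m) (hm : m ≤ p.M) :
    Real.log (p.τ j) ≤ Real.log (p.τ m) := by
  have := hv.three_le_cast (Finset.mem_Icc.2 ⟨hj, hjm.trans hm⟩)
  exact Real.log_le_log (by linarith) (by exact_mod_cast hv.τ_le_τ hjm hm)

theorem Valid.acc_le (hv : p.Valid N) (hj : 1 ≤ j) (hjm : j ≤ m) (hm : m ≤ p.M) :
    p.acc N j ≤ p.acc N m := by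
  unfold acc
  linarith [hv.log_τ_le hj hjm hm]

theorem Valid.le_acc (hv : p.Valid N) (hN : 1 ≤ N) (hm : m ∈ Finset.Icc 1 p.M) :
    64 ≤ p.acc N m := by
  unfold acc
  linarith [hv.one_le_log_card_div hN, hv.one_le_log_τ hm]

theorem Valid.τ_mul_eps (hv : p.Valid N) (hm : m ∈ Finset.Icc 1 p.M) :
    p.τ m * p.eps N m = p.acc N m := by
  have := hv.three_le_cast hm
  have h0 : (p.τ m : ℝ) ≠ 0 := by linarith
  unfold eps acc
  field_simp

theorem Valid.γ_ge' (hv : p.Valid N) : 216 ≤ p.γ := by linarith [hv.γ_ge, hv.η_ge]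

theorem Valid.c₁_sq_ge (hv : p.Valid N) : 24 * p.α ^ 2 ≤ p.c₁ ^ 2 := by
  have h6 : √6 ^ 2 = 6 := Real.sq_sqrt (by norm_num)
  have h := pow_le_pow_left₀ (by have := hv.α_ge; positivity) hv.c₁_ge 2
  nlinarith

theorem Valid.one_le_c₁ (hv : p.Valid N) : 1 ≤ p.c₁ := by
  have h6 : 2 ≤ √6 := Real.le_sqrt_of_sq_le (by norm_num)
  nlinarith [hv.c₁_ge, hv.α_ge]

theorem Valid.c₂_ge' (hv : p.Valid N) : 216 * p.c₁ ^ 2 ≤ p.c₂ := by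
  nlinarith [hv.c₂_ge, hv.η_ge, sq_nonneg p.c₁]

theorem Valid.c₁_le_c₂ (hv : p.Valid N) : p.c₁ ≤ p.c₂ := by
  nlinarith [hv.c₂_ge', hv.one_le_c₁]

/-- Since η ≤ 4γ, the factor η / (864γ) is at most 1/216. -/
theorem Valid.β_sq_le (hv : p.Valid N) (hN : 1 ≤ N) :
    p.β ^ 2 ≤ 1 / (216 * p.acc N p.M * Real.log p.n) := by
  have h := hv.β_le
  have hacc := hv.le_acc hN hv.last_mem
  have hlog : 1 ≤ Real.log p.n := hv.one_le_log_τ hv.last_mem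
  have e : 864 * p.γ * p.n * p.eps N p.M * Real.log p.n
      = 864 * p.γ * p.acc N p.M * Real.log p.n := by
    rw [← hv.τ_mul_eps hv.last_mem, n]; ring
  rw [e] at h
  have hγ := hv.γ_ge'
  refine h.trans ?_
  rw [div_le_div_iff₀ (by positivity) (by positivity)]
  have : 0 ≤ p.acc N p.M * Real.log p.n := by positivity
  nlinarith [hv.γ_ge]

theorem Valid.ξ_le' (hv : p.Valid N) : p.ξ ≤ 1 / (8 * p.acc N p.M * Real.log p.n) := by
  have h := hv.ξ_le
  rwa [show 8 * (p.n : ℝ) * p.eps N p.M * Real.log p.n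
    = 8 * p.acc N p.M * Real.log p.n by rw [← hv.τ_mul_eps hv.last_mem, n]; ring] at h

/-- Relative lengths of the epochs. The first epoch does not contribute. -/
theorem Valid.sum_len_div_le (hv : p.Valid N) (hm : m ∈ Finset.Icc 1 p.M) :
    ∑ j ∈ Finset.Icc 2 m, p.len j / p.τ (j - 1) ≤ 2 * Real.log (p.τ m) := by
  obtain ⟨h1, h2⟩ := Finset.mem_Icc.1 hm
  induction m, h1 using Nat.le_induction with
  | base => simpa using (zero_le_one.trans (hv.one_le_log_τ hm))
  | succ m hm1 ih =>
    have hm' : m ∈ Finset.Icc 1 p.M := Finset.mem_Icc.2 ⟨hm1, by omega⟩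
    rw [Finset.sum_Icc_succ_top (by omega), Nat.add_sub_cancel]
    have ih' := ih hm' (by omega)
    have ha := hv.three_le_cast hm'
    have hb := hv.three_le_cast hm
    have hle : (p.τ (m + 1) : ℝ) ≤ 2 * p.τ m := by exact_mod_cast hv.τ_le m hm1 (by omega)
    have hge : (p.τ m : ℝ) ≤ p.τ (m + 1) := by exact_mod_cast (hv.τ_lt m (by omega)).le
    have hlog := Real.log_le_sub_one_of_pos
      (div_pos (by linarith : (0 : ℝ) < p.τ m) (by linarith : (0 : ℝ) < p.τ (m + 1)))
    rw [Real.log_div (by linarith) (by linarith)] at hlog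
    -- Epochs at most double, so τ_m in the denominator may become τ_{m+1} at the price of the
    -- factor 2. Then 1 - u ≤ -log u makes the sum telescope.
    have : p.len (m + 1) / p.τ m ≤ 2 * (1 - p.τ m / p.τ (m + 1)) := by
      rw [len, Nat.add_sub_cancel, one_sub_div (by linarith), mul_div_assoc',
        div_le_div_iff₀ (by linarith) (by linarith)]
      nlinarith
    linarith

end Params

/-! ### Cumulative losses, thresholds and weights -/

namespace Trace

variable {𝒳 : Type*} {t : Trace 𝒳} {p : Params} {H : Finset (Classifier 𝒳)} {m j : ℕ}

theorem loss_bounds {g : Classifier 𝒳} {i : ℕ} (h : 0 ≤ t.w i) :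
    0 ≤ t.loss g i ∧ t.loss g i ≤ t.w i := by
  unfold loss
  split_ifs <;> simp [h]

/-- Smallest cumulative loss at the end of epoch `m`. -/
noncomputable def minLoss (t : Trace 𝒳) (p : Params) (m : ℕ) : ℝ := t.cumLoss p m (t.h (m + 1))

/-- The threshold on the scale of cumulative losses, `τ_m Δ_m`. -/
noncomputable def thr (t : Trace 𝒳) (p : Params) (N m : ℕ) : ℝ :=
  p.c₁ * √(p.acc N m * t.minLoss p m) + p.c₂ * p.acc N m * Real.log (p.τ m)

theorem τ_mul_Δ {N : ℕ} (hv : p.Valid N) (hm : m ∈ Finset.Icc 1 p.M) :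
    p.τ m * t.Δ p N m = t.thr p N m := by
  have h3 := hv.three_le_cast hm
  have h0 : (0 : ℝ) < p.τ m := by linarith
  have hs : p.τ m * √(p.eps N m * (t.minLoss p m / p.τ m)) = √(p.acc N m * t.minLoss p m) := by
    rw [← hv.τ_mul_eps hm]
    conv_lhs => rw [← Real.sqrt_sq h0.le]
    rw [← Real.sqrt_mul (sq_nonneg _)]
    congr 1
    rw [Real.sqrt_sq h0.le]
    field_simp
  rw [thr, ← hs, Δ, empErr_eq, minLoss, ← hv.τ_mul_eps hm]
  ring

theorem thr_ge {N : ℕ} (hv : p.Valid N) :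
    p.c₂ * p.acc N m * Real.log (p.τ m) ≤ t.thr p N m :=
  le_add_of_nonneg_left (mul_nonneg (zero_le_one.trans hv.one_le_c₁) (Real.sqrt_nonneg _))

theorem thr_pos {N : ℕ} (hv : p.Valid N) (hN : 1 ≤ N) (hm : m ∈ Finset.Icc 1 p.M) :
    0 < t.thr p N m := by
  refine lt_of_lt_of_le ?_ (thr_ge hv)
  have h1 := hv.le_acc hN hm
  have h2 := hv.one_le_log_τ hm
  have h3 := hv.c₁_le_c₂
  have h4 := hv.one_le_c₁
  have h5 : 0 < p.c₂ := by linarith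
  positivity

/-- Multiplying by τ_m passes from empirical errors to cumulative losses, the scale on which
contributions of different epochs add up. -/
theorem mem_A_succ_iff (hv : p.Valid H.card) (hm : m ∈ Finset.Icc 1 p.M) {g : Classifier 𝒳} :
    g ∈ t.A p H (m + 1) ↔
      g ∈ H ∧ t.cumLoss p m g - t.minLoss p m ≤ p.γ * t.thr p H.card m := by
  have h0 : (0 : ℝ) < p.τ m := by linarith [hv.three_le_cast hm]
  rw [A, Set.mem_ofPred_eq, Nat.add_sub_cancel, empErr_eq, empErr_eq, ← τ_mul_Δ hv hm,
    ← sub_div, div_le_iff₀ h0, minLoss, mul_comm (p.τ m : ℝ), mul_assoc]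

/-- A bound on the inverse of the minimum query probability. -/
theorem inv_pMin_le (hv : p.Valid H.card) (hm : m ∈ Finset.Icc 1 p.M) :
    1 / t.pMin p H.card (m + 1)
      ≤ √(t.minLoss p m / p.acc H.card p.M) + 2 * Real.log (p.τ m) := by
  have h3 := hv.three_le_cast hm
  have hl := hv.one_le_log_τ hm
  have hs := Real.sqrt_nonneg (t.minLoss p m / p.acc H.card p.M)
  have e : (p.τ m : ℝ) * t.empErr p m (t.h (m + 1)) / (p.n * p.eps H.card p.M)
      = t.minLoss p m / p.acc H.card p.M := by
    rw [Params.n, hv.τ_mul_eps hv.last_mem, empErr_eq, mul_div_cancel₀ _ (by linarith), minLoss]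
  rw [pMin, Nat.add_sub_cancel, e, one_div]
  -- One logarithm is already in the denominator of the minimum probability. The second makes the
  -- bound at least 2, which accounts for the cap 1/2.
  refine inv_le_of_inv_le₀ (by linarith) (le_min ?_ ?_)
  · rw [← one_div]
    exact div_le_div₀ (by linarith [hv.c₃_ge]) hv.c₃_ge (by linarith) (by linarith)
  · rw [← one_div]
    exact one_div_le_one_div_of_le two_pos (by linarith)

variable [MeasurableSpace 𝒳] {D : Measure (𝒳 × Bool)}

theorem Follows.minLoss_le (hf : t.Follows D p H) (hv : p.Valid H.card)
    (hm : m ∈ Finset.Icc 1 p.M) {g : Classifier 𝒳} (hg : g ∈ H) :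
    t.minLoss p m ≤ t.cumLoss p m g := by
  have h0 : (0 : ℝ) < p.τ m := by linarith [hv.three_le_cast hm]
  obtain ⟨h1, h2⟩ := Finset.mem_Icc.1 hm
  have h := (hf.erm (m + 1) (Finset.mem_Icc.2 ⟨by omega, by omega⟩)).2 g hg
  rw [Nat.add_sub_cancel, empErr_eq, empErr_eq, div_le_div_iff_of_pos_right h0] at h
  exact h

theorem Follows.h_mem (hf : t.Follows D p H) (hm : m ∈ Finset.Icc 1 p.M) : t.h (m + 1) ∈ H := by
  obtain ⟨h1, h2⟩ := Finset.mem_Icc.1 hm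
  exact (hf.erm (m + 1) (Finset.mem_Icc.2 ⟨by omega, by omega⟩)).1

theorem Follows.h_mem_A (hf : t.Follows D p H) (hv : p.Valid H.card) (hN : 1 ≤ H.card)
    (hm : m ∈ Finset.Icc 1 p.M) : t.h (m + 1) ∈ t.A p H (m + 1) := by
  rw [mem_A_succ_iff hv hm]
  refine ⟨hf.h_mem hm, ?_⟩
  rw [minLoss, sub_self]
  exact mul_nonneg (by linarith [hv.γ_ge']) (thr_pos hv hN hm).le

/-- Weights are nonnegative, and in epoch `m + 1` at most `max (1, 1 / P_min)`. -/
theorem Follows.w_bounds (hf : t.Follows D p H) (hv : p.Valid H.card) {i : ℕ}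
    (hi : i ∈ Finset.Icc 1 p.n) :
    0 ≤ t.w i ∧ (t.w i ≤ 1 ∨ 2 ≤ p.epoch i ∧ t.w i ≤ 1 / t.pMin p H.card (p.epoch i)) := by
  obtain ⟨hj, hij⟩ := hv.mem_epoch hi
  obtain ⟨hj1, hjM⟩ := Finset.mem_Icc.1 hj
  rcases hj1.eq_or_lt with h1 | h1
  · rw [← h1, hv.τ_one, Nat.sub_self, hv.τ_zero] at hij
    have hi3 : i ∈ Finset.Icc 1 3 := by
      simp only [Finset.mem_Ioc] at hij
      simp only [Finset.mem_Icc]; omega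
    rw [(hf.start i hi3).2.2]
    simp
  · have hj2 := Finset.mem_Icc.2 ⟨h1, hjM⟩
    by_cases hx : t.x i ∈ t.region p H (p.epoch i)
    · by_cases hq : t.q i = true
      · have hF := hf.feasible _ hj2
        have hp := pMin_pos (t := t) hv.c₃_ge (hv.three_le_τ (by omega)
          (by omega : p.epoch i - 1 ≤ p.M)) H.card
        have hP := hF.pMin_le _ hx
        rw [(hf.queried _ hj2 i hij hx hq).2]
        exact ⟨one_div_nonneg.2 (hp.le.trans hP), Or.inr ⟨h1, one_div_le_one_div_of_le hp hP⟩⟩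
      · rw [(hf.skipped _ hj2 i hij hx (by simpa using hq)).2]
        simp
    · rw [(hf.predicted _ hj2 i hij hx).2.2]
      simp

theorem Follows.cumLoss_mono (hf : t.Follows D p H) (hv : p.Valid H.card) (hjm : j ≤ m)
    (hm : m ≤ p.M) (g : Classifier 𝒳) : t.cumLoss p j g ≤ t.cumLoss p m g :=
  Finset.sum_le_sum_of_subset_of_nonneg (Finset.Icc_subset_Icc_right (hv.τ_le_τ hjm hm))
    fun _ hi _ => (loss_bounds (hf.w_bounds hv
      (Finset.Icc_subset_Icc_right (hv.τ_le_τ hm le_rfl) hi)).1).1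

theorem Follows.cumLoss_nonneg (hf : t.Follows D p H) (hv : p.Valid H.card)
    (hm : m ≤ p.M) (g : Classifier 𝒳) : 0 ≤ t.cumLoss p m g :=
  Finset.sum_nonneg fun _ hi => (loss_bounds (hf.w_bounds hv
      (Finset.Icc_subset_Icc_right (hv.τ_le_τ hm le_rfl) hi)).1).1

/-- Losses are nonnegative, so the later minimizer had no larger loss at the earlier epoch, where
the minimum is smaller still. -/
theorem Follows.minLoss_mono (hf : t.Follows D p H) (hv : p.Valid H.card) (hj : 1 ≤ j)
    (hjm : j ≤ m) (hm : m ≤ p.M) : t.minLoss p j ≤ t.minLoss p m :=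
  (hf.minLoss_le hv (Finset.mem_Icc.2 ⟨hj, hjm.trans hm⟩)
    (hf.h_mem (Finset.mem_Icc.2 ⟨hj.trans hjm, hm⟩))).trans (hf.cumLoss_mono hv hjm hm _)

/-- All ingredients grow with the epoch. Hence bounds from earlier epochs can be stated with the
current threshold. -/
theorem Follows.thr_mono (hf : t.Follows D p H) (hv : p.Valid H.card) (hN : 1 ≤ H.card)
    (hj : 1 ≤ j) (hjm : j ≤ m) (hm : m ≤ p.M) : t.thr p H.card j ≤ t.thr p H.card m := by
  have hjM : j ∈ Finset.Icc 1 p.M := Finset.mem_Icc.2 ⟨hj, hjm.trans hm⟩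
  have h1 := hv.acc_le hj hjm hm
  have h2 := hf.minLoss_mono hv hj hjm hm
  have h3 := hv.log_τ_le hj hjm hm
  have h4 := hv.le_acc hN hjM
  have h5 := hv.one_le_log_τ hjM
  have h6 := hf.cumLoss_nonneg hv (hjm.trans hm) (t.h (j + 1))
  have h7 := hv.one_le_c₁
  have h8 := hv.c₁_le_c₂
  have h9 : 0 ≤ p.c₂ := by linarith
  change 0 ≤ t.minLoss p j at h6
  unfold thr
  refine add_le_add (mul_le_mul_of_nonneg_left (Real.sqrt_le_sqrt ?_) (by linarith)) ?_
  · exact mul_le_mul h1 h2 h6 (by linarith)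
  · exact mul_le_mul (mul_le_mul_of_nonneg_left h1 h9) h3 (by linarith)
      (mul_nonneg h9 (by linarith))

/-- A crude bound by induction: the weights of epoch m + 1 are at most τ_m/8 + 7τ_m/8 = τ_m. It
confines the random threshold to a range covered by τ_m + 1 scales. -/
theorem Follows.cumLoss_le_sq (hf : t.Follows D p H) (hv : p.Valid H.card) (hN : 1 ≤ H.card)
    (hm : m ∈ Finset.Icc 1 p.M) (g : Classifier 𝒳) :
    t.cumLoss p m g ≤ (p.τ m : ℝ) ^ 2 := by
  obtain ⟨h1, h2⟩ := Finset.mem_Icc.1 hm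
  induction m, h1 using Nat.le_induction generalizing g with
  | base =>
    have : ∀ i ∈ Finset.Icc 1 (p.τ 1), t.loss g i ≤ 1 := fun i hi => by
      have hw : t.w i = 1 := (hf.start i (hv.τ_one ▸ hi)).2.2
      exact hw ▸ (loss_bounds (by rw [hw]; norm_num)).2
    refine (Finset.sum_le_card_nsmul _ _ _ this).trans ?_
    simp [hv.τ_one]
    norm_num
  | succ m hm1 ih =>
    have hm' : m ∈ Finset.Icc 1 p.M := Finset.mem_Icc.2 ⟨hm1, by omega⟩
    have ih' := fun g => ih hm' g (by omega)
    have h3 := hv.three_le_cast hm'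
    have hle : p.τ m ≤ p.τ (m + 1) := (hv.τ_lt m (by omega)).le
    have hlec : (p.τ m : ℝ) ≤ p.τ (m + 1) := by exact_mod_cast hle
    have hR : 1 / t.pMin p H.card (m + 1) ≤ p.τ m := by
      refine (inv_pMin_le hv hm').trans ?_
      have hA := hv.le_acc hN hv.last_mem
      have : √(t.minLoss p m / p.acc H.card p.M) ≤ p.τ m / 8 := by
        refine Real.sqrt_le_iff.2 ⟨by positivity, ?_⟩
        rw [div_le_iff₀ (by linarith)]
        have := ih' (t.h (m + 1))
        change t.minLoss p m ≤ _ at this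
        nlinarith [sq_nonneg (p.τ m : ℝ)]
      linarith [two_mul_log_le (by linarith : (0 : ℝ) < p.τ m)]
    have e : t.cumLoss p (m + 1) g = t.cumLoss p m g
        + ∑ i ∈ Finset.Ioc (p.τ m) (p.τ (m + 1)), t.loss g i := by
      have e : ∀ k, Finset.Icc 1 k = Finset.Ioc 0 k := fun k => by ext; simp; omega
      rw [cumLoss, cumLoss, e, e, Finset.sum_Ioc_consecutive _ (Nat.zero_le _) hle]
    have hs : ∑ i ∈ Finset.Ioc (p.τ m) (p.τ (m + 1)), t.loss g i
        ≤ ((p.τ (m + 1) : ℝ) - p.τ m) * p.τ m := by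
      have := Finset.sum_le_card_nsmul (Finset.Ioc (p.τ m) (p.τ (m + 1))) (t.loss g) (p.τ m : ℝ)
        fun i hi => by
          have hi' : i ∈ Finset.Ioc (p.τ (m + 1 - 1)) (p.τ (m + 1)) := by simpa using hi
          have hep := hv.epoch_eq h2 hi'
          have hin : i ∈ Finset.Icc 1 p.n := by
            have h4 := Finset.mem_Ioc.1 hi
            exact Finset.mem_Icc.2 ⟨by omega, h4.2.trans (hv.τ_le_τ h2 le_rfl)⟩
          obtain ⟨w0, w1⟩ := hf.w_bounds hv hin
          refine (loss_bounds w0).2.trans ?_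
          rcases w1 with w1 | ⟨-, w1⟩
          · linarith
          · rw [hep] at w1
            exact w1.trans hR
      rwa [Nat.card_Ioc, nsmul_eq_mul, Nat.cast_sub hle] at this
    rw [e]
    nlinarith [ih' g]

end Trace

/-- Linear combination of the losses of `g` and `h`. -/
def linInd {𝒳 : Type*} (c : ℝ × ℝ) (g h : Classifier 𝒳) (x : 𝒳) (b : Bool) : ℝ :=
  c.1 * errInd g x b + c.2 * errInd h x b

/-- The linear combinations for which concentration is needed. -/
noncomputable def coeffs : Finset (ℝ × ℝ) := {(1, -1), (-1, 1), (0, 1), (0, -1)}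

theorem abs_linInd_le {𝒳 : Type*} {c : ℝ × ℝ} (hc : c ∈ coeffs) (g h : Classifier 𝒳) (x : 𝒳)
    (b : Bool) : |linInd c g h x b| ≤ 1 := by
  simp only [coeffs, Finset.mem_insert, Finset.mem_singleton] at hc
  rcases hc with rfl | rfl | rfl | rfl <;> simp only [linInd, errInd] <;>
    split_ifs <;> norm_num

theorem measurable_linInd {𝒳 : Type*} [MeasurableSpace 𝒳] (c : ℝ × ℝ) {g h : Classifier 𝒳}
    (hg : Measurable g) (hh : Measurable h) :
    Measurable fun z : 𝒳 × Bool => linInd c g h z.1 z.2 :=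
  ((measurable_errInd hg).const_mul _).add ((measurable_errInd hh).const_mul _)

/-- The grid of scales. -/
noncomputable def Params.grid (p : Params) (m k : ℕ) : ℝ :=
  2 / (p.γ * p.c₂ * Real.log (p.τ m) * (k + 1))

/-! ### Deviation bounds at a scale adapted to the threshold -/

namespace Trace

variable {𝒳 : Type*} [MeasurableSpace 𝒳] {t : Trace 𝒳} {D : Measure (𝒳 × Bool)} {p : Params}
  {H : Finset (Classifier 𝒳)} {m j : ℕ} {g hs : Classifier 𝒳}

/-- The deviations of the importance weighted losses are small at all scales. -/
def Concentrated (t : Trace 𝒳) (D : Measure (𝒳 × Bool)) (p : Params) (H : Finset (Classifier 𝒳))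
    (hs : Classifier 𝒳) : Prop :=
  ∀ m ∈ Finset.Icc 1 p.M, ∀ k ∈ Finset.range (p.τ m + 1), ∀ g ∈ H, ∀ c ∈ coeffs,
    ∑ i ∈ Finset.Icc 1 (p.τ m), (t.score p H (p.grid m k) (linInd c g hs) i
      - t.drift D p H (p.grid m k) (linInd c g hs) (p.epoch i)) ≤ p.acc H.card m / 8

/-- Sum of the conditional expectations of the losses of `g`. -/
noncomputable def meanSum (t : Trace 𝒳) (D : Measure (𝒳 × Bool)) (p : Params)
    (H : Finset (Classifier 𝒳)) (m : ℕ) (g : Classifier 𝒳) : ℝ :=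
  ∑ j ∈ Finset.Icc 1 m, p.len j * t.mean D p H (errInd g) j

/-- Sum of the conditional second moments of the loss differences. -/
noncomputable def momSum (t : Trace 𝒳) (D : Measure (𝒳 × Bool)) (p : Params)
    (H : Finset (Classifier 𝒳)) (m : ℕ) (g hs : Classifier 𝒳) : ℝ :=
  ∑ j ∈ Finset.Icc 1 m, p.len j * t.mom D p H (fun x b => errInd g x b - errInd hs x b) j

theorem mom_congr {F G : 𝒳 → Bool → ℝ} (h : ∀ x b, F x b ^ 2 = G x b ^ 2) :
    t.mom D p H F j = t.mom D p H G j := by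
  simp only [mom, h]

/-- With no query probability below the scale λ, the scores add up to λ times cumulative losses, and
the drifts to λ times the means plus λ² times the second moments. -/
theorem Concentrated.sum_le [IsProbabilityMeasure D] (hc : t.Concentrated D p H hs)
    (hf : t.Follows D p H) (hv : p.Valid H.card) (hH : ∀ h ∈ H, Measurable h)
    (hm : m ∈ Finset.Icc 1 p.M) {k : ℕ} (hk : k ∈ Finset.range (p.τ m + 1)) (hg : g ∈ H)
    (hhs : hs ∈ H) {c : ℝ × ℝ} (hcc : c ∈ coeffs) (hl : 0 < p.grid m k) (hl1 : p.grid m k ≤ 1)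
    (hP : ∀ j ∈ Finset.Icc 1 m, ∀ x ∈ t.qreg p H j, p.grid m k ≤ t.qprob j x) :
    p.grid m k * (c.1 * t.cumLoss p m g + c.2 * t.cumLoss p m hs)
      - p.grid m k * (c.1 * t.meanSum D p H m g + c.2 * t.meanSum D p H m hs)
      - p.grid m k ^ 2 * ∑ j ∈ Finset.Icc 1 m, p.len j * t.mom D p H (linInd c g hs) j
      ≤ p.acc H.card m / 8 := by
  obtain ⟨hm1, hmM⟩ := Finset.mem_Icc.1 hm
  have h := hc m hm k hk g hg c hcc
  set lam := p.grid m k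
  have hmF := measurable_linInd c (hH g hg) (hH hs hhs)
  have hFb := abs_linInd_le hcc g hs
  have e1 : ∑ i ∈ Finset.Icc 1 (p.τ m), t.score p H lam (linInd c g hs) i
      = lam * (c.1 * t.cumLoss p m g + c.2 * t.cumLoss p m hs) := by
    rw [cumLoss_eq_sum_wscore hf hv g hmM, cumLoss_eq_sum_wscore hf hv hs hmM, Finset.mul_sum,
      Finset.mul_sum, ← Finset.sum_add_distrib, Finset.mul_sum]
    refine Finset.sum_congr rfl fun i hi => ?_
    have hin : i ∈ Finset.Icc 1 p.n := Finset.Icc_subset_Icc_right (hv.τ_le_τ hmM le_rfl) hi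
    have hep := Finset.mem_Icc.1 (hv.mem_epoch hin).1
    have hle : p.epoch i ≤ m := Nat.sInf_le (Finset.mem_Icc.1 hi).2
    rw [score_eq_mul_wscore (hP _ (Finset.mem_Icc.2 ⟨hep.1, hle⟩) _)]
    congr 1
    exact wscore_lin c.1 c.2 (errInd g) (errInd hs) i
  have e2 : ∑ i ∈ Finset.Icc 1 (p.τ m), t.drift D p H lam (linInd c g hs) (p.epoch i)
      = lam * (c.1 * t.meanSum D p H m g + c.2 * t.meanSum D p H m hs)
      + lam ^ 2 * ∑ j ∈ Finset.Icc 1 m, p.len j * t.mom D p H (linInd c g hs) j := by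
    rw [hv.sum_epoch (fun j => t.drift D p H lam (linInd c g hs) j) hmM, meanSum, meanSum,
      Finset.mul_sum, Finset.mul_sum, Finset.mul_sum, ← Finset.sum_add_distrib, Finset.mul_sum,
      ← Finset.sum_add_distrib]
    refine Finset.sum_congr rfl fun j hj => ?_
    have hj' := Finset.mem_Icc.1 hj
    have hR := hf.epochMeasurable hH (Finset.mem_Icc.2 ⟨hj'.1, hj'.2.trans hmM⟩)
    rw [drift_eq hR hmF hFb hl hl1 (hP j hj),
      show t.mean D p H (linInd c g hs) j = c.1 * t.mean D p H (errInd g) j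
        + c.2 * t.mean D p H (errInd hs) j from mean_lin hR (measurable_errInd (hH g hg))
          (abs_errInd_le g) (measurable_errInd (hH hs hhs)) (abs_errInd_le hs) c.1 c.2]
    ring
  rw [Finset.sum_sub_distrib, e1, e2] at h
  linarith

/-- Deviation bounds for the cumulative losses. -/
theorem Concentrated.abs_sub_le [IsProbabilityMeasure D] (hc : t.Concentrated D p H hs)
    (hf : t.Follows D p H) (hv : p.Valid H.card) (hH : ∀ h ∈ H, Measurable h)
    (hm : m ∈ Finset.Icc 1 p.M) {k : ℕ} (hk : k ∈ Finset.range (p.τ m + 1)) (hg : g ∈ H)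
    (hhs : hs ∈ H) (hl : 0 < p.grid m k) (hl1 : p.grid m k ≤ 1)
    (hP : ∀ j ∈ Finset.Icc 1 m, ∀ x ∈ t.qreg p H j, 2 * p.grid m k ≤ t.qprob j x)
    (hsA : ∀ j ∈ Finset.Icc 2 m, hs ∈ t.A p H j) (hjA : ∀ j ∈ Finset.Icc 2 m, t.h j ∈ t.A p H j) :
    |t.cumLoss p m g - t.cumLoss p m hs - (t.meanSum D p H m g - t.meanSum D p H m hs)|
        ≤ p.grid m k * t.momSum D p H m g hs + p.acc H.card m / (8 * p.grid m k) ∧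
      |t.cumLoss p m hs - t.meanSum D p H m hs|
        ≤ t.meanSum D p H m hs / 2 + p.acc H.card m / (8 * p.grid m k) := by
  obtain ⟨hm1, hmM⟩ := Finset.mem_Icc.1 hm
  have hP' : ∀ j ∈ Finset.Icc 1 m, ∀ x ∈ t.qreg p H j, p.grid m k ≤ t.qprob j x :=
    fun j hj x hx => by linarith [hP j hj x hx]
  have key := fun c (hcc : c ∈ coeffs) => hc.sum_le hf hv hH hm hk hg hhs hcc hl hl1 hP'
  -- The two signs of the loss difference give the first two-sided bound, the two signs of the loss
  -- of `hs` the second. In the latter, λ times the second moment is absorbed by half the mean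
  -- because the query probabilities are at least 2λ.
  have k1 := key (1, -1) (by simp [coeffs])
  have k2 := key (-1, 1) (by simp [coeffs])
  have k3 := key (0, 1) (by simp [coeffs])
  have k4 := key (0, -1) (by simp [coeffs])
  set lam := p.grid m k
  have e1 : ∀ c : ℝ × ℝ, (c = (1, -1) ∨ c = (-1, 1)) →
      ∑ j ∈ Finset.Icc 1 m, p.len j * t.mom D p H (linInd c g hs) j = t.momSum D p H m g hs := by
    intro c hc
    refine Finset.sum_congr rfl fun j _ => ?_
    rw [mom_congr (G := fun x b => errInd g x b - errInd hs x b) fun x b => ?_]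
    rcases hc with rfl | rfl <;> simp only [linInd] <;> ring
  have e2 : ∀ c : ℝ × ℝ, (c = (0, 1) ∨ c = (0, -1)) →
      lam * ∑ j ∈ Finset.Icc 1 m, p.len j * t.mom D p H (linInd c g hs) j
        ≤ t.meanSum D p H m hs / 2 := by
    intro c hc
    rw [Finset.mul_sum, meanSum, Finset.sum_div]
    refine Finset.sum_le_sum fun j hj => ?_
    have hj' := Finset.mem_Icc.1 hj
    have hR := hf.epochMeasurable hH (Finset.mem_Icc.2 ⟨hj'.1, hj'.2.trans hmM⟩)
    rw [mom_congr (G := errInd hs) fun x b => by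
      rcases hc with rfl | rfl <;> simp only [linInd] <;> ring]
    have := mom_errInd_le (D := D) hR (hH hs hhs)
      (fun h => hsA j (Finset.mem_Icc.2 ⟨h, hj'.2⟩)) (fun h => hjA j (Finset.mem_Icc.2 ⟨h, hj'.2⟩))
      hl hl1 (hP j hj)
    have hlen := hv.len_nonneg (hj'.2.trans hmM)
    nlinarith
  rw [e1 _ (by simp)] at k1 k2
  have k3' := e2 (0, 1) (by simp)
  have k4' := e2 (0, -1) (by simp)
  simp only at k1 k2 k3 k4
  have edp : lam * (p.acc H.card m / (8 * lam)) = p.acc H.card m / 8 := by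
    field_simp
  constructor
  · rw [abs_le]
    constructor <;> refine le_of_mul_le_mul_left ?_ hl <;> nlinarith
  · rw [abs_le]
    constructor <;> refine le_of_mul_le_mul_left ?_ hl <;> nlinarith

/-- On the grid there is a scale that is adapted to the threshold. -/
theorem Follows.exists_grid (hf : t.Follows D p H) (hv : p.Valid H.card) (hN : 1 ≤ H.card)
    (hm : m ∈ Finset.Icc 1 p.M) : ∃ k ∈ Finset.range (p.τ m + 1), 0 < p.grid m k ∧
      p.grid m k * (p.γ * t.thr p H.card m) ≤ 2 * p.acc H.card m ∧
      p.acc H.card m / p.grid m k ≤ p.γ * t.thr p H.card m := by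
  have hT := thr_pos (t := t) hv hN hm
  have hTge := thr_ge (t := t) (m := m) hv
  have ha := hv.le_acc hN hm
  have hx := hv.one_le_log_τ hm
  have h1 := hv.one_le_c₁
  have h2 := hv.c₁_le_c₂
  have hγ := hv.γ_ge'
  have h3 := hv.three_le_cast hm
  have hL := hf.cumLoss_le_sq hv hN hm (t.h (m + 1))
  change t.minLoss p m ≤ _ at hL
  set a := p.acc H.card m
  set x := Real.log (p.τ m)
  set T := t.thr p H.card m with hTdef
  have hc2 : 0 < p.c₂ := by linarith
  have hB : 0 < p.c₂ * a * x := by positivity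
  have hTB : T ≤ p.c₂ * a * x * (p.τ m + 1) := by
    have hs : √(a * t.minLoss p m) ≤ a * p.τ m := by
      refine Real.sqrt_le_iff.2 ⟨by positivity, ?_⟩
      have : a * t.minLoss p m ≤ a * (p.τ m : ℝ) ^ 2 := mul_le_mul_of_nonneg_left hL (by linarith)
      nlinarith [sq_nonneg (p.τ m : ℝ), mul_nonneg (by linarith : (0 : ℝ) ≤ a)
        (sq_nonneg (p.τ m : ℝ))]
    have hs2 : p.c₁ * √(a * t.minLoss p m) ≤ p.c₂ * (a * p.τ m) :=
      mul_le_mul h2 hs (Real.sqrt_nonneg _) hc2.le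
    have hs3 : p.c₂ * (a * p.τ m) ≤ p.c₂ * (a * p.τ m) * x :=
      le_mul_of_one_le_right (by positivity) hx
    have : T = p.c₁ * √(a * t.minLoss p m) + p.c₂ * a * x := rfl
    linarith
  -- The scale must lie between a/(γT) and 2a/(γT), that is, (k + 1)c₂ax between T and 2T. Rounding
  -- up achieves this because T ≥ c₂ax.
  set k := ⌈T / (p.c₂ * a * x)⌉₊ - 1 with hk
  have hpos : 0 < ⌈T / (p.c₂ * a * x)⌉₊ := Nat.ceil_pos.2 (by positivity)
  have hk1 : (k : ℝ) + 1 = ⌈T / (p.c₂ * a * x)⌉₊ := by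
    rw [hk, Nat.cast_sub hpos]; simp
  have hlow : T / (p.c₂ * a * x) ≤ k + 1 := hk1 ▸ Nat.le_ceil _
  have hup : (k : ℝ) + 1 < T / (p.c₂ * a * x) + 1 := hk1 ▸ Nat.ceil_lt_add_one (by positivity)
  rw [div_le_iff₀ hB] at hlow
  have hup' : ((k : ℝ) + 1) * (p.c₂ * a * x) ≤ 2 * T := by
    have : ((k : ℝ) + 1) * (p.c₂ * a * x) ≤ (T / (p.c₂ * a * x) + 1) * (p.c₂ * a * x) :=
      mul_le_mul_of_nonneg_right hup.le hB.le
    rw [add_mul (T / _), div_mul_cancel₀ _ hB.ne'] at this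
    linarith
  refine ⟨k, ?_, ?_, ?_, ?_⟩
  · have : ⌈T / (p.c₂ * a * x)⌉₊ ≤ p.τ m + 1 := by
      refine Nat.ceil_le.2 ?_
      rw [div_le_iff₀ hB]
      push_cast
      linarith
    simp only [Finset.mem_range]
    omega
  · unfold Params.grid
    positivity
  · unfold Params.grid
    rw [div_mul_eq_mul_div, div_le_iff₀ (by positivity)]
    nlinarith
  · unfold Params.grid
    rw [div_div_eq_mul_div, div_le_iff₀ two_pos]
    nlinarith

end Trace

/-- The deviation bound at the adapted scale. -/
theorem deviation_le {a A x T γ α G L Ds S V lam : ℝ} (ha : 1 ≤ a) (haA : a ≤ A)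
    (hT : 0 < T) (hγ : 216 ≤ γ) (hα : 1 ≤ α) (hG : 0 ≤ G) (hD : 0 ≤ Ds)
    (hT1 : 24 * α ^ 2 * (a * L) ≤ T ^ 2) (hx : 1 ≤ x) (hT2 : 5184 * α ^ 2 * (a * x) ≤ T)
    (hl : 0 < lam) (hl2 : lam * (γ * T) ≤ 2 * a) (hl1 : a / lam ≤ γ * T)
    (hS : S ≤ 2 * (L + Ds) + γ * T / 4)
    (hV : V ≤ 2 * α ^ 2 * (G + 6 * S + 4 * x * (γ * T))
      + γ / (36 * A) * T * (G + γ * T) + T ^ 2 / (2 * A)) :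
    lam * V + a / (8 * lam) ≤ G / 8 + γ * T / 5 + Ds / 8 := by
  have hγ0 : 0 < γ := by linarith
  have ha0 : 0 < a := by linarith
  have hA0 : 0 < A := by linarith
  have hα2 : 1 ≤ α ^ 2 := by nlinarith
  have hT2' : 5184 * α ^ 2 * a ≤ T := by
    refine le_trans ?_ hT2
    rw [← mul_assoc]
    exact le_mul_of_one_le_right (by positivity) hx
  have hlT : lam * T ≤ 2 * a / γ := by
    rw [le_div_iff₀ hγ0]; linarith
  have hlT' : lam * T ≤ a / 108 := by
    refine hlT.trans ?_
    rw [div_le_div_iff₀ hγ0 (by norm_num)]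
    nlinarith
  have b1 : lam * α ^ 2 ≤ 1 / 500000 := by
    have : lam * (5184 * α ^ 2 * a) ≤ a / 108 :=
      (mul_le_mul_of_nonneg_left hT2' hl.le).trans hlT'
    have h' : a * (lam * α ^ 2 * 559872) ≤ a * 1 := by linarith
    have := le_of_mul_le_mul_left h' ha0
    linarith
  have b2 : lam * α ^ 2 * L ≤ T / 2592 := by
    have h1 : lam * (24 * α ^ 2 * (a * L)) ≤ lam * T ^ 2 := mul_le_mul_of_nonneg_left hT1 hl.le
    have h2 : lam * T ^ 2 ≤ a / 108 * T := by
      rw [pow_two, ← mul_assoc]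
      exact mul_le_mul_of_nonneg_right hlT' hT.le
    have h' : a * (lam * α ^ 2 * L * 24) ≤ a * (T / 108) := by linarith
    have := le_of_mul_le_mul_left h' ha0
    linarith
  have b3 : lam * α ^ 2 * (γ * T) ≤ T / 2592 := by
    have : α ^ 2 * (lam * (γ * T)) ≤ α ^ 2 * (2 * a) :=
      mul_le_mul_of_nonneg_left hl2 (by positivity)
    linarith
  have b4 : lam * α ^ 2 * (x * (γ * T)) ≤ T / 2592 := by
    have : α ^ 2 * x * (lam * (γ * T)) ≤ α ^ 2 * x * (2 * a) :=
      mul_le_mul_of_nonneg_left hl2 (by positivity)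
    linarith
  have b5 : lam * (γ / (36 * A) * T * (G + γ * T)) ≤ (G + γ * T) / 18 := by
    have h1 : lam * (γ / (36 * A) * T) ≤ 1 / 18 := by
      rw [show lam * (γ / (36 * A) * T) = lam * (γ * T) / (36 * A) by ring,
        div_le_div_iff₀ (by positivity) (by norm_num)]
      linarith
    have := mul_le_mul_of_nonneg_right h1 (by positivity : 0 ≤ G + γ * T)
    linarith
  have b6 : lam * (T ^ 2 / (2 * A)) ≤ T / 216 := by
    rw [show lam * (T ^ 2 / (2 * A)) = lam * T * T / (2 * A) by ring,
      div_le_div_iff₀ (by positivity) (by norm_num)]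
    have h1 : lam * T * T ≤ A / 108 * T :=
      mul_le_mul_of_nonneg_right (by linarith) hT.le
    linarith
  have b7 : a / (8 * lam) ≤ γ * T / 8 := by
    rw [mul_comm, ← div_div]
    linarith
  have hγT : 216 * T ≤ γ * T := mul_le_mul_of_nonneg_right hγ hT.le
  -- The main shares of γT are 1/8 from `b7` and 1/18 from `b5`. The other contributions are small
  -- multiples of T ≤ γT/216, and `b1` makes the remaining coefficients of G and Ds tiny.
  have hV' := mul_le_mul_of_nonneg_left hV hl.le
  have hS' := mul_le_mul_of_nonneg_left hS (by positivity : 0 ≤ lam * α ^ 2)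
  have b8 := mul_le_mul_of_nonneg_right b1 hG
  have b9 := mul_le_mul_of_nonneg_right b1 hD
  linarith

/-! ### Induction over the epochs -/

namespace Trace

variable {𝒳 : Type*} [MeasurableSpace 𝒳] {t : Trace 𝒳} {D : Measure (𝒳 × Bool)} {p : Params}
  {H : Finset (Classifier 𝒳)} {m j : ℕ} {g hs : Classifier 𝒳}

theorem Follows.h_mem_A_of_mem (hf : t.Follows D p H) (hv : p.Valid H.card) (hN : 1 ≤ H.card)
    (hj : 2 ≤ j) (hjM : j ≤ p.M) : t.h j ∈ t.A p H j := by
  have := hf.h_mem_A hv hN (m := j - 1) (Finset.mem_Icc.2 ⟨by omega, by omega⟩)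
  rwa [Nat.sub_add_cancel (by omega)] at this

/-- Favorable bias, for the sums over the epochs. -/
theorem Follows.meanSum_sub_le [IsProbabilityMeasure D] (hf : t.Follows D p H)
    (hv : p.Valid H.card) (hH : ∀ h ∈ H, Measurable h) (hN : 1 ≤ H.card) (hbest : IsBest D H hs)
    (hg : g ∈ H) (hjm : j ≤ m) (hm : m ≤ p.M) (hsA : ∀ j ∈ Finset.Icc 2 m, hs ∈ t.A p H j) :
    t.meanSum D p H j g - t.meanSum D p H j hs ≤ t.meanSum D p H m g - t.meanSum D p H m hs ∧
      p.τ m * (err D g - err D hs) ≤ t.meanSum D p H m g - t.meanSum D p H m hs := by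
  have hterm : ∀ i ∈ Finset.Icc 1 m, err D g - err D hs
      ≤ t.mean D p H (errInd g) i - t.mean D p H (errInd hs) i := fun i hi => by
    have hi' := Finset.mem_Icc.1 hi
    exact err_sub_le_mean_sub
      (hf.epochMeasurable hH (Finset.mem_Icc.2 ⟨hi'.1, hi'.2.trans hm⟩)) (hH g hg) (hH _ hbest.1)
      (fun h => hsA i (Finset.mem_Icc.2 ⟨h, hi'.2⟩))
      (fun h => hf.h_mem_A_of_mem hv hN h (hi'.2.trans hm))
  have hlen : ∀ i ∈ Finset.Icc 1 m, 0 ≤ p.len i := fun i hi =>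
    hv.len_nonneg ((Finset.mem_Icc.1 hi).2.trans hm)
  have hτ : (p.τ m : ℝ) = ∑ i ∈ Finset.Icc 1 m, p.len i := by
    have := hv.sum_epoch (fun _ => 1) hm
    simpa using this
  have e : ∀ k, t.meanSum D p H k g - t.meanSum D p H k hs = ∑ i ∈ Finset.Icc 1 k,
      p.len i * (t.mean D p H (errInd g) i - t.mean D p H (errInd hs) i) := fun k => by
    rw [meanSum, meanSum, ← Finset.sum_sub_distrib]
    exact Finset.sum_congr rfl fun i _ => by ring
  rw [e, e, hτ, Finset.sum_mul]
  constructor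
  · refine Finset.sum_le_sum_of_subset_of_nonneg (Finset.Icc_subset_Icc_right hjm) fun i hi _ => ?_
    exact mul_nonneg (hlen i hi) (by linarith [hterm i hi, hbest.2 g hg])
  · exact Finset.sum_le_sum fun i hi => mul_le_mul_of_nonneg_left (hterm i hi) (hlen i hi)

/-- Second moment of the loss difference after the first epoch. -/
theorem mom_succ_le [IsProbabilityMeasure D] (hf : t.Follows D p H) (hv : p.Valid H.card)
    (hH : ∀ h ∈ H, Measurable h) (hN : 1 ≤ H.card) (hj : 1 ≤ j) (hjM : j + 1 ≤ p.M) (hg : g ∈ H)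
    (hhs : hs ∈ H) (hsA : hs ∈ t.A p H (j + 1)) {W T R ξ : ℝ}
    (hW : t.cumLoss p j g - t.minLoss p j + (t.cumLoss p j hs - t.minLoss p j) ≤ W)
    (hT : t.thr p H.card j ≤ T) (hR : p.τ j * (err D (t.h (j + 1)) - err D hs) ≤ R)
    (hξ : p.ξ ≤ ξ) (hξ0 : 0 ≤ ξ) :
    t.mom D p H (fun x b => errInd g x b - errInd hs x b) (j + 1)
      ≤ 2 * p.α ^ 2 * (t.mean D p H (errInd g) (j + 1) - t.mean D p H (errInd hs) (j + 1)
          + 6 * t.mean D p H (errInd hs) (j + 1))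
        + (4 * p.α ^ 2 * R + 2 * p.β ^ 2 * p.γ * W * T + 2 * ξ * T ^ 2) / p.τ j := by
  have hjm : j ∈ Finset.Icc 1 p.M := Finset.mem_Icc.2 ⟨hj, by omega⟩
  have hE := hf.epochMeasurable hH (Finset.mem_Icc.2 ⟨by omega, hjM⟩ : j + 1 ∈ Finset.Icc 1 p.M)
  have h1 := mom_sub_le hf hv hH (Finset.mem_Icc.2 ⟨by omega, hjM⟩ : j + 1 ∈ Finset.Icc 2 p.M)
    hg hhs
  have h2 := sum_disagree_le (D := D) hE (hH g hg) (hH hs hhs) (hH _ (hf.h_mem hjm))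
    (fun _ => hsA) (fun _ => hf.h_mem_A hv hN hjm)
  have hT0 := thr_pos (t := t) hv hN hjm
  have hτ3 := hv.three_le_cast hjm
  have hτ0 : (0 : ℝ) < p.τ j := by linarith
  have hα : 1 ≤ p.α ^ 2 := by nlinarith [hv.α_ge]
  have hγ := hv.γ_ge'
  have eq : t.qreg p H (j + 1) = t.region p H (j + 1) := if_neg (by omega)
  have hset : ∀ {g : Classifier 𝒳}, Measurable g →
      MeasurableSet {x | g x ≠ t.h (j + 1) x ∧ x ∈ t.region p H (j + 1)} := fun hg =>
    (measurableSet_eq_fun hg (hH _ (hf.h_mem hjm))).compl.inter (eq ▸ hE.qreg)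
  have hb : ∀ g ∈ H, t.b D p H (j + 1) g
      = 2 * p.α ^ 2 * D.real {z | g z.1 ≠ t.h (j + 1) z.1 ∧ z.1 ∈ t.qreg p H (j + 1)}
        + (2 * p.β ^ 2 * p.γ * (t.cumLoss p j g - t.minLoss p j) * t.thr p H.card j
          + p.ξ * t.thr p H.card j ^ 2) / p.τ j := by
    intro g hg
    have hbg := fst_real_eq (D := D) (hset (hH g hg))
    rw [b, hbg, eq, Nat.add_sub_cancel, empErr_eq, empErr_eq, ← τ_mul_Δ hv hjm, minLoss]
    simp only [Set.mem_ofPred_eq]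
    field_simp
    ring
  rw [hb g hg, hb hs hhs] at h1
  set Xg := D.real {z | g z.1 ≠ t.h (j + 1) z.1 ∧ z.1 ∈ t.qreg p H (j + 1)}
  set Xs := D.real {z | hs z.1 ≠ t.h (j + 1) z.1 ∧ z.1 ∈ t.qreg p H (j + 1)}
  have hY : 0 ≤ D.real {z | g z.1 ≠ hs z.1 ∧ z.1 ∉ t.qreg p H (j + 1)} := measureReal_nonneg
  set Y := D.real {z | g z.1 ≠ hs z.1 ∧ z.1 ∉ t.qreg p H (j + 1)}
  have h3 : Y ≤ 2 * p.α ^ 2 * Y := le_mul_of_one_le_left hY (by linarith)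
  have h4 := mul_le_mul_of_nonneg_left h2 (by positivity : 0 ≤ 2 * p.α ^ 2)
  have h5 : 4 * p.α ^ 2 * (err D (t.h (j + 1)) - err D hs) ≤ 4 * p.α ^ 2 * R / p.τ j := by
    rw [le_div_iff₀ hτ0]
    have := mul_le_mul_of_nonneg_left hR (by positivity : 0 ≤ 4 * p.α ^ 2)
    linarith
  have hdg := sub_nonneg.2 (hf.minLoss_le hv hjm hg)
  have hds := sub_nonneg.2 (hf.minLoss_le hv hjm hhs)
  have h6 : 2 * p.β ^ 2 * p.γ * (t.cumLoss p j g - t.minLoss p j) * t.thr p H.card j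
      + 2 * p.β ^ 2 * p.γ * (t.cumLoss p j hs - t.minLoss p j) * t.thr p H.card j
      ≤ 2 * p.β ^ 2 * p.γ * W * T := by
    rw [← add_mul, ← mul_add]
    have hk : 0 ≤ 2 * p.β ^ 2 * p.γ := by positivity
    exact mul_le_mul (mul_le_mul_of_nonneg_left hW hk) hT hT0.le
      (mul_nonneg hk ((add_nonneg hdg hds).trans hW))
  have h7 : p.ξ * t.thr p H.card j ^ 2 ≤ ξ * T ^ 2 :=
    (mul_le_mul_of_nonneg_right hξ (sq_nonneg _)).trans
      (mul_le_mul_of_nonneg_left (pow_le_pow_left₀ hT0.le hT 2) hξ0)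
  have h8 : (2 * p.β ^ 2 * p.γ * (t.cumLoss p j g - t.minLoss p j) * t.thr p H.card j
        + p.ξ * t.thr p H.card j ^ 2) / p.τ j
      + (2 * p.β ^ 2 * p.γ * (t.cumLoss p j hs - t.minLoss p j) * t.thr p H.card j
        + p.ξ * t.thr p H.card j ^ 2) / p.τ j
      ≤ (2 * p.β ^ 2 * p.γ * W * T + 2 * ξ * T ^ 2) / p.τ j := by
    rw [← add_div]
    exact div_le_div_of_nonneg_right (by linarith) hτ0.le
  have h9 : (4 * p.α ^ 2 * R + 2 * p.β ^ 2 * p.γ * W * T + 2 * ξ * T ^ 2) / p.τ j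
      = 4 * p.α ^ 2 * R / p.τ j + (2 * p.β ^ 2 * p.γ * W * T + 2 * ξ * T ^ 2) / p.τ j := by
    rw [← add_div]; ring
  rw [h9]
  linarith

/-- The outcome of the analysis at the end of epoch `m`. -/
structure Controlled (t : Trace 𝒳) (D : Measure (𝒳 × Bool)) (p : Params)
    (H : Finset (Classifier 𝒳)) (hs : Classifier 𝒳) (m : ℕ) : Prop where
  dev : ∀ g ∈ H,
    |t.cumLoss p m g - t.cumLoss p m hs - (t.meanSum D p H m g - t.meanSum D p H m hs)|
      ≤ (t.meanSum D p H m g - t.meanSum D p H m hs) / 2 + p.γ * t.thr p H.card m / 2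
  noise : |t.cumLoss p m hs - t.meanSum D p H m hs|
    ≤ t.meanSum D p H m hs / 2 + p.γ * t.thr p H.card m / 8
  best : t.cumLoss p m hs - t.minLoss p m ≤ p.γ * t.thr p H.card m / 2

theorem Controlled.mem_A (hc : t.Controlled D p H hs m) (hv : p.Valid H.card) (hN : 1 ≤ H.card)
    (hm : m ∈ Finset.Icc 1 p.M) (hhs : hs ∈ H) : hs ∈ t.A p H (m + 1) := by
  rw [mem_A_succ_iff hv hm]
  have hT := thr_pos (t := t) hv hN hm
  have : 0 < p.γ * t.thr p H.card m := mul_pos (by linarith [hv.γ_ge']) hT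
  exact ⟨hhs, by linarith [hc.best]⟩

/-- Inverts the deviation bound: half of the conditional regret on its right side is absorbed on the
left. -/
theorem Controlled.meanSum_sub_le (hc : t.Controlled D p H hs m) (hg : g ∈ H) {W : ℝ}
    (hW : t.cumLoss p m g - t.cumLoss p m hs ≤ W) :
    t.meanSum D p H m g - t.meanSum D p H m hs ≤ 2 * W + p.γ * t.thr p H.card m := by
  have := (abs_le.1 (hc.dev g hg)).1
  linarith

/-- The variance bound under the induction hypothesis. -/
theorem momSum_le [IsProbabilityMeasure D] (hf : t.Follows D p H)
    (hv : p.Valid H.card) (hH : ∀ h ∈ H, Measurable h) (hN : 1 ≤ H.card) (hbest : IsBest D H hs)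
    (hg : g ∈ H) (hm : m ∈ Finset.Icc 1 p.M)
    (ih : ∀ j, 1 ≤ j → j < m → t.Controlled D p H hs j)
    (hsA : ∀ j ∈ Finset.Icc 2 m, hs ∈ t.A p H j) :
    t.momSum D p H m g hs
      ≤ 2 * p.α ^ 2 * (t.meanSum D p H m g - t.meanSum D p H m hs + 6 * t.meanSum D p H m hs
          + 4 * Real.log (p.τ m) * (p.γ * t.thr p H.card m))
        + p.γ / (36 * p.acc H.card p.M) * t.thr p H.card m
          * (t.meanSum D p H m g - t.meanSum D p H m hs + p.γ * t.thr p H.card m)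
        + t.thr p H.card m ^ 2 / (2 * p.acc H.card p.M) := by
  obtain ⟨hm1, hmM⟩ := Finset.mem_Icc.1 hm
  have hα : 1 ≤ p.α ^ 2 := by nlinarith [hv.α_ge]
  have hγ := hv.γ_ge'
  have hT0 := thr_pos (t := t) hv hN hm
  have hA := hv.le_acc hN hv.last_mem
  have hln : 1 ≤ Real.log p.n := hv.one_le_log_τ hv.last_mem
  have hβ := hv.β_sq_le hN
  have hξ := hv.ξ_le'
  have hG0 : 0 ≤ t.meanSum D p H m g - t.meanSum D p H m hs :=
    le_trans (mul_nonneg (Nat.cast_nonneg _) (sub_nonneg.2 (hbest.2 g hg)))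
      (hf.meanSum_sub_le hv hH hN hbest hg le_rfl hmM hsA).2
  set T := t.thr p H.card m
  set A := p.acc H.card p.M
  set G := t.meanSum D p H m g - t.meanSum D p H m hs with hG
  set ln := Real.log p.n
  -- K bounds the numerator over τ_i in `mom_succ_le`, uniformly in the earlier epochs i: the regret
  -- of the empirical minimizer is at most γT (zero empirical regret in
  -- `Controlled.meanSum_sub_le`), and the empirical regrets of g and `hs` add up to at most 3G/2 +
  -- γT/2 + 2 · γT/2.
  set K := 4 * p.α ^ 2 * (p.γ * T) + 2 * p.β ^ 2 * p.γ * (3 / 2 * G + 3 / 2 * (p.γ * T)) * T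
    + 2 * (1 / (8 * A * ln)) * T ^ 2 with hK
  have hK0 : 0 ≤ K := by positivity
  have hlen : ∀ j ∈ Finset.Icc 1 m, 0 ≤ p.len j := fun i hi =>
    hv.len_nonneg ((Finset.mem_Icc.1 hi).2.trans hmM)
  set md : ℕ → ℝ := fun j => t.mean D p H (errInd g) j - t.mean D p H (errInd hs) j
    + 6 * t.mean D p H (errInd hs) j with hmd
  have hmd0 : ∀ j ∈ Finset.Icc 1 m, 0 ≤ md j := fun j hj => by
    have := mean_errInd_nonneg (t := t) (D := D) (p := p) (H := H) (j := j) g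
    have := mean_errInd_nonneg (t := t) (D := D) (p := p) (H := H) (j := j) hs
    simp only [hmd]; linarith
  have hsum : ∑ j ∈ Finset.Icc 1 m, p.len j * md j = G + 6 * t.meanSum D p H m hs := by
    rw [hG, meanSum, meanSum, ← Finset.sum_sub_distrib, Finset.mul_sum, ← Finset.sum_add_distrib]
    exact Finset.sum_congr rfl fun j _ => by simp only [hmd]; ring
  have hsplit : ∀ f : ℕ → ℝ, ∑ j ∈ Finset.Icc 1 m, f j = f 1 + ∑ j ∈ Finset.Icc 2 m, f j :=
    fun f => by
      rw [← Finset.add_sum_Ioc_eq_sum_Icc hm1]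
      rfl
  have hfirst : p.len 1 * t.mom D p H (fun x b => errInd g x b - errInd hs x b) 1
      ≤ 2 * p.α ^ 2 * (p.len 1 * md 1) := by
    have h1m : 1 ∈ Finset.Icc 1 m := Finset.mem_Icc.2 ⟨le_rfl, hm1⟩
    have h := mom_sub_le_of_le_one (D := D)
      (hf.epochMeasurable hH (Finset.mem_Icc.2 ⟨le_rfl, hm1.trans hmM⟩)) le_rfl (hH g hg)
      (hH _ hbest.1)
    have h1 := mul_le_mul_of_nonneg_left h (hlen 1 h1m)
    have h2 := mul_nonneg (hlen 1 h1m) (hmd0 1 h1m)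
    have h3 : p.len 1 * md 1 ≤ 2 * p.α ^ 2 * (p.len 1 * md 1) :=
      le_mul_of_one_le_left h2 (by linarith)
    exact h1.trans h3
  have hrest : ∀ j ∈ Finset.Icc 2 m,
      p.len j * t.mom D p H (fun x b => errInd g x b - errInd hs x b) j
        ≤ 2 * p.α ^ 2 * (p.len j * md j) + p.len j / p.τ (j - 1) * K := by
    intro j hj
    obtain ⟨hj2, hjm⟩ := Finset.mem_Icc.1 hj
    obtain ⟨i, rfl⟩ : ∃ i, j = i + 1 := ⟨j - 1, by omega⟩
    have hi1 : 1 ≤ i := by omega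
    have hiM : i ∈ Finset.Icc 1 p.M := Finset.mem_Icc.2 ⟨hi1, by omega⟩
    have hci := ih i hi1 (by omega)
    have hTi : t.thr p H.card i ≤ T := hf.thr_mono hv hN hi1 (by omega) hmM
    have hγT : p.γ * t.thr p H.card i ≤ p.γ * T := mul_le_mul_of_nonneg_left hTi (by linarith)
    have hsAi : ∀ j ∈ Finset.Icc 2 i, hs ∈ t.A p H j := fun j hj => hsA j (by
      simp only [Finset.mem_Icc] at hj ⊢; omega)
    have hR : p.τ i * (err D (t.h (i + 1)) - err D hs) ≤ p.γ * T := by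
      have h1 := (hf.meanSum_sub_le hv hH hN hbest (hf.h_mem hiM) le_rfl (by omega) hsAi).2
      have h2 := hci.meanSum_sub_le (hf.h_mem hiM) (W := 0)
        (sub_nonpos.2 (hf.minLoss_le hv hiM hbest.1))
      linarith
    have hW : t.cumLoss p i g - t.minLoss p i + (t.cumLoss p i hs - t.minLoss p i)
        ≤ 3 / 2 * G + 3 / 2 * (p.γ * T) := by
      have h1 := (hf.meanSum_sub_le hv hH hN hbest hg (show i ≤ m by omega) hmM hsA).1
      have h2 := (abs_le.1 (hci.dev g hg)).2
      have h3 := hci.best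
      linarith
    have h := mom_succ_le hf hv hH hN hi1 (by omega) hg hbest.1 (hsA _ hj) hW hTi hR hξ
      (by positivity)
    rw [← hK] at h
    have h1 := mul_le_mul_of_nonneg_left h (hlen (i + 1) (Finset.mem_Icc.2 ⟨by omega, hjm⟩))
    refine h1.trans (le_of_eq ?_)
    rw [Nat.add_sub_cancel]
    simp only [hmd]
    ring
  have hlenK : (∑ j ∈ Finset.Icc 2 m, p.len j / p.τ (j - 1)) * K ≤ 2 * Real.log (p.τ m) * K :=
    mul_le_mul_of_nonneg_right (hv.sum_len_div_le hm) hK0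
  have hxm : Real.log (p.τ m) ≤ ln := hv.log_τ_le hm1 hmM le_rfl
  have hx1 := hv.one_le_log_τ hm
  have hKx : 2 * Real.log (p.τ m) * K ≤ 2 * p.α ^ 2 * (4 * Real.log (p.τ m) * (p.γ * T))
      + p.γ / (36 * A) * T * (G + p.γ * T) + T ^ 2 / (2 * A) := by
    -- The logarithm produced by summing over the epochs is paid for by the log n in the
    -- requirements on β² and ξ.
    have k1 : p.β ^ 2 * Real.log (p.τ m) ≤ 1 / (216 * A) := by
      have : p.β ^ 2 * Real.log (p.τ m) ≤ 1 / (216 * A * ln) * ln :=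
        mul_le_mul hβ hxm (by linarith) (by positivity)
      refine this.trans (le_of_eq ?_)
      field_simp
    have k2 : 1 / (8 * A * ln) * Real.log (p.τ m) ≤ 1 / (8 * A) := by
      have : 1 / (8 * A * ln) * Real.log (p.τ m) ≤ 1 / (8 * A * ln) * ln :=
        mul_le_mul_of_nonneg_left hxm (by positivity)
      refine this.trans (le_of_eq ?_)
      field_simp
    have k3 := mul_le_mul_of_nonneg_right k1
      (by positivity : 0 ≤ 6 * p.γ * (G + p.γ * T) * T)
    have k4 := mul_le_mul_of_nonneg_right k2 (by positivity : 0 ≤ 4 * T ^ 2)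
    have e3 : 1 / (216 * A) * (6 * p.γ * (G + p.γ * T) * T)
        = p.γ / (36 * A) * T * (G + p.γ * T) := by field_simp; ring
    have e4 : 1 / (8 * A) * (4 * T ^ 2) = T ^ 2 / (2 * A) := by field_simp; ring
    rw [e3] at k3
    rw [e4] at k4
    rw [hK]
    linarith
  calc t.momSum D p H m g hs
      = p.len 1 * t.mom D p H (fun x b => errInd g x b - errInd hs x b) 1
        + ∑ j ∈ Finset.Icc 2 m,
          p.len j * t.mom D p H (fun x b => errInd g x b - errInd hs x b) j := hsplit _
    _ ≤ 2 * p.α ^ 2 * (p.len 1 * md 1) + ∑ j ∈ Finset.Icc 2 m,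
          (2 * p.α ^ 2 * (p.len j * md j) + p.len j / p.τ (j - 1) * K) :=
        add_le_add hfirst (Finset.sum_le_sum hrest)
    _ = 2 * p.α ^ 2 * (G + 6 * t.meanSum D p H m hs)
        + (∑ j ∈ Finset.Icc 2 m, p.len j / p.τ (j - 1)) * K := by
        rw [Finset.sum_add_distrib, ← Finset.mul_sum, ← Finset.sum_mul, ← add_assoc, ← mul_add,
          ← hsplit fun j => p.len j * md j, hsum]
    _ ≤ _ := by linarith

/-- On the concentration event, all epochs are controlled. -/
theorem Concentrated.controlled [IsProbabilityMeasure D] (hc : t.Concentrated D p H hs)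
    (hf : t.Follows D p H) (hv : p.Valid H.card) (hH : ∀ h ∈ H, Measurable h)
    (hbest : IsBest D H hs) (hm : m ∈ Finset.Icc 1 p.M) : t.Controlled D p H hs m := by
  have hN : 1 ≤ H.card := Finset.card_pos.2 ⟨hs, hbest.1⟩
  induction m using Nat.strong_induction_on with
  | _ m ih =>
    obtain ⟨hm1, hmM⟩ := Finset.mem_Icc.1 hm
    have ih' : ∀ j, 1 ≤ j → j < m → t.Controlled D p H hs j := fun j h1 h2 =>
      ih j h2 (Finset.mem_Icc.2 ⟨h1, by omega⟩)
    have hsA : ∀ j ∈ Finset.Icc 2 m, hs ∈ t.A p H j := fun j hj => by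
      obtain ⟨h1, h2⟩ := Finset.mem_Icc.1 hj
      have := (ih' (j - 1) (by omega) (by omega)).mem_A hv hN
        (Finset.mem_Icc.2 ⟨by omega, by omega⟩) hbest.1
      rwa [Nat.sub_add_cancel (by omega)] at this
    have hjA : ∀ j ∈ Finset.Icc 2 m, t.h j ∈ t.A p H j := fun j hj => by
      obtain ⟨h1, h2⟩ := Finset.mem_Icc.1 hj
      exact hf.h_mem_A_of_mem hv hN h1 (by omega)
    -- The scale may depend on the trace because concentration holds on the whole grid.
    obtain ⟨k, hk, hl, hl2, hl1⟩ := hf.exists_grid hv hN hm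
    have ha := hv.le_acc hN hm
    have haA : p.acc H.card m ≤ p.acc H.card p.M := hv.acc_le hm1 hmM le_rfl
    have hγ := hv.γ_ge'
    have hα := hv.α_ge
    have hα2 : 1 ≤ p.α ^ 2 := by nlinarith
    have hT := thr_pos (t := t) hv hN hm
    have hTge := thr_ge (t := t) (m := m) hv
    have hx := hv.one_le_log_τ hm
    have hc1 := hv.one_le_c₁
    have hc1' := hv.c₁_sq_ge
    have hc2 := hv.c₂_ge'
    have hL0 : 0 ≤ t.minLoss p m := hf.cumLoss_nonneg hv hmM _
    have hTdef : t.thr p H.card m = p.c₁ * √(p.acc H.card m * t.minLoss p m)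
      + p.c₂ * p.acc H.card m * Real.log (p.τ m) := rfl
    set a := p.acc H.card m
    set A := p.acc H.card p.M
    set T := t.thr p H.card m
    set x := Real.log (p.τ m)
    set L := t.minLoss p m with hLdef
    set lam := p.grid m k
    have hax : 0 < a * x := by positivity
    -- The constant is 216 · 24, from c₂ ≥ 216c₁² and c₁² ≥ 24α².
    have hT2 : 5184 * p.α ^ 2 * (a * x) ≤ T := by
      refine le_trans ?_ hTge
      rw [mul_assoc p.c₂]
      exact mul_le_mul_of_nonneg_right (by linarith) hax.le
    have hsq0 := Real.sqrt_nonneg (a * L)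
    have hsq : √(a * L) ^ 2 = a * L := Real.sq_sqrt (by positivity)
    have hTs : p.c₁ * √(a * L) ≤ T := by
      rw [hTdef]
      have : 0 ≤ p.c₂ * a * x := by
        have : 0 ≤ p.c₂ := by nlinarith
        positivity
      linarith
    have hT1 : 24 * p.α ^ 2 * (a * L) ≤ T ^ 2 := by
      have h1 := pow_le_pow_left₀ (by positivity) hTs 2
      rw [mul_pow, hsq] at h1
      exact (mul_le_mul_of_nonneg_right hc1' (by positivity)).trans h1
    have hlT : lam * T * 108 ≤ a := by
      have : lam * (216 * T) ≤ lam * (p.γ * T) :=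
        mul_le_mul_of_nonneg_left (mul_le_mul_of_nonneg_right hγ hT.le) hl.le
      linarith
    have hcax : 5184 * (a * x) ≤ T := by
      refine le_trans ?_ hT2
      exact mul_le_mul_of_nonneg_right (by linarith) hax.le
    have haT : a * 5184 ≤ T := by
      have : a ≤ a * x := le_mul_of_one_le_right (by linarith) hx
      linarith
    -- Truncation is void, with a factor 2 to spare: after the first epoch, a times the inverse
    -- minimum probability is at most √(aL) + 2ax ≤ 2T, while 108λT ≤ a.
    have hP : ∀ j ∈ Finset.Icc 1 m, ∀ y ∈ t.qreg p H j, 2 * lam ≤ t.qprob j y := by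
      intro j hj y hy
      obtain ⟨hj1, hjm⟩ := Finset.mem_Icc.1 hj
      have hl2 : 2 * lam ≤ 1 := by
        have h1 : lam * (a * 5184) ≤ lam * T := mul_le_mul_of_nonneg_left haT hl.le
        have h2 : a * (2 * lam) ≤ a * 1 := by linarith
        exact le_of_mul_le_mul_left h2 (by linarith)
      rcases hj1.eq_or_lt with h1 | h1
      · simpa [qprob, ← h1] using hl2
      · have hn : ¬ j ≤ 1 := by omega
        obtain ⟨i, rfl⟩ : ∃ i, j = i + 1 := ⟨j - 1, by omega⟩
        have hiM : i ∈ Finset.Icc 1 p.M := Finset.mem_Icc.2 ⟨by omega, by omega⟩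
        have hF := hf.feasible (i + 1) (Finset.mem_Icc.2 ⟨h1, by omega⟩)
        rw [qreg, if_neg hn] at hy
        rw [qprob, if_neg hn]
        refine le_trans ?_ (hF.pMin_le y hy)
        have hpm := pMin_pos (t := t) (j := i + 1) hv.c₃_ge
          (hv.three_le_τ (by omega) (by omega : i + 1 - 1 ≤ p.M)) H.card
        have hinv := inv_pMin_le (t := t) hv hiM
        have hLi : t.minLoss p i ≤ L := hf.minLoss_mono hv (by omega) (by omega) hmM
        have hxi : Real.log (p.τ i) ≤ x := hv.log_τ_le (by omega) (by omega) hmM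
        have hR : 1 / t.pMin p H.card (i + 1) ≤ √(L / A) + 2 * x := by
          refine hinv.trans (add_le_add (Real.sqrt_le_sqrt ?_) (by linarith))
          exact div_le_div_of_nonneg_right hLi (by linarith)
        have hsA : a * √(L / A) ≤ √(a * L) := by
          refine Real.le_sqrt_of_sq_le ?_
          rw [mul_pow, Real.sq_sqrt (div_nonneg hL0 (by linarith)), mul_div_assoc',
            div_le_iff₀ (by linarith)]
          have : a * a * L ≤ a * A * L :=
            mul_le_mul_of_nonneg_right (mul_le_mul_of_nonneg_left haA (by linarith)) hL0
          linarith
        have haR : a * (√(L / A) + 2 * x) ≤ 2 * T := by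
          have : √(a * L) ≤ p.c₁ * √(a * L) := le_mul_of_one_le_left hsq0 hc1
          linarith
        have h2 : 2 * lam * (√(L / A) + 2 * x) ≤ 1 := by
          have h3 : a * (2 * lam * (√(L / A) + 2 * x)) ≤ a * 1 := by
            have := mul_le_mul_of_nonneg_left haR (by linarith : 0 ≤ 2 * lam)
            have : 0 ≤ lam * T := by positivity
            linarith
          exact le_of_mul_le_mul_left h3 (by linarith)
        have h3 : 2 * lam * (1 / t.pMin p H.card (i + 1)) ≤ 1 :=
          (mul_le_mul_of_nonneg_left hR (by linarith)).trans h2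
        rwa [mul_one_div, div_le_one hpm] at h3
    have hl1' : lam ≤ 1 := by
      have h1 : lam * (a * 5184) ≤ lam * T := mul_le_mul_of_nonneg_left haT hl.le
      have h2 : a * lam ≤ a * 1 := by
        have : 0 ≤ lam * a := by positivity
        linarith
      exact le_of_mul_le_mul_left h2 (by linarith)
    have habs := fun g (hg : g ∈ H) =>
      hc.abs_sub_le hf hv hH hm hk hg hbest.1 hl hl1' hP hsA hjA
    have hal : a / (8 * lam) ≤ p.γ * T / 8 := by
      rw [mul_comm, ← div_div]
      linarith
    have hnoise : |t.cumLoss p m hs - t.meanSum D p H m hs|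
        ≤ t.meanSum D p H m hs / 2 + p.γ * T / 8 := by
      linarith [(habs hs hbest.1).2]
    have hDs := sub_nonneg.2 (hf.minLoss_le hv hm hbest.1)
    have hS : t.meanSum D p H m hs ≤ 2 * (L + (t.cumLoss p m hs - L)) + p.γ * T / 4 := by
      linarith [(abs_le.1 hnoise).1]
    have hG0 : ∀ g ∈ H, 0 ≤ t.meanSum D p H m g - t.meanSum D p H m hs := fun g hg =>
      le_trans (mul_nonneg (Nat.cast_nonneg _) (sub_nonneg.2 (hbest.2 g hg)))
        (hf.meanSum_sub_le hv hH hN hbest hg le_rfl hmM hsA).2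
    have hdev : ∀ g ∈ H,
        |t.cumLoss p m g - t.cumLoss p m hs - (t.meanSum D p H m g - t.meanSum D p H m hs)|
        ≤ (t.meanSum D p H m g - t.meanSum D p H m hs) / 8 + p.γ * T / 5
          + (t.cumLoss p m hs - L) / 8 := fun g hg =>
      (habs g hg).1.trans (deviation_le (by linarith) haA hT hγ hα (hG0 g hg) hDs hT1 hx hT2 hl
        hl2 hl1 hS (momSum_le hf hv hH hN hbest hg hm ih' hsA))
    -- For the empirical minimizer the conditional regret is nonnegative, so the deviation bound
    -- leaves Ds ≤ γT/5 + Ds/8 for the empirical regret Ds of `hs`.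
    have hbest' : t.cumLoss p m hs - L ≤ p.γ * T / 2 := by
      have h1 := (abs_le.1 (hdev _ (hf.h_mem hm))).1
      have h2 := hG0 _ (hf.h_mem hm)
      have h3 : t.cumLoss p m (t.h (m + 1)) = L := rfl
      have : 0 < p.γ * T := by positivity
      rw [h3] at h1
      linarith
    refine ⟨fun g hg => (hdev g hg).trans ?_, hnoise, hbest'⟩
    have : 0 < p.γ * T := by positivity
    linarith [hG0 g hg]

end Trace

/-- Solution of the recursive inequality for the number of queries. -/
theorem le_of_self_bound {ω l x τ U K : ℝ} (hω : 0 < ω) (hω1 : ω ≤ 1) (hl : 1 ≤ l) (hx : 1 ≤ x)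
    (hτ : 1 ≤ τ) (hK : 0 ≤ K)
    (h : U ≤ 3 + K * (√(32 * (l + x) * U) + 32 * (l + x) * x) ^ ω * (τ ^ (1 - ω) * x)) :
    U ≤ (6 + (144 * K + 1) ^ 2) * x ^ 3 * τ ^ (2 * (1 - ω) / (2 - ω)) * l := by
  have hb : 0 ≤ 2 * (1 - ω) / (2 - ω) := div_nonneg (by linarith) (by linarith)
  have hτb : 1 ≤ τ ^ (2 * (1 - ω) / (2 - ω)) := Real.one_le_rpow hτ hb
  have hlx3 : 1 ≤ l * x ^ 3 := one_le_mul_of_one_le_of_one_le hl (one_le_pow₀ hx)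
  have hlx : 1 ≤ l * x := one_le_mul_of_one_le_of_one_le hl hx
  -- Small U satisfies the claim outright. Above this level, the summand 3 is at most U/2, and the
  -- square root dominates the other term in the base of the power.
  rcases le_or_gt U (6 * (l * x ^ 3)) with hU | hU
  · refine hU.trans ?_
    have h1 : l * x ^ 3 ≤ l * x ^ 3 * τ ^ (2 * (1 - ω) / (2 - ω)) :=
      le_mul_of_one_le_right (by linarith) hτb
    have h2 : 0 ≤ (144 * K + 1) ^ 2 * (l * x ^ 3 * τ ^ (2 * (1 - ω) / (2 - ω))) := by positivity
    linarith
  have hU0 : 0 < U := by linarith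
  -- Here l + x ≤ 2lx, and 72 = 8 + 64 collects the square root and the term that it dominates.
  have hy : √(32 * (l + x) * U) + 32 * (l + x) * x ≤ 72 * √(l * x * U) := by
    have ha : 32 * (l + x) ≤ 64 * (l * x) := by nlinarith
    have h1 : √(32 * (l + x) * U) ≤ 8 * √(l * x * U) := by
      rw [show (8 : ℝ) = √64 by rw [show (64 : ℝ) = 8 ^ 2 by norm_num]; simp,
        ← Real.sqrt_mul (by norm_num)]
      refine Real.sqrt_le_sqrt ?_
      have := mul_le_mul_of_nonneg_right ha hU0.le
      linarith
    have h2 : l * x ^ 2 ≤ √(l * x * U) := by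
      refine Real.le_sqrt_of_sq_le ?_
      have : l * x * (l * x ^ 3) ≤ l * x * U :=
        mul_le_mul_of_nonneg_left (by linarith) (by linarith)
      linarith
    have h3 := mul_le_mul_of_nonneg_right ha (by linarith : 0 ≤ x)
    linarith
  have hpow : (√(32 * (l + x) * U) + 32 * (l + x) * x) ^ ω
      ≤ 72 * ((l * x) ^ (ω / 2) * U ^ (ω / 2)) := by
    refine (Real.rpow_le_rpow (by positivity) hy hω.le).trans ?_
    rw [Real.mul_rpow (by norm_num) (Real.sqrt_nonneg _), Real.sqrt_eq_rpow,
      ← Real.rpow_mul (by positivity), Real.mul_rpow (by linarith) hU0.le,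
      show 1 / 2 * ω = ω / 2 by ring]
    refine mul_le_mul_of_nonneg_right ?_ (by positivity)
    calc (72 : ℝ) ^ ω ≤ 72 ^ (1 : ℝ) := Real.rpow_le_rpow_of_exponent_le (by norm_num) hω1
      _ = 72 := Real.rpow_one _
  -- Division by U^{ω/2}. Absorbing the summand 3 doubles 72K to 144K, and the added 1 makes the
  -- base at least 1, so that its power q ≤ 2 is at most its square.
  have hmain : U ^ (1 - ω / 2) ≤ (144 * K + 1) * ((l * x) ^ (ω / 2) * τ ^ (1 - ω) * x) := by
    have h0 : 0 < U ^ (ω / 2) := Real.rpow_pos_of_pos hU0 _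
    refine le_of_mul_le_mul_right ?_ h0
    rw [← Real.rpow_add hU0, show 1 - ω / 2 + ω / 2 = 1 by ring, Real.rpow_one]
    have h1 := mul_le_mul_of_nonneg_left hpow hK
    have h2 := mul_le_mul_of_nonneg_right h1 (by positivity : 0 ≤ τ ^ (1 - ω) * x)
    have h3 : 0 ≤ (l * x) ^ (ω / 2) * τ ^ (1 - ω) * x * U ^ (ω / 2) := by positivity
    linarith
  -- The reciprocal of 1 - ω/2; it turns the exponent 1 - ω of τ into 2(1-ω)/(2-ω).
  set q : ℝ := 2 / (2 - ω) with hq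
  have hq0 : 0 < q := div_pos two_pos (by linarith)
  have hq2 : q ≤ 2 := by rw [hq, div_le_iff₀ (by linarith)]; linarith
  have hω2 : (2 - ω) ≠ 0 := by linarith
  have hfin := Real.rpow_le_rpow (by positivity) hmain hq0.le
  rw [← Real.rpow_mul hU0.le, show (1 - ω / 2) * q = 1 by rw [hq]; field_simp, Real.rpow_one,
    Real.mul_rpow (by positivity) (by positivity), Real.mul_rpow (by positivity) (by positivity),
    Real.mul_rpow (by positivity) (by positivity), ← Real.rpow_mul (by positivity),
    ← Real.rpow_mul (by positivity),
    show (1 - ω) * q = 2 * (1 - ω) / (2 - ω) by rw [hq]; ring] at hfin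
  have e1 : (144 * K + 1) ^ q ≤ (144 * K + 1) ^ 2 := by
    rw [← Real.rpow_two]
    exact Real.rpow_le_rpow_of_exponent_le (by linarith) hq2
  have e2 : (l * x) ^ (ω / 2 * q) ≤ l * x := by
    conv_rhs => rw [← Real.rpow_one (l * x)]
    refine Real.rpow_le_rpow_of_exponent_le hlx ?_
    rw [hq, show ω / 2 * (2 / (2 - ω)) = ω / (2 - ω) by field_simp, div_le_one (by linarith)]
    linarith
  have e3 : x ^ q ≤ x ^ 2 := by
    rw [← Real.rpow_two]
    exact Real.rpow_le_rpow_of_exponent_le hx hq2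
  calc U ≤ (144 * K + 1) ^ q * ((l * x) ^ (ω / 2 * q) * τ ^ (2 * (1 - ω) / (2 - ω)) * x ^ q) :=
        hfin
    _ ≤ (144 * K + 1) ^ 2 * (l * x * τ ^ (2 * (1 - ω) / (2 - ω)) * x ^ 2) := by gcongr
    _ ≤ _ := by
        have : 0 ≤ 6 * x ^ 3 * τ ^ (2 * (1 - ω) / (2 - ω)) * l := by positivity
        linarith

/-! ### Mass of the query regions -/

namespace Trace

variable {𝒳 : Type*} [MeasurableSpace 𝒳] {t : Trace 𝒳} {D : Measure (𝒳 × Bool)} {p : Params}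
  {H : Finset (Classifier 𝒳)} {m j : ℕ} {g hs : Classifier 𝒳}

/-- Sum of the masses of the query regions. -/
noncomputable def massSum (t : Trace 𝒳) (D : Measure (𝒳 × Bool)) (p : Params)
    (H : Finset (Classifier 𝒳)) (m : ℕ) : ℝ :=
  ∑ j ∈ Finset.Icc 1 m, p.len j * D.real {z | z.1 ∈ t.qreg p H j}

theorem massSum_mono (hv : p.Valid H.card) (hjm : j ≤ m) (hm : m ≤ p.M) :
    t.massSum D p H j ≤ t.massSum D p H m :=
  Finset.sum_le_sum_of_subset_of_nonneg (Finset.Icc_subset_Icc_right hjm) fun _ hi _ =>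
    mul_nonneg (hv.len_nonneg ((Finset.mem_Icc.1 hi).2.trans hm)) measureReal_nonneg

/-- The loss of `hs` is only incurred in the query region. -/
theorem mean_errInd_le [IsProbabilityMeasure D] (hR : t.EpochMeasurable p H j)
    (hhs : Measurable hs) (hsA : 2 ≤ j → hs ∈ t.A p H j) (hjA : 2 ≤ j → t.h j ∈ t.A p H j) :
    t.mean D p H (errInd hs) j ≤ D.real {z | z.1 ∈ t.qreg p H j} := by
  have hq : MeasurableSet {z : 𝒳 × Bool | z.1 ∈ t.qreg p H j} := measurable_fst hR.qreg
  rw [mean, ← integral_indicator_one hq]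
  refine integral_mono (integrable_score hR (measurable_errInd hhs) (abs_errInd_le _))
    ((integrable_const (1 : ℝ)).indicator hq) fun z => ?_
  by_cases hz : z.1 ∈ t.qreg p H j
  · simpa [hz] using errInd_le_one hs z.1 (t.lab p H j z)
  · have e : t.lab p H j z = hs z.1 := by
      simp only [lab, hz, if_false]
      exact eq_of_notMem_qreg hjA hsA hz
    simp [hz, e, errInd]

/-- The threshold in terms of the expected losses of `hs`. -/
theorem Controlled.thr_le (hc : t.Controlled D p H hs m) (hf : t.Follows D p H)
    (hv : p.Valid H.card) (hm : m ∈ Finset.Icc 1 p.M) (hhs : hs ∈ H) {U : ℝ} (hU0 : 0 ≤ U)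
    (hU : t.meanSum D p H m hs ≤ U) :
    t.thr p H.card m ≤ (4 * p.c₁ + p.c₁ ^ 2 * p.γ + 2 * p.c₂) *
      (√(p.acc H.card m * U) + p.acc H.card m * Real.log (p.τ m)) := by
  have hN : 1 ≤ H.card := Finset.card_pos.2 ⟨hs, hhs⟩
  have hT := thr_pos (t := t) hv hN hm
  have ha := hv.le_acc hN hm
  have hx := hv.one_le_log_τ hm
  have hc1 := hv.one_le_c₁
  have hc2 := hv.c₁_le_c₂
  have hγ := hv.γ_ge'
  have hL : t.minLoss p m ≤ 3 / 2 * U + p.γ * t.thr p H.card m / 8 := by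
    linarith [hf.minLoss_le hv hm hhs, (abs_le.1 hc.noise).2]
  have hTdef : t.thr p H.card m = p.c₁ * √(p.acc H.card m * t.minLoss p m)
    + p.c₂ * p.acc H.card m * Real.log (p.τ m) := rfl
  set a := p.acc H.card m
  set T := t.thr p H.card m
  set x := Real.log (p.τ m)
  set y := √(a * (p.γ * T) / 8)
  set s := √(a * U)
  have hy0 : 0 ≤ y := Real.sqrt_nonneg _
  have hs0 : 0 ≤ s := Real.sqrt_nonneg _
  have hy2 : y ^ 2 = a * (p.γ * T) / 8 := Real.sq_sqrt (by positivity)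
  have hs2 : s ^ 2 = a * U := Real.sq_sqrt (by positivity)
  have h1 : √(a * t.minLoss p m) ≤ 2 * s + y := by
    refine Real.sqrt_le_iff.2 ⟨by positivity, ?_⟩
    have h := mul_le_mul_of_nonneg_left hL (by linarith : 0 ≤ a)
    have : 0 ≤ a * U := by positivity
    have : 0 ≤ s * y := by positivity
    nlinarith
  -- The threshold occurs under its own square root. This is the inequality of the means, with
  -- weights such that half of T can be moved to the left side.
  have h2 : p.c₁ * y ≤ T / 2 + p.c₁ ^ 2 * p.γ * a / 16 := by
    have haγ : 0 < a * p.γ := by positivity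
    have : T / 2 = 4 * y ^ 2 / (a * p.γ) := by rw [hy2]; field_simp; ring
    rw [this, ← sub_nonneg]
    have e : 4 * y ^ 2 / (a * p.γ) + p.c₁ ^ 2 * p.γ * a / 16 - p.c₁ * y
        = (8 * y - p.c₁ * (a * p.γ)) ^ 2 / (16 * (a * p.γ)) := by field_simp; ring
    rw [e]
    positivity
  have h3 := mul_le_mul_of_nonneg_left h1 (by linarith : 0 ≤ p.c₁)
  have h4 : p.c₁ ^ 2 * p.γ * a ≤ p.c₁ ^ 2 * p.γ * (a * x) :=
    mul_le_mul_of_nonneg_left (le_mul_of_one_le_right (by linarith) hx) (by positivity)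
  have hc2' : 0 ≤ p.c₂ := by linarith
  have h5 : 0 ≤ p.c₁ ^ 2 * p.γ * s := by positivity
  have h6 : 0 ≤ p.c₂ * s := by positivity
  have h7 : 0 ≤ p.c₁ * (a * x) := by positivity
  have h8 : 0 ≤ p.c₁ ^ 2 * p.γ * (a * x) := by positivity
  linarith

/-- Mass of the query region after the first epoch. -/
theorem Controlled.mass_le [IsProbabilityMeasure D] (hc : t.Controlled D p H hs m)
    (hf : t.Follows D p H) (hv : p.Valid H.card) (hH : ∀ h ∈ H, Measurable h)
    (hbest : IsBest D H hs) (hm : m ∈ Finset.Icc 1 p.M) (hm1 : m + 1 ≤ p.M)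
    (hsA : ∀ j ∈ Finset.Icc 2 m, hs ∈ t.A p H j) {ζ ω θ : ℝ} (hζ : 0 < ζ) (hω : 0 < ω)
    (hT : Tsybakov D H hs ζ ω 1) (hθ : disCoeff D H hs ≤ ENNReal.ofReal θ) {Θ : ℝ}
    (hΘ : t.thr p H.card m ≤ Θ) :
    D.real {z | z.1 ∈ t.qreg p H (m + 1)} ≤ max θ 0 * (ζ * (3 * p.γ * Θ / p.τ m) ^ ω) := by
  have hN : 1 ≤ H.card := Finset.card_pos.2 ⟨hs, hbest.1⟩
  have hT0 := thr_pos (t := t) hv hN hm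
  have hγ := hv.γ_ge'
  have hτ := hv.three_le_cast hm
  have hτ0 : (0 : ℝ) < p.τ m := by linarith
  have hE := hf.epochMeasurable hH (Finset.mem_Icc.2 ⟨by omega, hm1⟩ : m + 1 ∈ Finset.Icc 1 p.M)
  have hΘ0 : 0 < Θ := hT0.trans_le hΘ
  set r := ζ * (3 * p.γ * Θ / p.τ m) ^ ω with hr
  have hr0 : 0 < r := by positivity
  have eq : t.qreg p H (m + 1) = t.region p H (m + 1) := if_neg (by
    have := (Finset.mem_Icc.1 hm).1; omega)
  -- Members of the set have empirical regret at most γT against `hs`; inverting the deviation bound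
  -- turns this into 2γT + γT, and favorable bias passes to the true excess error.
  have hdist : ∀ g ∈ t.A p H (m + 1), disagree D g hs ≤ r := by
    intro g hg
    rw [mem_A_succ_iff hv hm] at hg
    have h1 := hc.meanSum_sub_le hg.1 (W := p.γ * t.thr p H.card m)
      (by linarith [hf.minLoss_le hv hm hbest.1, hg.2])
    have h2 := (hf.meanSum_sub_le hv hH hN hbest hg.1 le_rfl (by omega) hsA).2
    have h3 : err D g - err D hs ≤ 3 * p.γ * Θ / p.τ m := by
      rw [le_div_iff₀ hτ0]
      have := mul_le_mul_of_nonneg_left hΘ (by linarith : 0 ≤ p.γ)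
      linarith
    have h4 : err D g - err D hs ≤ 1 := by
      have : err D g ≤ 1 := measureReal_le_one
      have : 0 ≤ err D hs := measureReal_nonneg
      linarith
    refine (hT g hg.1 h4).trans (mul_le_mul_of_nonneg_left ?_ hζ.le)
    exact Real.rpow_le_rpow (sub_nonneg.2 (hbest.2 g hg.1)) h3 hω.le
  -- Where two members of the set differ, one of them differs from `hs`.
  have hsub : t.qreg p H (m + 1) ⊆ {x | ∃ h ∈ H, hs x ≠ h x ∧ disagree D h hs ≤ r} := by
    rw [eq]
    rintro x ⟨g, hg, g', hg', hne⟩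
    by_cases h : hs x = g x
    · exact ⟨g', hg'.1, fun h' => hne (h.symm.trans h'), hdist _ hg'⟩
    · exact ⟨g, hg.1, h, hdist _ hg⟩
  have h1 : D.fst (t.qreg p H (m + 1)) / ENNReal.ofReal r ≤ ENNReal.ofReal θ := by
    refine le_trans ?_ hθ
    refine le_trans (ENNReal.div_le_div_right (measure_mono hsub) _) ?_
    exact le_iSup₂ (f := fun (r : ℝ) (_ : 0 < r) =>
      D.fst {x | ∃ h ∈ H, hs x ≠ h x ∧ disagree D h hs ≤ r} / ENNReal.ofReal r) r hr0
  rw [ENNReal.div_le_iff (by simpa using hr0) ENNReal.ofReal_ne_top] at h1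
  have h2 := ENNReal.toReal_mono (ENNReal.mul_ne_top ENNReal.ofReal_ne_top ENNReal.ofReal_ne_top) h1
  rw [ENNReal.toReal_mul, ENNReal.toReal_ofReal', ENNReal.toReal_ofReal hr0.le] at h2
  rw [← fst_real_eq hE.qreg]
  exact h2

/-- The bound on the expected number of queries. -/
theorem Concentrated.massSum_le [IsProbabilityMeasure D] (hc : t.Concentrated D p H hs)
    (hf : t.Follows D p H) (hv : p.Valid H.card) (hH : ∀ h ∈ H, Measurable h)
    (hbest : IsBest D H hs) (hm : m ∈ Finset.Icc 1 p.M) {ζ ω θ : ℝ} (hζ : 0 < ζ) (hω : 0 < ω)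
    (hω1 : ω ≤ 1) (hT : Tsybakov D H hs ζ ω 1) (hθ : disCoeff D H hs ≤ ENNReal.ofReal θ) {K : ℝ}
    (hK : K = 2 * (max θ 0 * ζ)
      * (3 * p.γ * (4 * p.c₁ + p.c₁ ^ 2 * p.γ + 2 * p.c₂)) ^ ω) :
    t.massSum D p H m ≤ (6 + (144 * K + 1) ^ 2) * Real.log (p.τ m) ^ 3
      * (p.τ m : ℝ) ^ (2 * (1 - ω) / (2 - ω)) * Real.log (H.card / p.δ) := by
  have hN : 1 ≤ H.card := Finset.card_pos.2 ⟨hs, hbest.1⟩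
  obtain ⟨hm1, hmM⟩ := Finset.mem_Icc.1 hm
  have hcon := fun j (hj : j ∈ Finset.Icc 1 p.M) => hc.controlled hf hv hH hbest hj
  have hsA : ∀ j, 2 ≤ j → j ≤ p.M → hs ∈ t.A p H j := fun j h1 h2 => by
    have := (hcon (j - 1) (Finset.mem_Icc.2 ⟨by omega, by omega⟩)).mem_A hv hN
      (Finset.mem_Icc.2 ⟨by omega, by omega⟩) hbest.1
    rwa [Nat.sub_add_cancel (by omega)] at this
  have hx := hv.one_le_log_τ hm
  have hτ := hv.three_le_cast hm
  have hγ := hv.γ_ge'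
  have hc1 := hv.one_le_c₁
  have hc2 := hv.c₁_le_c₂
  have hc2' : 0 ≤ p.c₂ := by linarith
  have ha := hv.le_acc hN hm
  have hθ0 : 0 ≤ max θ 0 := le_max_right _ _
  set C₁ := 4 * p.c₁ + p.c₁ ^ 2 * p.γ + 2 * p.c₂ with hC₁
  have hC₁0 : 0 < C₁ := by positivity
  have hK0 : 0 ≤ K := by rw [hK]; positivity
  have hlen : ∀ j ∈ Finset.Icc 1 m, 0 ≤ p.len j := fun i hi =>
    hv.len_nonneg ((Finset.mem_Icc.1 hi).2.trans hmM)
  set U := t.massSum D p H m with hU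
  have hU0 : 0 ≤ U := Finset.sum_nonneg fun j hj => mul_nonneg (hlen j hj) measureReal_nonneg
  set W := √(p.acc H.card m * U) + p.acc H.card m * Real.log (p.τ m) with hW
  have hW0 : 0 < W := by positivity
  have hthr : ∀ j, 1 ≤ j → j ≤ m → t.thr p H.card j ≤ C₁ * W := by
    intro j hj1 hjm
    have hjM : j ∈ Finset.Icc 1 p.M := Finset.mem_Icc.2 ⟨hj1, by omega⟩
    -- The point that closes the recursion: `hs` incurs loss only in query regions, so its expected
    -- loss is bounded by the quantity being estimated.
    have hS : t.meanSum D p H j hs ≤ U := by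
      refine le_trans ?_ (massSum_mono hv hjm hmM)
      refine Finset.sum_le_sum fun i hi => ?_
      have hi' := Finset.mem_Icc.1 hi
      exact mul_le_mul_of_nonneg_left (mean_errInd_le
        (hf.epochMeasurable hH (Finset.mem_Icc.2 ⟨hi'.1, by omega⟩)) (hH _ hbest.1)
        (fun h => hsA i h (by omega)) (fun h => hf.h_mem_A_of_mem hv hN h (by omega)))
        (hv.len_nonneg (by omega))
    refine ((hcon j hjM).thr_le hf hv hjM hbest.1 hU0 hS).trans
      (mul_le_mul_of_nonneg_left ?_ hC₁0.le)
    have h1 := hv.acc_le hj1 hjm hmM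
    have h2 := hv.log_τ_le hj1 hjm hmM
    have h3 := hv.one_le_log_τ hjM
    exact add_le_add (Real.sqrt_le_sqrt (mul_le_mul_of_nonneg_right h1 hU0))
      (mul_le_mul h1 h2 (by linarith) (by linarith))
  have hrest : ∀ j ∈ Finset.Icc 2 m, p.len j * D.real {z | z.1 ∈ t.qreg p H j}
      ≤ p.len j / p.τ (j - 1) * (max θ 0 * ζ * (3 * p.γ * C₁) ^ ω * W ^ ω
        * (p.τ m : ℝ) ^ (1 - ω)) := by
    intro j hj
    obtain ⟨hj2, hjm⟩ := Finset.mem_Icc.1 hj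
    obtain ⟨i, rfl⟩ : ∃ i, j = i + 1 := ⟨j - 1, by omega⟩
    have hi1 : 1 ≤ i := by omega
    have hiM : i ∈ Finset.Icc 1 p.M := Finset.mem_Icc.2 ⟨hi1, by omega⟩
    have hτi := hv.three_le_cast hiM
    have hτi0 : (0 : ℝ) < p.τ i := by linarith
    have h := (hcon i hiM).mass_le hf hv hH hbest hiM (by omega)
      (fun j hj => hsA j (Finset.mem_Icc.1 hj).1 (by
        have := (Finset.mem_Icc.1 hj).2; omega)) hζ hω hT hθ
      (hthr i hi1 (by omega))
    -- Writing τ_i^{-ω} as τ_i^{1-ω}/τ_i isolates the relative epoch lengths, whose sum is only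
    -- logarithmic.
    have e : (3 * p.γ * (C₁ * W) / p.τ i) ^ ω
        = (3 * p.γ * C₁) ^ ω * W ^ ω * ((p.τ i : ℝ) ^ (1 - ω) / p.τ i) := by
      rw [← mul_assoc, Real.div_rpow (by positivity) hτi0.le,
        Real.mul_rpow (by positivity) hW0.le, Real.rpow_sub hτi0, Real.rpow_one]
      field_simp
    rw [e] at h
    have hmono : (p.τ i : ℝ) ^ (1 - ω) ≤ (p.τ m : ℝ) ^ (1 - ω) :=
      Real.rpow_le_rpow hτi0.le (by exact_mod_cast hv.τ_le_τ (by omega) hmM) (by linarith)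
    rw [Nat.add_sub_cancel]
    have hl := hlen (i + 1) (Finset.mem_Icc.2 ⟨by omega, hjm⟩)
    calc p.len (i + 1) * D.real {z | z.1 ∈ t.qreg p H (i + 1)}
        ≤ p.len (i + 1) * (max θ 0 * (ζ * ((3 * p.γ * C₁) ^ ω * W ^ ω
          * ((p.τ i : ℝ) ^ (1 - ω) / p.τ i)))) := mul_le_mul_of_nonneg_left h hl
      _ = p.len (i + 1) / p.τ i * (max θ 0 * ζ * (3 * p.γ * C₁) ^ ω * W ^ ω
          * (p.τ i : ℝ) ^ (1 - ω)) := by ring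
      _ ≤ _ := by gcongr
  have hsum : U ≤ 3 + K * W ^ ω * ((p.τ m : ℝ) ^ (1 - ω) * Real.log (p.τ m)) := by
    have h1 : U = p.len 1 * D.real {z | z.1 ∈ t.qreg p H 1}
        + ∑ j ∈ Finset.Icc 2 m, p.len j * D.real {z | z.1 ∈ t.qreg p H j} := by
      rw [hU, massSum, ← Finset.add_sum_Ioc_eq_sum_Icc hm1]
      rfl
    have h2 : p.len 1 * D.real {z | z.1 ∈ t.qreg p H 1} ≤ 3 := by
      have : p.len 1 = 3 := by simp [Params.len, hv.τ_one, hv.τ_zero]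
      rw [this]
      have : D.real {z | z.1 ∈ t.qreg p H 1} ≤ 1 := measureReal_le_one
      linarith
    have h3 := Finset.sum_le_sum hrest
    rw [← Finset.sum_mul] at h3
    have h4 := mul_le_mul_of_nonneg_right (hv.sum_len_div_le hm)
      (by positivity : 0 ≤ max θ 0 * ζ * (3 * p.γ * C₁) ^ ω * W ^ ω * (p.τ m : ℝ) ^ (1 - ω))
    have h5 : K * W ^ ω * ((p.τ m : ℝ) ^ (1 - ω) * Real.log (p.τ m))
        = 2 * Real.log (p.τ m)
          * (max θ 0 * ζ * (3 * p.γ * C₁) ^ ω * W ^ ω * (p.τ m : ℝ) ^ (1 - ω)) := by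
      rw [hK]; ring
    linarith
  exact le_of_self_bound hω hω1 (hv.one_le_log_card_div hN) hx (by linarith) hK0 hsum

end Trace

theorem sum_inv_mul_succ_le (M : ℕ) :
    ∑ m ∈ Finset.Icc 1 M, 1 / (((m : ℝ) + 1) * (m + 2)) ≤ 1 := by
  have : ∑ m ∈ Finset.Icc 1 M, 1 / (((m : ℝ) + 1) * (m + 2)) = 1 / 2 - 1 / ((M : ℝ) + 2) := by
    induction M with
    | zero => simp
    | succ M ih =>
      rw [Finset.sum_Icc_succ_top (by omega), ih]
      push_cast
      field_simp
      ring
  rw [this]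
  have : (0 : ℝ) < 1 / ((M : ℝ) + 2) := by positivity
  linarith

/-- The factors count scales, classifiers and the four linear combinations. The exponential equals
(δ/N)⁴ τ_m⁻⁴; one factor δ/N cancels N, one τ_m pays for the scales, and the rest is at most δ/τ_m²
with τ_m ≥ m + 2. -/
theorem Params.Valid.union_bound {p : Params} {N m : ℕ} (hv : p.Valid N) (hN : 1 ≤ N)
    (hm : m ∈ Finset.Icc 1 p.M) :
    ((p.τ m : ℝ) + 1) * (N * (4 * Real.exp (-(p.acc N m / 8))))
      ≤ p.δ * (1 / (((m : ℝ) + 1) * (m + 2))) := by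
  obtain ⟨h1, h2⟩ := Finset.mem_Icc.1 hm
  have hτ := hv.three_le_cast hm
  have hτm : (m : ℝ) + 2 ≤ p.τ m := by exact_mod_cast hv.add_two_le_τ h1 h2
  have hτ0 : (0 : ℝ) < p.τ m := by linarith
  have hN' : (0 : ℝ) < N := by exact_mod_cast hN
  have hδ := hv.δ_pos
  have hℓ := hv.one_le_log_card_div hN
  have hr : 2 ≤ N / p.δ := by
    have := (Real.le_log_iff_exp_le (div_pos hN' hδ)).1 hℓ
    linarith [Real.exp_one_gt_d9]
  have he : Real.exp (-(p.acc N m / 8)) = (p.δ / N) ^ 4 / (p.τ m : ℝ) ^ 4 := by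
    have : -(p.acc N m / 8) = -((4 : ℕ) * Real.log (N / p.δ) + (4 : ℕ) * Real.log (p.τ m)) := by
      unfold Params.acc; push_cast; ring
    rw [this, Real.exp_neg, Real.exp_add, Real.exp_nat_mul, Real.exp_nat_mul,
      Real.exp_log (div_pos hN' hδ), Real.exp_log hτ0]
    field_simp
  rw [he]
  have hq : p.δ / N ≤ 1 / 2 := by
    rw [div_le_div_iff₀ hN' two_pos]
    rw [le_div_iff₀ hδ] at hr
    linarith
  have hq3 : (p.δ / N) ^ 3 ≤ 1 / 8 := by
    have := pow_le_pow_left₀ (by positivity) hq 3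
    linarith
  have e : ((p.τ m : ℝ) + 1) * (N * (4 * ((p.δ / N) ^ 4 / (p.τ m : ℝ) ^ 4)))
      = p.δ * ((p.δ / N) ^ 3 * (4 * ((p.τ m : ℝ) + 1) / (p.τ m : ℝ) ^ 4)) := by
    field_simp
  rw [e]
  refine mul_le_mul_of_nonneg_left ?_ hδ.le
  have h3 : 4 * ((p.τ m : ℝ) + 1) / (p.τ m : ℝ) ^ 4 ≤ 8 / (p.τ m : ℝ) ^ 2 := by
    rw [div_le_div_iff₀ (by positivity) (by positivity)]
    have : 4 * ((p.τ m : ℝ) + 1) ≤ 8 * (p.τ m : ℝ) ^ 2 := by nlinarith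
    nlinarith [sq_nonneg (p.τ m : ℝ)]
  calc (p.δ / N) ^ 3 * (4 * ((p.τ m : ℝ) + 1) / (p.τ m : ℝ) ^ 4)
      ≤ 1 / 8 * (8 / (p.τ m : ℝ) ^ 2) := mul_le_mul hq3 h3 (by positivity) (by norm_num)
    _ = 1 / (p.τ m : ℝ) ^ 2 := by ring
    _ ≤ _ := by
        refine one_div_le_one_div_of_le (by positivity) ?_
        nlinarith

/-! ### Failure probability and expected number of queries -/

namespace IsRun

variable {𝒳 Ω : Type*} [MeasurableSpace 𝒳] {mΩ : MeasurableSpace Ω}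
  {D : Measure (𝒳 × Bool)} {H : Finset (Classifier 𝒳)} {p : Params}
  {μ : Measure Ω} {ℱ : Filtration ℕ mΩ} {T : Ω → Trace 𝒳} {hs : Classifier 𝒳}

/-- Concentration fails with probability at most `δ`. -/
theorem measure_not_concentrated_le [IsProbabilityMeasure μ] [IsProbabilityMeasure D]
    (hr : IsRun D H p μ ℱ T) (hv : p.Valid H.card) (hH : ∀ h ∈ H, Measurable h) (hhs : hs ∈ H) :
    μ.real {a | ¬ (T a).Concentrated D p H hs} ≤ p.δ := by
  have hN : 1 ≤ H.card := Finset.card_pos.2 ⟨hs, hhs⟩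
  set S : ℕ → ℕ → Classifier 𝒳 → ℝ × ℝ → Set Ω := fun m k g c =>
    {a | p.acc H.card m / 8 < ∑ i ∈ Finset.Icc 1 (p.τ m),
      ((T a).score p H (p.grid m k) (linInd c g hs) i
        - (T a).drift D p H (p.grid m k) (linInd c g hs) (p.epoch i))} with hS
  have hsub : {a | ¬ (T a).Concentrated D p H hs} ⊆ ⋃ m ∈ Finset.Icc 1 p.M,
      ⋃ k ∈ Finset.range (p.τ m + 1), ⋃ g ∈ H, ⋃ c ∈ coeffs, S m k g c := by
    intro a ha
    simp only [Set.mem_ofPred_eq, Trace.Concentrated, not_forall, not_le] at ha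
    obtain ⟨m, hm, k, hk, g, hg, c, hc, h⟩ := ha
    exact Set.mem_biUnion hm (Set.mem_biUnion hk (Set.mem_biUnion hg (Set.mem_biUnion hc h)))
  have hS1 : ∀ m ∈ Finset.Icc 1 p.M, ∀ k ∈ Finset.range (p.τ m + 1), ∀ g ∈ H, ∀ c ∈ coeffs,
      μ.real (S m k g c) ≤ Real.exp (-(p.acc H.card m / 8)) := by
    intro m hm k _ g hg c hc
    have hγ := hv.γ_ge'
    have hc2 : 1 ≤ p.c₂ := hv.one_le_c₁.trans hv.c₁_le_c₂
    have hx := hv.one_le_log_τ hm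
    have hpos : 0 < p.grid m k := by unfold Params.grid; positivity
    have hle : p.grid m k ≤ 1 := by
      have h1 : 216 ≤ p.γ * p.c₂ * Real.log (p.τ m) * ((k : ℝ) + 1) := by
        have : 1 ≤ p.c₂ * Real.log (p.τ m) * ((k : ℝ) + 1) :=
          one_le_mul_of_one_le_of_one_le (one_le_mul_of_one_le_of_one_le hc2 hx)
            (by linarith [(Nat.cast_nonneg k : (0 : ℝ) ≤ k)])
        nlinarith
      rw [Params.grid, div_le_one (by linarith)]
      linarith
    exact hr.measure_score_gt_le hv hH (measurable_linInd c (hH g hg) (hH hs hhs))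
      (abs_linInd_le hc g hs) hpos hle (Finset.mem_Icc.1 hm).2 _
  have hcard : (coeffs.card : ℝ) ≤ 4 := by
    have : coeffs.card ≤ 4 := Finset.card_le_four
    exact_mod_cast this
  calc μ.real {a | ¬ (T a).Concentrated D p H hs}
      ≤ ∑ m ∈ Finset.Icc 1 p.M, ∑ k ∈ Finset.range (p.τ m + 1), ∑ g ∈ H, ∑ c ∈ coeffs,
          μ.real (S m k g c) := by
        refine (measureReal_mono hsub (measure_ne_top μ _)).trans ?_
        refine (measureReal_biUnion_finset_le _ _).trans (Finset.sum_le_sum fun m _ => ?_)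
        refine (measureReal_biUnion_finset_le _ _).trans (Finset.sum_le_sum fun k _ => ?_)
        refine (measureReal_biUnion_finset_le _ _).trans (Finset.sum_le_sum fun g _ => ?_)
        exact measureReal_biUnion_finset_le _ _
    _ ≤ ∑ m ∈ Finset.Icc 1 p.M, ∑ k ∈ Finset.range (p.τ m + 1), ∑ g ∈ H, ∑ c ∈ coeffs,
          Real.exp (-(p.acc H.card m / 8)) :=
        Finset.sum_le_sum fun m hm => Finset.sum_le_sum fun k hk => Finset.sum_le_sum fun g hg =>
          Finset.sum_le_sum fun c hc => hS1 m hm k hk g hg c hc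
    _ ≤ ∑ m ∈ Finset.Icc 1 p.M, p.δ * (1 / (((m : ℝ) + 1) * (m + 2))) := by
        refine Finset.sum_le_sum fun m hm => ?_
        simp only [Finset.sum_const, nsmul_eq_mul, Finset.card_range]
        refine le_trans ?_ (hv.union_bound hN hm)
        push_cast
        gcongr
    _ ≤ p.δ := by
        rw [← Finset.mul_sum]
        exact mul_le_of_le_one_right hv.δ_pos.le (sum_inv_mul_succ_le _)

/-- The sum of the conditional query probabilities is at most the sum of the masses of the query
regions. -/
theorem sum_condExp_query_le [IsProbabilityMeasure μ] [IsProbabilityMeasure D]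
    (hr : IsRun D H p μ ℱ T) (hv : p.Valid H.card) (hH : ∀ h ∈ H, Measurable h) {m : ℕ}
    (hm : m ≤ p.M) :
    ∀ᵐ a ∂μ, ∑ i ∈ Finset.Icc 1 (p.τ m), (μ[fun a => (T a).query i|ℱ (i - 1)]) a
      ≤ (T a).massSum D p H m := by
  have h : ∀ᵐ a ∂μ, ∀ i ∈ Finset.Icc 1 (p.τ m), (μ[fun a => (T a).query i|ℱ (i - 1)]) a
      ≤ D.real {z | z.1 ∈ (T a).qreg p H (p.epoch i)} := by
    rw [Filter.eventually_all_finset]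
    exact fun i hi => hr.condExp_query_le hv hH
      (Finset.Icc_subset_Icc_right (hv.τ_le_τ hm le_rfl) hi)
  filter_upwards [h] with a ha
  refine (Finset.sum_le_sum ha).trans (le_of_eq ?_)
  exact hv.sum_epoch (fun j => D.real {z | z.1 ∈ (T a).qreg p H j}) hm

/-- Bounds on the number of queries in an event `E` and overall. -/
theorem integral_numQueries_le [IsProbabilityMeasure μ] (hr : IsRun D H p μ ℱ T)
    (hv : p.Valid H.card) {m : ℕ} (hm : m ≤ p.M) {E : Set Ω} (hE : MeasurableSet E)
    (hEδ : 1 - p.δ ≤ μ.real E) {B : ℝ} (hB : 0 ≤ B)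
    (h : ∀ᵐ a ∂μ, a ∈ E →
      ∑ i ∈ Finset.Icc 1 (p.τ m), (μ[fun a => (T a).query i|ℱ (i - 1)]) a ≤ B) :
    ∫ a in E, (T a).numQueries p m ∂μ ≤ B ∧
      ∫ a, (T a).numQueries p m ∂μ ≤ B + p.δ * p.τ m := by
  have hmeas : ∀ i ∈ Finset.Icc 1 (p.τ m), Measurable fun a => (T a).query i := fun i hi =>
    (hr.measurable_query' (Finset.Icc_subset_Icc_right (hv.τ_le_τ hm le_rfl) hi)).mono
      (ℱ.le i) le_rfl
  have h1 : ∫ a in E, (T a).numQueries p m ∂μ ≤ B :=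
    setIntegral_sum_le_of_condExp (f := fun i a => (T a).query i) hmeas
      (fun i _ a => Trace.query_nonneg _ _) (fun i _ a => Trace.query_le_one _ _) hE hB h
  refine ⟨h1, ?_⟩
  have hq : ∀ a, (T a).numQueries p m ≤ p.τ m := fun a => by
    refine (Finset.sum_le_card_nsmul _ _ 1 fun i _ => Trace.query_le_one _ _).trans ?_
    simp
  have hq0 : ∀ a, 0 ≤ (T a).numQueries p m := fun a =>
    Finset.sum_nonneg fun i _ => Trace.query_nonneg _ _
  have hint : Integrable (fun a => (T a).numQueries p m) μ :=
    integrable_of_abs_le (c := p.τ m) (Finset.measurable_sum _ hmeas) fun a => by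
      rw [abs_of_nonneg (hq0 a)]; exact hq a
  have h2 : ∫ a in Eᶜ, (T a).numQueries p m ∂μ ≤ p.δ * p.τ m := by
    calc ∫ a in Eᶜ, (T a).numQueries p m ∂μ ≤ ∫ _ in Eᶜ, (p.τ m : ℝ) ∂μ :=
          integral_mono hint.integrableOn (integrable_const _) hq
      _ = μ.real Eᶜ * p.τ m := by simp
      _ ≤ p.δ * p.τ m := by
          refine mul_le_mul_of_nonneg_right ?_ (Nat.cast_nonneg _)
          rw [probReal_compl_eq_one_sub hE]
          linarith
  rw [← integral_add_compl hE hint]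
  linarith

end IsRun

end ActiveCover

theorem mainTheorem7 :
    ∃ k : ℕ, ∀ ζ ω θ γ c₁ c₂ : ℝ, 0 < ζ → 0 < ω → ω ≤ 1 → ∃ C : ℝ, 0 < C ∧
      ∀ (𝒳 Ω : Type*) [MeasurableSpace 𝒳] [mΩ : MeasurableSpace Ω]
        (D : Measure (𝒳 × Bool)) [IsProbabilityMeasure D]
        (H : Finset (ActiveCover.Classifier 𝒳)) (hs : ActiveCover.Classifier 𝒳)
        (p : ActiveCover.Params) (μ : Measure Ω) [IsProbabilityMeasure μ]
        (ℱ : Filtration ℕ mΩ) (T : Ω → ActiveCover.Trace 𝒳),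
        (∀ h ∈ H, Measurable h) →
        ActiveCover.IsBest D H hs →
        ActiveCover.Tsybakov D H hs ζ ω 1 →
        ActiveCover.disCoeff D H hs ≤ ENNReal.ofReal θ →
        p.Valid H.card → p.γ = γ → p.c₁ = c₁ → p.c₂ = c₂ →
        ActiveCover.IsRun D H p μ ℱ T →
        ∃ E : Set Ω, MeasurableSet E ∧ 1 - p.δ ≤ μ.real E ∧
          ∀ m ∈ Finset.Icc 1 p.M, ∀ B : ℝ,
            B = C * Real.log (p.τ m) ^ k * (p.τ m : ℝ) ^ (2 * (1 - ω) / (2 - ω))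
              * Real.log (H.card / p.δ) →
            (∀ᵐ a ∂μ, a ∈ E →
              ∑ i ∈ Finset.Icc 1 (p.τ m), (μ[fun a => (T a).query i | ℱ (i - 1)]) a ≤ B) ∧
            ∫ a in E, (T a).numQueries p m ∂μ ≤ B ∧
            ∫ a, (T a).numQueries p m ∂μ ≤ B + p.δ * p.τ m := by
  -- Three logarithms come from `le_of_self_bound`: one from the factor lx and two from x^q ≤ x².
  refine ⟨3, fun ζ ω θ γ c₁ c₂ hζ hω hω1 => ?_⟩
  set K := 2 * (max θ 0 * ζ) * (3 * γ * (4 * c₁ + c₁ ^ 2 * γ + 2 * c₂)) ^ ω with hK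
  refine ⟨6 + (144 * K + 1) ^ 2, by positivity, ?_⟩
  intro 𝒳 Ω _ mΩ D _ H hs p μ _ ℱ T hH hbest hT hθ hv hγ hc₁ hc₂ hr
  have hN : 1 ≤ H.card := Finset.card_pos.2 ⟨hs, hbest.1⟩
  set bad : Set Ω := {a | ¬ (T a).Concentrated D p H hs} with hbad
  -- The measurable hull has the same measure as the failure set, so measurability of the
  -- concentration event is not needed.
  have hEm : MeasurableSet (toMeasurable μ bad)ᶜ := (measurableSet_toMeasurable μ bad).compl
  have hEδ : 1 - p.δ ≤ μ.real (toMeasurable μ bad)ᶜ := by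
    rw [probReal_compl_eq_one_sub (measurableSet_toMeasurable μ bad), measureReal_def,
      measure_toMeasurable, ← measureReal_def]
    linarith [hr.measure_not_concentrated_le hv hH hbest.1]
  refine ⟨(toMeasurable μ bad)ᶜ, hEm, hEδ, fun m hm B hB => ?_⟩
  have hmM := (Finset.mem_Icc.1 hm).2
  have hB0 : 0 ≤ B := by
    have h1 := hv.one_le_log_τ hm
    have h2 := hv.one_le_log_card_div hN
    rw [hB]
    positivity
  have hmass : ∀ a ∈ (toMeasurable μ bad)ᶜ, (T a).massSum D p H m ≤ B := by
    intro a ha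
    have hconc : (T a).Concentrated D p H hs := by
      by_contra hcon
      exact ha (subset_toMeasurable μ bad hcon)
    rw [hB]
    exact hconc.massSum_le (hr.follows a) hv hH hbest hm hζ hω hω1 hT hθ
      (by rw [hK, hγ, hc₁, hc₂])
  have h1 : ∀ᵐ a ∂μ, a ∈ (toMeasurable μ bad)ᶜ →
      ∑ i ∈ Finset.Icc 1 (p.τ m), (μ[fun a => (T a).query i | ℱ (i - 1)]) a ≤ B := by
    filter_upwards [hr.sum_condExp_query_le hv hH hmM] with a ha haE
    exact ha.trans (hmass a haE)
  exact ⟨h1, hr.integral_numQueries_le hv hmM hEm hEδ hB0 h1⟩
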